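/- **Setting.** Let $\{\nu_\theta\}_{\theta\in\Theta}$ be a canonical one-parameter exponential family on $\mathbb R$ with reference measure $\rho$: $\frac{d\nu_\theta}{d\rho}(x)=\exp(\theta x-b(\theta))$, $b(\theta)=\log\int e^{\theta x}\,d\rho(x)$, $\Theta=\{\theta: b(\theta)<\infty\}$. Assume that $b$ is twice differentiable at every point of $\Theta$ (so that $\Theta$ is open) and that the variances of the $\nu_\theta$ are bounded by a constant. Let $I$ be the set of means of the $\nu_\theta$, and for means $\mu,\mu'\in I$ of $\nu_\theta,\nu_{\theta'}$ put $\mathrm{kl}(\mu,\mu')=b(\theta')-b(\theta)-b'(\theta)(\theta'-\theta)$, extended by continuity to boundary points $\mu$ of $I$. A bandit instance with $K\ge 2$ arms is a vector $\mu\in I^K$ with a unique largest entry; let $i^*$ be the index of that entry, $\Delta_i=\mu_{i^*}-\mu_i$ and $\mathrm I^*(\mu)=\sum_{i\ne i^*}\Delta_i/\mathrm{kl}(\mu_i,\mu_{i^*})$. At each time $t\ge 1$ an arm $A_t$ is pulled and a reward $X_t$ is drawn from the member of the family with mean $\mu_{A_t}$, independently of the past. $N_i(t)$ and $\hat\mu_i(t)$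 are the number of pulls and the empirical mean of arm $i$ up to time $t$. **Algorithm (Double KL-UCB), with confidence level $\delta\in(0,1)$.** Put $f(t)=3\log t$, $g(\delta,t)=\log(2Kt^2/\delta)$ and $\beta(\delta)=1-\min\{1/\log\log(1/\delta),1/2\}$, where $1/\log\log(1/\delta)$ is read as $+\infty$ (so that $\beta(\delta)=1/2$) when $\log\log(1/\delta)\le 0$. Pull each arm once during the first $K$ steps. At each $t>K$ let $U_i^f(t)$ and $U_i^g(t)$ be the suprema of the sets of all $m\in I$ with $\mathrm{kl}(\hat\mu_i(t-1),m)\le f(t)/N_i(t-1)$, respectively $\le g(\delta,t)/N_i(t-1)$, and let $L_i^g(t)$ be the infimum of the latter set. Let $A_t^f\in\arg\max_i U_i^f(t)$ and $A_t^g\in\arg\max_{i\ne A_t^f}U_i^g(t)$, ties being broken by any fixed measurable rules that may depend on the time and on the history. Flip an independent coin that shows heads with probability $\beta(\delta)$; pull $A_t=A_t^f$ on heads and $A_t=A_t^g$ on tails. Stop at the first time $\tau_\delta=t>K$ with $L^g_{A_t^f}(t)>U^g_{A_t^g}(t)$ (the pull at this time is made), and output $i_{\mathrm{out}}=A^f_{\tau_\delta}$.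 Let $R(\tau_\delta)=\sum_{t=1}^{\tau_\delta}(\mu_{i^*}-X_t)$. **Theorem.** For every $\delta\in(0,1)$ the algorithm is $\delta$-PAC: for every bandit instance, $\tau_\delta<\infty$ almost surely and $\mathbb P(i_{\mathrm{out}}\ne i^*)\le\delta$. Moreover, for every bandit instance $\mu$, $R(\tau_\delta)$ is integrable for all sufficiently small $\delta$, $$\limsup_{\delta\to0^+}\frac{\mathbb E_\mu[R(\tau_\delta)]}{\log(1/\delta)}\le \mathrm I^*(\mu)\quad\text{(asymptotic optimality)},\qquad \lim_{\delta\to0^+}\frac{\mathbb E_\mu[\tau_\delta]}{\log(1/\delta)\,(\log\log(1/\delta))^2}=0 .$$ -/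

import Mathlib

open MeasureTheory ProbabilityTheory Filter Topology

noncomputable section

/-! ## Canonical one-parameter exponential families -/

/-- A canonical one-parameter exponential family on `ℝ`, generated by a reference measure `ρ`.
The natural parameter set is `Θ = {θ | ∫ exp (θ x) dρ(x) < ∞}` and the log-partition function is
`b(θ) = log ∫ exp (θ x) dρ(x)`, i.e. `cgf id ρ θ`. -/
structure ExpFamily where
  /-- the reference measure -/
  ρ : Measure ℝ
  ρ_ne_zero : ρ ≠ 0
  /-- `b` is (two-sidedly, hence infinitely often) differentiable at all points of `Θ`: as `b` is
  `∞` off `Θ` and smooth on the interior of `Θ`, this says that `Θ` is open. -/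
  isOpen_param : IsOpen (integrableExpSet id ρ)
  /-- the variances of the members of the family are bounded by a constant -/
  variance_bdd : ∃ V : ℝ, 0 < V ∧
    ∀ θ ∈ integrableExpSet id ρ, Var[id; ρ.tilted (fun x => θ * x)] ≤ V

namespace ExpFamily

/-- The natural parameter set `Θ = {θ | b(θ) < ∞}`. -/
def Θ (F : ExpFamily) : Set ℝ := integrableExpSet id F.ρ

/-- The log-partition function `b(θ) = log ∫ exp (θ x) dρ(x)`. -/
def b (F : ExpFamily) (θ : ℝ) : ℝ := cgf id F.ρ θ

/-- The member `ν_θ` of the family, with density `exp (θ x - b(θ))` with respect to `ρ`. -/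
def law (F : ExpFamily) (θ : ℝ) : Measure ℝ := F.ρ.tilted (fun x => θ * x)

/-- The mean of `ν_θ`. -/
def mean (F : ExpFamily) (θ : ℝ) : ℝ := ∫ x, x ∂(F.law θ)

/-- The set `I` of all means of members of the family. -/
def I (F : ExpFamily) : Set ℝ := F.mean '' F.Θ

/-- The natural parameter of the member of the family with mean `m` (for `m ∈ I`). -/
def natParam (F : ExpFamily) (m : ℝ) : ℝ := Function.invFunOn F.mean F.Θ m

/-- The Kullback-Leibler divergence between the members with means `m` and `m'` in `I`. -/
def kl (F : ExpFamily) (m m' : ℝ) : ℝ :=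
  F.b (F.natParam m') - F.b (F.natParam m)
    - deriv F.b (F.natParam m) * (F.natParam m' - F.natParam m)

/-- The divergence `kl(x, m')` for an arbitrary first argument. An empirical mean `x` may lie on the
boundary of `I` (e.g. `0` or `1` for Bernoulli rewards), where `kl(x, m')` is understood as the
limit from inside `I`. The convex-conjugate expression
`sup_θ (θ x - b(θ)) - (θ' x - b(θ'))`, with `θ'` the natural parameter of `m'`, is that extension;
`klExt_eq_kl` says that it is `kl` on `I`. -/
def klExt (F : ExpFamily) (x m' : ℝ) : EReal :=
  ⨆ θ ∈ F.Θ, (((θ - F.natParam m') * x - (F.b θ - F.b (F.natParam m')) : ℝ) : EReal)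

lemma natParam_mem (F : ExpFamily) {m : ℝ} (hm : m ∈ F.I) : F.natParam m ∈ F.Θ :=
  Function.invFunOn_mem hm

lemma mean_natParam (F : ExpFamily) {m : ℝ} (hm : m ∈ F.I) : F.mean (F.natParam m) = m :=
  Function.invFunOn_eq hm

lemma mem_interior (F : ExpFamily) {θ : ℝ} (hθ : θ ∈ F.Θ) :
    θ ∈ interior (integrableExpSet id F.ρ) := by
  rw [F.isOpen_param.interior_eq]; exact hθ

lemma mean_eq_deriv (F : ExpFamily) {θ : ℝ} (hθ : θ ∈ F.Θ) : F.mean θ = deriv F.b θ :=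
  integral_tilted_mul_self (X := id) (μ := F.ρ) (F.mem_interior hθ)

lemma isProbabilityMeasure_law (F : ExpFamily) {θ : ℝ} (hθ : θ ∈ F.Θ) :
    IsProbabilityMeasure (F.law θ) := by
  have : NeZero F.ρ := ⟨F.ρ_ne_zero⟩
  exact isProbabilityMeasure_tilted hθ

/-- The tangent of `b` at a point of `Θ` lies below `b` on `Θ`. -/
lemma tangent_le (F : ExpFamily) {θ₀ θ : ℝ} (h₀ : θ₀ ∈ F.Θ) (hθ : θ ∈ F.Θ) :
    F.b θ₀ + deriv F.b θ₀ * (θ - θ₀) ≤ F.b θ := by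
  have : NeZero F.ρ := ⟨F.ρ_ne_zero⟩
  have := F.isProbabilityMeasure_law h₀
  set m := F.mean θ₀ with hm
  have hpos₀ : 0 < mgf id F.ρ θ₀ := mgf_pos' F.ρ_ne_zero h₀
  have hpos : 0 < mgf id F.ρ θ := mgf_pos' F.ρ_ne_zero hθ
  have hX : Integrable (fun x : ℝ => x) (F.law θ₀) :=
    (memLp_tilted_mul (X := id) (μ := F.ρ) (F.mem_interior h₀) 1).integrable (by simp)
  have key : ∫ x, Real.exp ((θ - θ₀) * x) ∂(F.law θ₀) = mgf id F.ρ θ / mgf id F.ρ θ₀ := by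
    have h := integral_tilted_mul_eq_mgf (X := id) (μ := F.ρ) (t := θ₀)
      (fun x : ℝ => Real.exp ((θ - θ₀) * x))
    simp only [id] at h
    unfold law
    have hθ' : mgf id F.ρ θ = ∫ x, Real.exp (θ * x) ∂F.ρ := rfl
    rw [h, hθ', ← integral_div]
    refine integral_congr_ae (Eventually.of_forall fun x => ?_)
    simp only [smul_eq_mul]
    rw [div_mul_eq_mul_div, ← Real.exp_add]
    congr 2
    ring
  have hint : Integrable (fun x : ℝ => Real.exp ((θ - θ₀) * x)) (F.law θ₀) := by
    by_contra hni
    rw [integral_undef hni] at key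
    exact absurd key (div_pos hpos hpos₀).ne
  have hle : Real.exp ((θ - θ₀) * m) ≤ mgf id F.ρ θ / mgf id F.ρ θ₀ := by
    rw [← key]
    have h1 : ∫ x, (Real.exp ((θ - θ₀) * m) * (1 + (θ - θ₀) * (x - m))) ∂(F.law θ₀)
        = Real.exp ((θ - θ₀) * m) := by
      have hi : Integrable (fun x : ℝ => (θ - θ₀) * (x - m)) (F.law θ₀) :=
        (hX.sub (integrable_const m)).const_mul _
      rw [integral_const_mul, integral_add (integrable_const _) hi, integral_const_mul,
        integral_sub hX (integrable_const m)]
      simp [hm, mean]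
    rw [← h1]
    refine integral_mono ?_ hint fun x => ?_
    · exact ((integrable_const _).add ((hX.sub (integrable_const m)).const_mul _)).const_mul _
    · have h2 := Real.add_one_le_exp ((θ - θ₀) * (x - m))
      calc Real.exp ((θ - θ₀) * m) * (1 + (θ - θ₀) * (x - m))
          ≤ Real.exp ((θ - θ₀) * m) * Real.exp ((θ - θ₀) * (x - m)) := by
            refine mul_le_mul_of_nonneg_left ?_ (Real.exp_pos _).le
            linarith
        _ = Real.exp ((θ - θ₀) * x) := by
            rw [← Real.exp_add]; congr 1; ring
  have hlog := Real.log_le_log (Real.exp_pos _) hle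
  rw [Real.log_exp, Real.log_div hpos.ne' hpos₀.ne'] at hlog
  rw [← F.mean_eq_deriv h₀]
  change cgf id F.ρ θ₀ + m * (θ - θ₀) ≤ cgf id F.ρ θ
  unfold cgf
  linarith

/-- On `I`, the extension is the divergence itself. -/
lemma klExt_eq_kl (F : ExpFamily) {m m' : ℝ} (hm : m ∈ F.I) :
    F.klExt m m' = (F.kl m m' : EReal) := by
  have h₀ := F.natParam_mem hm
  have hd : deriv F.b (F.natParam m) = m := by rw [← F.mean_eq_deriv h₀, F.mean_natParam hm]
  refine le_antisymm (iSup₂_le fun θ hθ => ?_) ?_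
  · have ht := F.tangent_le h₀ hθ
    rw [EReal.coe_le_coe_iff, kl]
    rw [hd] at ht ⊢
    linarith
  · refine le_trans (le_of_eq ?_) (le_iSup₂ (F.natParam m) h₀)
    rw [EReal.coe_eq_coe_iff, kl, hd]
    ring

end ExpFamily

/-! ## Bandit instances and the environment -/

/-- A bandit instance with `K` arms and rewards in the family `F`: a vector of means with a unique
optimal arm. (The optimal arm may be any of the arms, as the agent does not know its index.) -/
structure Bandit (F : ExpFamily) (K : ℕ) where
  /-- the means of the arms -/
  μ : Fin K → ℝ
  mem_I : ∀ i, μ i ∈ F.I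
  /-- the unique optimal arm -/
  best : Fin K
  lt_best : ∀ i, i ≠ best → μ i < μ best

/-- The outcomes: `ω.1 (i, s)` is the reward that the `(s+1)`-st pull of arm `i` yields, and `ω.2 n`
tells whether the coin that is flipped at time step `n + 1` shows heads. -/
abbrev Outcome (K : ℕ) : Type := (Fin K × ℕ → ℝ) × (ℕ → Bool)

/-- The probability of heads `β(δ) = 1 - min {1 / log log (1/δ), 1/2}`; if `log log (1/δ) ≤ 0`, the
quotient `1 / log log (1/δ)` is read as `+∞`. -/
def coinBias (δ : ℝ) : ℝ :=
  if 0 < Real.log (Real.log (1 / δ)) then 1 - min (1 / Real.log (Real.log (1 / δ))) (1 / 2)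
  else 1 / 2

lemma coinBias_mem (δ : ℝ) : coinBias δ ∈ unitInterval := by
  unfold coinBias
  split_ifs with h
  · have h1 : 0 ≤ min (1 / Real.log (Real.log (1 / δ))) (1 / 2) :=
      le_min (one_div_nonneg.mpr h.le) (by norm_num)
    have h2 : min (1 / Real.log (Real.log (1 / δ))) (1 / 2) ≤ 1 / 2 := min_le_right _ _
    constructor <;> linarith
  · constructor <;> norm_num

/-- The law of a coin that shows heads with probability `β(δ)`. -/
def coinLaw (δ : ℝ) : Measure Bool := bernoulliMeasure true false ⟨coinBias δ, coinBias_mem δ⟩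

namespace Bandit

/-- The law of the outcomes: all rewards and coins are independent, a reward of arm `i` follows the
member of the family with mean `μ i`, and the coins have bias `β(δ)`. -/
def prob {F : ExpFamily} {K : ℕ} (B : Bandit F K) (δ : ℝ) : Measure (Outcome K) :=
  (Measure.infinitePi fun p : Fin K × ℕ => F.law (F.natParam (B.μ p.1))).prod
    (Measure.infinitePi fun _ : ℕ => coinLaw δ)

instance {F : ExpFamily} {K : ℕ} (B : Bandit F K) (δ : ℝ) : IsProbabilityMeasure (B.prob δ) := by
  have : ∀ p : Fin K × ℕ, IsProbabilityMeasure (F.law (F.natParam (B.μ p.1))) := fun p =>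
    F.isProbabilityMeasure_law (F.natParam_mem (B.mem_I p.1))
  have : ∀ _ : ℕ, IsProbabilityMeasure (coinLaw δ) := fun _ => by
    unfold coinLaw; infer_instance
  unfold prob
  infer_instance

/-- The suboptimality gap `Δ_i`. -/
def gap {F : ExpFamily} {K : ℕ} (B : Bandit F K) (i : Fin K) : ℝ := B.μ B.best - B.μ i

/-- The hardness parameter `I*(μ) = ∑ Δ_i / kl(μ_i, μ_best)`, over the suboptimal arms. -/
def hardness {F : ExpFamily} {K : ℕ} (B : Bandit F K) : ℝ :=
  ∑ i ∈ Finset.univ.erase B.best, B.gap i / F.kl (B.μ i) (B.μ B.best)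

end Bandit

/-- A best arm identification algorithm that stops at time `τ` and recommends `out` is `δ`-PAC if,
for all bandit instances, it terminates almost surely and errs with probability at most `δ`. -/
def IsPAC (F : ExpFamily) (K : ℕ) (δ : ℝ) (τ : Outcome K → ℕ∞) (out : Outcome K → Fin K) : Prop :=
  ∀ B : Bandit F K, (∀ᵐ ω ∂(B.prob δ), τ ω < ⊤) ∧
    B.prob δ {ω | out ω ≠ B.best} ≤ ENNReal.ofReal δ

/-! ## The Double KL-UCB algorithm -/

/-- The arms and rewards `(A_1, X_1), …, (A_n, X_n)` of the first `n` time steps; the pair of time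
step `s + 1` stands at position `s`. -/
abbrev History (K n : ℕ) : Type := Fin n → Fin K × ℝ

/-- The number `N_i(n)` of pulls of arm `i`. -/
def pullCount {K n : ℕ} (h : History K n) (i : Fin K) : ℕ :=
  (Finset.univ.filter fun s => (h s).1 = i).card

/-- The empirical mean of the rewards of arm `i`. -/
def empMean {K n : ℕ} (h : History K n) (i : Fin K) : ℝ :=
  (∑ s, if (h s).1 = i then (h s).2 else 0) / pullCount h i

/-- A rule that breaks the ties of an argmax: it picks an element of the (nonempty) set of
maximizers, depending measurably on the history. -/
structure TieRule (K : ℕ) where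
  /-- the element picked at time step `n + 1` from a set of arms -/
  pick : (n : ℕ) → History K n → Finset (Fin K) → Fin K
  pick_mem : ∀ n h S, S.Nonempty → pick n h S ∈ S
  measurable_pick : ∀ n S, Measurable fun h => pick n h S

open Classical in
/-- The set of maximizers of `u` in `S`. -/
def maximizers {K : ℕ} (S : Finset (Fin K)) (u : Fin K → EReal) : Finset (Fin K) :=
  S.filter fun i => ∀ j ∈ S, u j ≤ u i

/-- The exploration function `f(t) = 3 log t`. -/
def explF (t : ℕ) : ℝ := 3 * Real.log t

/-- The exploration function `g(δ, t) = log (2 K t² / δ)`. -/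
def explG (K : ℕ) (δ : ℝ) (t : ℕ) : ℝ := Real.log (2 * K * (t : ℝ) ^ 2 / δ)

/-- The means `m ∈ I` with `kl(empirical mean of arm i, m) ≤ c / N_i`. -/
def confSet (F : ExpFamily) {K n : ℕ} (h : History K n) (c : ℝ) (i : Fin K) : Set ℝ :=
  {m | m ∈ F.I ∧ F.klExt (empMean h i) m ≤ ((c / pullCount h i : ℝ) : EReal)}

/-- The upper confidence bound of arm `i` at exploration level `c`, an extended real. -/
def ucb (F : ExpFamily) {K n : ℕ} (h : History K n) (c : ℝ) (i : Fin K) : EReal :=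
  sSup ((fun m : ℝ => (m : EReal)) '' confSet F h c i)

/-- The lower confidence bound of arm `i` at exploration level `c`, an extended real. -/
def lcb (F : ExpFamily) {K n : ℕ} (h : History K n) (c : ℝ) (i : Fin K) : EReal :=
  sInf ((fun m : ℝ => (m : EReal)) '' confSet F h c i)

/-- The candidate `A_t^f` at time `t = n + 1`, given the history of the first `n` steps. -/
def candF (F : ExpFamily) {K : ℕ} (Tf : TieRule K) {n : ℕ} (h : History K n) : Fin K :=
  Tf.pick n h (maximizers Finset.univ fun i => ucb F h (explF (n + 1)) i)

/-- The candidate `A_t^g` at time `t = n + 1`, given the history of the first `n` steps. -/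
def candG (F : ExpFamily) {K : ℕ} (δ : ℝ) (Tf Tg : TieRule K) {n : ℕ} (h : History K n) : Fin K :=
  Tg.pick n h (maximizers (Finset.univ.erase (candF F Tf h))
    fun i => ucb F h (explG K δ (n + 1)) i)

/-- The arm `A_t` pulled at time `t = n + 1`: each arm once during the first `K` steps; afterwards
`A_t^f` if the coin shows heads, and `A_t^g` otherwise. -/
def nextArm (F : ExpFamily) {K : ℕ} (δ : ℝ) (Tf Tg : TieRule K) {n : ℕ} (h : History K n)
    (heads : Bool) : Fin K :=
  if hn : n < K then ⟨n, hn⟩ else if heads then candF F Tf h else candG F δ Tf Tg h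

/-- The history of the first `n` time steps on the outcome `ω`: the arm pulled yields its next
unused reward. -/
def hist (F : ExpFamily) {K : ℕ} (δ : ℝ) (Tf Tg : TieRule K) (ω : Outcome K) :
    (n : ℕ) → History K n
  | 0 => Fin.elim0
  | n + 1 =>
    let h := hist F δ Tf Tg ω n
    let a := nextArm F δ Tf Tg h (ω.2 n)
    Fin.snoc (α := fun _ => Fin K × ℝ) h (a, ω.1 (a, pullCount h a))

/-- The stopping condition `L^g_{A_t^f}(t) > U^g_{A_t^g}(t)` at time `t = n + 1`. -/
def stopCond (F : ExpFamily) {K : ℕ} (δ : ℝ) (Tf Tg : TieRule K) {n : ℕ} (h : History K n) : Prop :=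
  ucb F h (explG K δ (n + 1)) (candG F δ Tf Tg h) < lcb F h (explG K δ (n + 1)) (candF F Tf h)

/-- The stopping time `τ_δ`: the first time `t = n + 1` after the initialization (of `K` steps) at
which the stopping condition holds; `⊤` if there is none. -/
def stopTime (F : ExpFamily) {K : ℕ} (δ : ℝ) (Tf Tg : TieRule K) (ω : Outcome K) : ℕ∞ :=
  sInf {t : ℕ∞ | ∃ n : ℕ, K ≤ n ∧ stopCond F δ Tf Tg (hist F δ Tf Tg ω n) ∧ t = ((n + 1 : ℕ) : ℕ∞)}

/-- The recommended arm `A_τ^f`. -/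
def recommend (F : ExpFamily) {K : ℕ} (δ : ℝ) (Tf Tg : TieRule K) (ω : Outcome K) : Fin K :=
  candF F Tf (hist F δ Tf Tg ω ((stopTime F δ Tf Tg ω).toNat - 1))

/-- The cumulative regret `R(τ_δ) = ∑_{t=1}^{τ_δ} (μ_best - X_t)`, the arm pulled at time `τ_δ`
included (on the event `τ_δ < ∞`). -/
def regret {F : ExpFamily} {K : ℕ} (B : Bandit F K) (δ : ℝ) (Tf Tg : TieRule K)
    (ω : Outcome K) : ℝ :=
  let T := (stopTime F δ Tf Tg ω).toNat
  ∑ s : Fin T, (B.μ B.best - (hist F δ Tf Tg ω T s).2)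

end

/-!
The rewards are read off from stacks: the `s`-th pull of arm `i` yields the `s`-th entry of the stack
of the arm, whenever it happens. Concentration of the rewards is therefore a statement about i.i.d.
sequences, and a union bound over the numbers of pulls is all that is needed; only the coins call for
a supermartingale argument (`lintegral_prod_coin_le_one`).

**Correctness.** By the Chernoff bound `Bandit.measure_lt_klExt_le`, all confidence regions at level
`g` contain their means with probability at least `1 - δ`. On this event a leader `j` other than the
optimal arm cannot meet the stopping condition: the challenger has an upper confidence bound of at
least the optimal mean, and the lower confidence bound of `j` is at most its mean.

**The sample size.** Bounded variances make `b` at most quadratic around each of its tangents. So all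
natural parameters are allowed (`ExpFamily.Θ_eq_univ`), and the divergence dominates a multiple of
the squared distance (`ExpFamily.sq_le_of_klExt_le`). For an integer `q` consider the horizon `q ^ 4`
and the event `IsGoodRun`, of probability `1 - O(q ^ (-6))`, on which

* the means lie in their confidence regions at level `3 log t` at all times `t ≥ q ^ 3`, so that a
  suboptimal leader has `O(log q)` pulls;
* the coins show about the expected numbers of heads and tails, so that leaders are pulled in a fair
  share of the cases. Hence at most `q ^ 3` leaders are suboptimal up to the horizon
  (`IsGoodRun.card_wrongLeader_le`).

The optimal arm is thus pulled a multiple of `γ q ^ 4` times in a warm-up phase of length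
`γ q ^ 4 / 16`, with `γ = tailsProb δ` the probability of tails. As `γ q ^ 4` is large compared with
`log (1 / δ)` and `q ^ 3`, its mean is then known up to `ε`. While the algorithm does not stop, a
challenger `i` has an upper confidence bound close to the optimal mean, so that it has at most
`log (1 / δ) / κ i` pulls up to lower order, with `κ i` close to its divergence from the optimal arm
(`IsGoodRun.pulls_challenger_le`). Every tail results in such a pull, apart from `O(q ^ 3)` wrong
leaders and the tails of the warm-up; but there are about `γ q ^ 4` tails, so that the algorithm
stops before the horizon (`IsGoodRun.exists_stopCond`). The same count bounds the pulls of the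
suboptimal arms, and hence the regret, by `∑ Δ i / κ i * log (1 / δ)` plus terms of order `q ^ 3` and
`γ ^ 2 q ^ 4`, the latter from the warm-up (`IsGoodRun.stopTime_and_regret_le`).

**Expectations.** On the event that `q` is the first good index from `q₀` on, the stopping time and
the regret are `O(q ^ 4)`; as bad indices have probability `O(q ^ (-6))`, the horizons after the first
one contribute `O(1 / q₀)` (`lintegral_le_of_bad`). It remains to choose `q₀` so that `q₀ ^ 4` is of
order `x (log x) ^ (3 / 2)` with `x = log (1 / δ)`, and to recall that `γ = 1 / log x` for small `δ`:
then `q₀ ^ 4` is `o(x (log x) ^ 2)`, and both `q₀ ^ 3` and `γ ^ 2 q₀ ^ 4` are `o(x)`, while `γ q₀ ^ 4`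
exceeds every multiple of `x`.
-/

open scoped ENNReal

/-! ### Exponential families with bounded variances -/

namespace ExpFamily

variable (F : ExpFamily)

/-- A bound for the variances of the members of the family. -/
noncomputable def V : ℝ := F.variance_bdd.choose

lemma V_pos : 0 < F.V := F.variance_bdd.choose_spec.1

lemma variance_le_V {θ : ℝ} (hθ : θ ∈ F.Θ) : Var[id; F.law θ] ≤ F.V :=
  F.variance_bdd.choose_spec.2 θ hθ

lemma hasDerivAt_b {θ : ℝ} (hθ : θ ∈ F.Θ) : HasDerivAt F.b (F.mean θ) θ := by
  rw [F.mean_eq_deriv hθ]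
  exact (analyticAt_cgf (F.mem_interior hθ)).differentiableAt.hasDerivAt

lemma hasDerivAt_mean {θ : ℝ} (hθ : θ ∈ F.Θ) : HasDerivAt F.mean (Var[id; F.law θ]) θ := by
  have h1 : F.mean =ᶠ[𝓝 θ] deriv F.b := by
    filter_upwards [F.isOpen_param.mem_nhds hθ] with t ht using F.mean_eq_deriv ht
  refine HasDerivAt.congr_of_eventuallyEq ?_ h1
  have h2 : Var[id; F.law θ] = deriv (deriv F.b) θ := by
    have := variance_tilted_mul (X := id) (μ := F.ρ) (F.mem_interior hθ)
    rw [iteratedDeriv_succ, iteratedDeriv_one] at this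
    exact this
  rw [h2]
  exact (analyticAt_cgf (F.mem_interior hθ)).deriv.differentiableAt.hasDerivAt

/-- The quadratic upper bound for `b` that the variance bound yields. -/
lemma abs_b_sub_tangent_le {θ₀ θ : ℝ} (h₀ : θ₀ ∈ F.Θ) (hθ : θ ∈ F.Θ) :
    |F.b θ - F.b θ₀ - F.mean θ₀ * (θ - θ₀)| ≤ F.V * (θ - θ₀) ^ 2 := by
  have hconv : Convex ℝ F.Θ := convex_integrableExpSet
  have hseg : Set.uIcc θ₀ θ ⊆ F.Θ := hconv.ordConnected.uIcc_subset h₀ hθ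
  have hlip : ∀ t ∈ Set.uIcc θ₀ θ, |F.mean t - F.mean θ₀| ≤ F.V * |θ - θ₀| := by
    intro t ht
    have h := (convex_uIcc θ₀ θ).norm_image_sub_le_of_norm_hasDerivWithin_le (f := F.mean)
      (f' := fun t => Var[id; F.law t]) (C := F.V)
      (fun x hx => (F.hasDerivAt_mean (hseg hx)).hasDerivWithinAt)
      (fun x hx => by
        rw [Real.norm_of_nonneg (variance_nonneg _ _)]
        exact F.variance_le_V (hseg hx)) Set.left_mem_uIcc ht
    rw [Real.norm_eq_abs, Real.norm_eq_abs] at h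
    exact h.trans (mul_le_mul_of_nonneg_left (Set.abs_sub_left_of_mem_uIcc ht) F.V_pos.le)
  have h := (convex_uIcc θ₀ θ).norm_image_sub_le_of_norm_hasDerivWithin_le
    (f := fun t => F.b t - F.mean θ₀ * t)
    (f' := fun t => F.mean t - F.mean θ₀) (C := F.V * |θ - θ₀|)
    (fun x hx => by
      have := (F.hasDerivAt_b (hseg hx)).sub ((hasDerivAt_id x).const_mul (F.mean θ₀))
      simp only [mul_one] at this
      exact this.hasDerivWithinAt)
    (fun x hx => hlip x hx) Set.left_mem_uIcc Set.right_mem_uIcc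
  rw [Real.norm_eq_abs, Real.norm_eq_abs, mul_assoc, ← sq, sq_abs] at h
  convert h using 2
  ring

/-- A family with bounded variances has all real numbers as natural parameters: the log-partition
function cannot blow up at a boundary point of `Θ`. -/
lemma Θ_eq_univ (hne : F.Θ.Nonempty) : F.Θ = Set.univ := by
  obtain ⟨θ₀, h₀⟩ := hne
  refine IsClopen.eq_univ ⟨?_, F.isOpen_param⟩ ⟨θ₀, h₀⟩
  refine isClosed_of_closure_subset fun θ hθ => ?_
  obtain ⟨u, hu, hlim⟩ := mem_closure_iff_seq_limit.1 hθ
  obtain ⟨C, hC⟩ : ∃ C : ℝ, ∀ n, F.b (u n) ≤ C := by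
    have hcont : Tendsto (fun n => F.b θ₀ + F.mean θ₀ * (u n - θ₀) + F.V * (u n - θ₀) ^ 2) atTop
        (𝓝 (F.b θ₀ + F.mean θ₀ * (θ - θ₀) + F.V * (θ - θ₀) ^ 2)) := by
      have := hlim.sub_const θ₀
      exact (tendsto_const_nhds.add (this.const_mul _)).add ((this.pow 2).const_mul _)
    obtain ⟨C, hC⟩ := hcont.bddAbove_range
    refine ⟨C, fun n => le_trans ?_ (hC ⟨n, rfl⟩)⟩
    have := (abs_le.1 (F.abs_b_sub_tangent_le h₀ (hu n))).2
    simp only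
    linarith
  have hbound : ∀ n, ∫⁻ x, ENNReal.ofReal (Real.exp (u n * x)) ∂F.ρ
      ≤ ENNReal.ofReal (Real.exp C) := by
    intro n
    have hi : Integrable (fun x => Real.exp (u n * x)) F.ρ := hu n
    rw [← ofReal_integral_eq_lintegral_ofReal hi (Eventually.of_forall fun x => (Real.exp_pos _).le)]
    apply ENNReal.ofReal_le_ofReal
    have hpos : 0 < mgf id F.ρ (u n) := mgf_pos' F.ρ_ne_zero (hu n)
    have : Real.log (mgf id F.ρ (u n)) ≤ C := hC n
    exact (Real.log_le_iff_le_exp hpos).1 this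
  refine ⟨by fun_prop, ?_⟩
  rw [hasFiniteIntegral_iff_ofReal (Eventually.of_forall fun x => (Real.exp_pos _).le)]
  have hfatou : ∫⁻ x, liminf (fun n => ENNReal.ofReal (Real.exp (u n * x))) atTop ∂F.ρ
      ≤ liminf (fun n => ∫⁻ x, ENNReal.ofReal (Real.exp (u n * x)) ∂F.ρ) atTop :=
    lintegral_liminf_le fun n => by fun_prop
  have hlimx : ∀ x : ℝ, liminf (fun n => ENNReal.ofReal (Real.exp (u n * x))) atTop
      = ENNReal.ofReal (Real.exp (θ * x)) := by
    intro x
    refine Tendsto.liminf_eq ?_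
    refine ENNReal.tendsto_ofReal ((Real.continuous_exp.tendsto _).comp ?_)
    exact hlim.mul_const x
  simp only [hlimx] at hfatou
  refine lt_of_le_of_lt (hfatou.trans ?_) (ENNReal.ofReal_lt_top (r := Real.exp C))
  exact (liminf_le_liminf (v := fun _ : ℕ => ENNReal.ofReal (Real.exp C))
    (Eventually.of_forall hbound)).trans_eq (liminf_const _)

lemma mem_Θ {m : ℝ} (hm : m ∈ F.I) (θ : ℝ) : θ ∈ F.Θ := by
  obtain ⟨θ₀, h₀, -⟩ := hm
  rw [F.Θ_eq_univ ⟨θ₀, h₀⟩]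
  trivial

/-- Each natural parameter gives a lower bound for the divergence. -/
lemma le_klExt {θ : ℝ} (hθ : θ ∈ F.Θ) (x m : ℝ) :
    (((θ - F.natParam m) * x - (F.b θ - F.b (F.natParam m)) : ℝ) : EReal) ≤ F.klExt x m :=
  le_iSup₂ (f := fun θ (_ : θ ∈ F.Θ) =>
    (((θ - F.natParam m) * x - (F.b θ - F.b (F.natParam m)) : ℝ) : EReal)) θ hθ

/-- A Pinsker-type inequality, valid also for empirical means `x` outside `I`. -/
lemma sq_le_of_klExt_le {x m r : ℝ} (hm : m ∈ F.I) (h : F.klExt x m ≤ (r : EReal)) :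
    (x - m) ^ 2 ≤ 4 * F.V * r := by
  have hV := F.V_pos
  -- this parameter maximizes the lower bound that the quadratic bound for `b` gives
  set θ := F.natParam m + (x - m) / (2 * F.V) with hθ
  have h1 := (F.le_klExt (F.mem_Θ hm θ) x m).trans h
  rw [EReal.coe_le_coe_iff] at h1
  have h2 := (abs_le.1 (F.abs_b_sub_tangent_le (F.natParam_mem hm) (F.mem_Θ hm θ))).2
  rw [F.mean_natParam hm] at h2
  have h3 : θ - F.natParam m = (x - m) / (2 * F.V) := by rw [hθ]; ring
  rw [h3] at h1 h2
  have h4 : (x - m) / (2 * F.V) * x - (m * ((x - m) / (2 * F.V))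
      + F.V * ((x - m) / (2 * F.V)) ^ 2) ≤ r := by linarith
  have h5 : (x - m) / (2 * F.V) * x - (m * ((x - m) / (2 * F.V))
      + F.V * ((x - m) / (2 * F.V)) ^ 2) = (x - m) ^ 2 / (4 * F.V) := by
    field_simp; ring
  rw [h5, div_le_iff₀ (by positivity)] at h4
  linarith

/-- If the family has two different means, then no member is degenerate. -/
lemma variance_pos (hF : F.I.Nontrivial) (θ : ℝ) : 0 < Var[id; F.law θ] := by
  obtain ⟨m, hm, m', hm', hne⟩ := hF
  have hθ := F.mem_Θ hm θ
  have hp := F.isProbabilityMeasure_law hθ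
  refine lt_of_le_of_ne (variance_nonneg _ _) fun h0 => ?_
  have hL2 : MemLp id 2 (F.law θ) := memLp_tilted_mul (X := id) (μ := F.ρ) (F.mem_interior hθ) 2
  have h1 : (fun x : ℝ => x) =ᵐ[F.law θ] fun _ => F.mean θ := by
    have h2 := (evariance_eq_zero_iff (X := id) (μ := F.law θ) aemeasurable_id).1
      (by rw [← hL2.ofReal_variance_eq, ← h0, ENNReal.ofReal_zero])
    filter_upwards [h2] with x hx
    exact hx
  have h2 : ∀ᵐ x ∂F.ρ, x = F.mean θ :=
    (absolutelyContinuous_tilted (μ := F.ρ) (f := fun x => θ * x) hθ) h1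
  have h3 : ∀ θ', F.mean θ' = F.mean θ := by
    intro θ'
    have hp' := F.isProbabilityMeasure_law (F.mem_Θ hm θ')
    have : (fun x : ℝ => x) =ᵐ[F.law θ'] fun _ => F.mean θ :=
      (tilted_absolutelyContinuous F.ρ _) h2
    rw [mean, integral_congr_ae this]
    simp
  obtain ⟨t, -, rfl⟩ := hm
  obtain ⟨t', -, rfl⟩ := hm'
  exact hne (by rw [h3 t, h3 t'])

/-- If all means coincide, then `F.mean` is constant: two different means are needed. -/
lemma strictMono_mean (hF : F.I.Nontrivial) : StrictMono F.mean :=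
  strictMono_of_hasDerivAt_pos (fun θ => F.hasDerivAt_mean (F.mem_Θ hF.nonempty.some_mem θ))
    (fun θ => F.variance_pos hF θ)

lemma kl_pos {m m' : ℝ} (hm : m ∈ F.I) (hm' : m' ∈ F.I) (hne : m ≠ m') : 0 < F.kl m m' := by
  have h := F.sq_le_of_klExt_le (x := m) (r := F.kl m m') hm' (F.klExt_eq_kl hm).le
  have h1 : 0 < (m - m') ^ 2 := by have := sub_ne_zero.2 hne; positivity
  have := F.V_pos
  by_contra hcon
  nlinarith

lemma continuous_mean {m : ℝ} (hm : m ∈ F.I) : Continuous F.mean :=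
  continuous_iff_continuousAt.2 fun t => (F.hasDerivAt_mean (F.mem_Θ hm t)).continuousAt

lemma continuous_b {m : ℝ} (hm : m ∈ F.I) : Continuous F.b :=
  continuous_iff_continuousAt.2 fun t => (F.hasDerivAt_b (F.mem_Θ hm t)).continuousAt

/-- The divergence of a mean `m` from a larger mean `m'` is almost a lower bound for the divergences
of points below `m + ε` from means above `m' - ε`. The parameter of `m` provides the bound; it is
increasing in the second argument, so that a parameter slightly below that of `m'` suffices. -/
lemma exists_le_klExt {m m' k : ℝ} (hm : m ∈ F.I) (hm' : m' ∈ F.I) (hlt : m < m')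
    (hk : k < F.kl m m') :
    ∃ ε > 0, ∀ x ≤ m + ε, ∀ y ∈ F.I, m' - ε ≤ y → (k : EReal) ≤ F.klExt x y := by
  have hmono := F.strictMono_mean ⟨m, hm, m', hm', hlt.ne⟩
  have hd := F.mean_eq_deriv (F.natParam_mem hm)
  rw [F.mean_natParam hm] at hd
  set θ₁ := F.natParam m
  set θ₂ := F.natParam m'
  have hθ : θ₁ < θ₂ := by
    rw [← hmono.lt_iff_lt, F.mean_natParam hm, F.mean_natParam hm']; exact hlt
  rw [kl, ← hd] at hk
  have hbc := F.continuous_b hm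
  obtain ⟨θ, hθlt, hθ1, hθk⟩ : ∃ θ, θ < θ₂ ∧ θ₁ < θ ∧ k < F.b θ - F.b θ₁ - m * (θ - θ₁) := by
    have hc : ContinuousAt (fun t => F.b t - F.b θ₁ - m * (t - θ₁)) θ₂ := by fun_prop
    have h1 : ∀ᶠ t in 𝓝[<] θ₂, θ₁ < t ∧ k < F.b t - F.b θ₁ - m * (t - θ₁) :=
      nhdsWithin_le_nhds ((lt_mem_nhds hθ).and (hc.eventually (lt_mem_nhds hk)))
    obtain ⟨t, ht, ht'⟩ := (h1.and self_mem_nhdsWithin).exists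
    exact ⟨t, ht', ht⟩
  have h1 : m < F.mean θ := by rw [← F.mean_natParam hm]; exact hmono hθ1
  have h2 : F.mean θ < m' := by rw [← F.mean_natParam hm']; exact hmono hθlt
  have hev : ∀ᶠ ε in 𝓝[>] (0 : ℝ), m + ε < F.mean θ ∧ F.mean θ < m' - ε ∧
      k < F.b θ - F.b θ₁ - (m + ε) * (θ - θ₁) := by
    have c1 : ContinuousAt (fun ε : ℝ => m + ε) 0 := by fun_prop
    have c2 : ContinuousAt (fun ε : ℝ => m' - ε) 0 := by fun_prop
    have c3 : ContinuousAt (fun ε : ℝ => F.b θ - F.b θ₁ - (m + ε) * (θ - θ₁)) 0 := by fun_prop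
    exact nhdsWithin_le_nhds ((c1.eventually (gt_mem_nhds (by simpa using h1))).and
      ((c2.eventually (lt_mem_nhds (by simpa using h2))).and
        (c3.eventually (lt_mem_nhds (by simpa using hθk)))))
  obtain ⟨ε, ⟨he1, he2, he3⟩, he0⟩ := (hev.and self_mem_nhdsWithin).exists
  refine ⟨ε, he0, fun x hx y hy hmy => le_trans ?_ (F.le_klExt (F.natParam_mem hm) x y)⟩
  rw [EReal.coe_le_coe_iff]
  set θ' := F.natParam y
  have hmean : F.mean θ' = y := F.mean_natParam hy
  have h3 : θ < θ' := by rw [← hmono.lt_iff_lt, hmean]; linarith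
  have h4 := F.tangent_le (F.mem_Θ hm θ) (F.mem_Θ hm θ')
  rw [← F.mean_eq_deriv (F.mem_Θ hm θ)] at h4
  nlinarith [mul_nonneg (sub_nonneg.2 h3.le) (sub_nonneg.2 he1.le),
    mul_nonneg (sub_nonneg.2 (hθ1.trans h3).le) (sub_nonneg.2 hx)]

end ExpFamily

/-! ### Concentration of the empirical means -/

namespace ExpFamily

/-- The moment generating function of a member of the family. -/
lemma mgf_law (F : ExpFamily) {θ u : ℝ} (h₀ : θ ∈ F.Θ) (hu : θ + u ∈ F.Θ) :
    mgf id (F.law θ) u = Real.exp (F.b (θ + u) - F.b θ) := by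
  have hpos₀ : 0 < mgf id F.ρ θ := mgf_pos' F.ρ_ne_zero h₀
  have hpos : 0 < mgf id F.ρ (θ + u) := mgf_pos' F.ρ_ne_zero hu
  have h := integral_tilted_mul_eq_mgf (X := id) (μ := F.ρ) (t := θ)
    (fun x : ℝ => Real.exp (u * x))
  simp only [id] at h
  have h2 : mgf id (F.law θ) u = mgf id F.ρ (θ + u) / mgf id F.ρ θ := by
    unfold law
    have e1 : mgf id (F.ρ.tilted fun x => θ * x) u
        = ∫ x, Real.exp (u * x) ∂(F.ρ.tilted fun x => θ * x) := rfl
    have e2 : mgf id F.ρ (θ + u) = ∫ x, Real.exp ((θ + u) * x) ∂F.ρ := rfl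
    rw [e1, h, e2, ← integral_div]
    refine integral_congr_ae (Eventually.of_forall fun x => ?_)
    simp only [smul_eq_mul]
    rw [div_mul_eq_mul_div, ← Real.exp_add]
    congr 2
    ring
  rw [h2, Real.exp_sub]
  change _ = Real.exp (Real.log _) / Real.exp (Real.log _)
  rw [Real.exp_log hpos, Real.exp_log hpos₀]

lemma integrable_exp_mul_law (F : ExpFamily) {θ u : ℝ} (h₀ : θ ∈ F.Θ) (hu : θ + u ∈ F.Θ) :
    Integrable (fun x => Real.exp (u * x)) (F.law θ) := by
  by_contra hni
  have h := F.mgf_law h₀ hu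
  have e1 : mgf id (F.law θ) u = ∫ x, Real.exp (u * x) ∂(F.law θ) := rfl
  rw [e1, integral_undef hni] at h
  exact (Real.exp_pos _).ne h

end ExpFamily

/-- If all tails `{r ≤ Z}` that start in an open upper set `A` have mass at most `ε`, then so does
the event `Z ∈ A`: it is a directed union of countably many such tails. -/
lemma measure_mem_le_of_isUpperSet {Ω : Type*} [MeasurableSpace Ω] (P : Measure Ω) (Z : Ω → ℝ)
    {A : Set ℝ} (hA : IsOpen A) (hup : IsUpperSet A) {ε : ℝ≥0∞}
    (h : ∀ r ∈ A, P {ω | r ≤ Z ω} ≤ ε) : P {ω | Z ω ∈ A} ≤ ε := by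
  have hU : {ω | Z ω ∈ A} = ⋃ r : {r : ℚ // (r : ℝ) ∈ A}, {ω | ((r : ℚ) : ℝ) ≤ Z ω} := by
    ext ω
    simp only [Set.mem_ofPred_eq, Set.mem_iUnion]
    constructor
    · intro hω
      obtain ⟨ε, hε, hball⟩ := Metric.isOpen_iff.1 hA _ hω
      obtain ⟨r, hr1, hr2⟩ := exists_rat_btwn (sub_lt_self (Z ω) hε)
      refine ⟨⟨r, hball ?_⟩, hr2.le⟩
      rw [Metric.mem_ball, Real.dist_eq, abs_lt]
      constructor <;> linarith
    · rintro ⟨r, hr⟩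
      exact hup hr r.2
  rw [hU, Directed.measure_iUnion]
  · exact iSup_le fun r => h _ r.2
  · intro r r'
    have hanti : ∀ a b : {r : ℚ // (r : ℝ) ∈ A}, a.1 ≤ b.1 →
        {ω | ((b : ℚ) : ℝ) ≤ Z ω} ⊆ {ω | ((a : ℚ) : ℝ) ≤ Z ω} := by
      intro a b hab ω hω
      rw [Set.mem_ofPred_eq] at hω ⊢
      exact le_trans (by exact_mod_cast hab) hω
    rcases le_total r.1 r'.1 with hle | hle
    · exact ⟨r, subset_rfl, hanti _ _ hle⟩
    · exact ⟨r', hanti _ _ hle, subset_rfl⟩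

/-- The mean of the first `n` rewards that arm `i` has in store. -/
noncomputable def rewardAvg {K : ℕ} (ω : Outcome K) (i : Fin K) (n : ℕ) : ℝ :=
  (∑ j ∈ Finset.range n, ω.1 (i, j)) / n

namespace Bandit

variable {F : ExpFamily} {K : ℕ} (B : Bandit F K)

lemma isProbabilityMeasure_arm (p : Fin K × ℕ) :
    IsProbabilityMeasure (F.law (F.natParam (B.μ p.1))) :=
  F.isProbabilityMeasure_law (F.natParam_mem (B.mem_I p.1))

instance (δ : ℝ) : IsProbabilityMeasure (coinLaw δ) := by
  unfold coinLaw; infer_instance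

/-- One-sided Chernoff bound for the empirical means; the sign `σ` selects the side. -/
lemma measure_le_rewardAvg (δ : ℝ) (i : Fin K) {n : ℕ} (hn : 1 ≤ n) (σ : ℝ) {u : ℝ} (hu : 0 ≤ u)
    (r : ℝ) :
    B.prob δ {ω | r ≤ σ * rewardAvg ω i n} ≤ ENNReal.ofReal (Real.exp (-(n * (u * r -
      (F.b (F.natParam (B.μ i) + σ * u) - F.b (F.natParam (B.μ i))))))) := by
  have hI := B.mem_I i
  have := B.isProbabilityMeasure_arm
  set θ := F.natParam (B.μ i)
  set P := Measure.infinitePi fun p : Fin K × ℕ => F.law (F.natParam (B.μ p.1)) with hP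
  have hn0 : (0 : ℝ) < n := by exact_mod_cast hn
  have hset : {ω : Outcome K | r ≤ σ * rewardAvg ω i n}
      = {x : Fin K × ℕ → ℝ | n * r ≤ σ * ∑ j ∈ Finset.range n, x (i, j)} ×ˢ Set.univ := by
    ext ω
    simp only [Set.mem_ofPred_eq, Set.mem_prod, Set.mem_univ, and_true, rewardAvg]
    rw [← mul_div_assoc, le_div_iff₀ hn0, mul_comm r]
  have hprod : B.prob δ {ω : Outcome K | r ≤ σ * rewardAvg ω i n}
      = P {x | n * r ≤ σ * ∑ j ∈ Finset.range n, x (i, j)} := by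
    rw [hset, prob, Measure.prod_prod, measure_univ, mul_one]
  rw [hprod]
  have hind : iIndepFun (fun (j : ℕ) (x : Fin K × ℕ → ℝ) => x (i, j)) P :=
    (iIndepFun_infinitePi (P := fun p : Fin K × ℕ => F.law (F.natParam (B.μ p.1)))
      (X := fun _ x => x) (fun _ => measurable_id)).precomp
      (g := fun j : ℕ => (i, j)) (fun a b hab => by simpa using hab)
  have hmap : ∀ j : ℕ, P.map (fun x => x (i, j)) = F.law θ := fun j =>
    (measurePreserving_eval_infinitePi
      (fun p : Fin K × ℕ => F.law (F.natParam (B.μ p.1))) (i, j)).map_eq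
  have hmgf1 : ∀ j : ℕ, mgf (fun x : Fin K × ℕ → ℝ => x (i, j)) P (u * σ)
      = Real.exp (F.b (θ + u * σ) - F.b θ) := by
    intro j
    rw [← mgf_id_map (measurable_pi_apply _).aemeasurable, hmap j]
    exact F.mgf_law (F.mem_Θ hI _) (F.mem_Θ hI _)
  have hmgf : mgf (∑ j ∈ Finset.range n, fun x : Fin K × ℕ → ℝ => x (i, j)) P (u * σ)
      = Real.exp (F.b (θ + u * σ) - F.b θ) ^ n := by
    rw [hind.mgf_sum (fun j => by fun_prop), Finset.prod_congr rfl fun j _ => hmgf1 j]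
    simp
  have hint : Integrable (fun x => Real.exp (u * σ *
      (∑ j ∈ Finset.range n, fun x : Fin K × ℕ → ℝ => x (i, j)) x)) P := by
    refine hind.integrable_exp_mul_sum (fun j => by fun_prop) fun j _ => ?_
    have hi := F.integrable_exp_mul_law (u := u * σ) (F.mem_Θ hI θ) (F.mem_Θ hI _)
    rw [← hmap j] at hi
    exact hi.comp_measurable (by fun_prop)
  have hch := measure_ge_le_exp_mul_mgf (μ := P)
    (X := fun x : Fin K × ℕ → ℝ => σ * ∑ j ∈ Finset.range n, x (i, j)) (n * r) hu (by
      refine hint.congr (Eventually.of_forall fun x => ?_)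
      simp [mul_assoc])
  have hmgf' : mgf (fun x : Fin K × ℕ → ℝ => σ * ∑ j ∈ Finset.range n, x (i, j)) P u
      = Real.exp (F.b (θ + u * σ) - F.b θ) ^ n := by
    rw [mgf_const_mul, ← hmgf, mul_comm σ u]
    congr 1
    ext x
    simp
  rw [hmgf', ← Real.exp_nat_mul, ← Real.exp_add] at hch
  rw [← ofReal_measureReal]
  refine ENNReal.ofReal_le_ofReal (hch.trans (le_of_eq ?_))
  rw [mul_comm σ u]
  congr 1
  ring

/-- **Chernoff bound** for the divergence of an empirical mean from the true mean. -/
lemma measure_lt_klExt_le (δ : ℝ) (i : Fin K) {n : ℕ} (hn : 1 ≤ n) {c : ℝ} (hc : 0 ≤ c) :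
    B.prob δ {ω | ((c / n : ℝ) : EReal) < F.klExt (rewardAvg ω i n) (B.μ i)}
      ≤ ENNReal.ofReal (2 * Real.exp (-c)) := by
  have hn0 : (0 : ℝ) < n := by exact_mod_cast hn
  set θ := F.natParam (B.μ i) with hθ
  -- the divergence exceeds `c / n` iff one of its affine minorants, of slope `σ * u`, does
  set A : ℝ → Set ℝ := fun σ =>
    {z | ∃ u > 0, c / n < u * z - (F.b (θ + σ * u) - F.b θ)} with hAdef
  have hA : ∀ σ, B.prob δ {ω | σ * rewardAvg ω i n ∈ A σ} ≤ ENNReal.ofReal (Real.exp (-c)) := by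
    intro σ
    refine measure_mem_le_of_isUpperSet _ _ ?_ ?_ ?_
    · have : A σ = ⋃ u > 0, {z | c / n < u * z - (F.b (θ + σ * u) - F.b θ)} := by
        ext z; simp [hAdef]
      rw [this]
      exact isOpen_biUnion fun u _ => isOpen_lt (by fun_prop) (by fun_prop)
    · rintro z z' hz ⟨u, hu, h⟩
      exact ⟨u, hu, h.trans_le (by gcongr)⟩
    · rintro r ⟨u, hu, h⟩
      refine (B.measure_le_rewardAvg δ i hn σ hu.le r).trans (ENNReal.ofReal_le_ofReal ?_)
      rw [Real.exp_le_exp, neg_le_neg_iff]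
      rw [div_lt_iff₀ hn0] at h
      linarith
  have hsub : {ω : Outcome K | ((c / n : ℝ) : EReal) < F.klExt (rewardAvg ω i n) (B.μ i)}
      ⊆ {ω | 1 * rewardAvg ω i n ∈ A 1} ∪ {ω | (-1) * rewardAvg ω i n ∈ A (-1)} := by
    intro ω hω
    simp only [Set.mem_ofPred_eq, ExpFamily.klExt, lt_iSup_iff, EReal.coe_lt_coe_iff] at hω
    obtain ⟨t, -, ht⟩ := hω
    rw [← hθ] at ht
    rcases lt_trichotomy t θ with hlt | heq | hgt
    · right
      refine ⟨θ - t, sub_pos.2 hlt, ?_⟩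
      have : θ + -1 * (θ - t) = t := by ring
      rw [this]
      linarith
    · exfalso
      rw [heq] at ht
      have : 0 ≤ c / n := by positivity
      linarith
    · left
      refine ⟨t - θ, sub_pos.2 hgt, ?_⟩
      have : θ + 1 * (t - θ) = t := by ring
      rw [this]
      linarith
  refine (measure_mono hsub).trans ((measure_union_le _ _).trans ((add_le_add (hA 1) (hA (-1))).trans
    (le_of_eq ?_)))
  rw [← ENNReal.ofReal_add (Real.exp_pos _).le (Real.exp_pos _).le, two_mul]

end Bandit

/-! ### Products of adapted weights of independent coins -/

/-- If the weights `w k` depend on the past coins only and have mean at most one under the law of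
the next coin, then so does their product. -/
lemma lintegral_prod_coin_le_one (ν : Measure Bool) [IsProbabilityMeasure ν]
    (w : ℕ → (ℕ → Bool) → Bool → ℝ≥0∞)
    (hpred : ∀ n c c' b, (∀ k < n, c k = c' k) → w n c b = w n c' b)
    (hle : ∀ n c, ∫⁻ b, w n c b ∂ν ≤ 1) (n : ℕ) :
    ∫⁻ c, ∏ k ∈ Finset.range n, w k c (c k) ∂(Measure.infinitePi fun _ : ℕ => ν) ≤ 1 := by
  induction n with
  | zero => simp
  | succ n ih =>
    set Q := Measure.infinitePi fun _ : ℕ => ν with hQ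
    set ext : (Finset.range n → Bool) → ℕ → Bool :=
      fun a k => if h : k ∈ Finset.range n then a ⟨k, h⟩ else false with hext
    set res : (ℕ → Bool) → Finset.range n → Bool := fun c k => c k with hres
    have hagree : ∀ c : ℕ → Bool, ∀ k < n, ext (res c) k = c k := by
      intro c k hk
      simp [hext, hres, hk]
    set G : (Finset.range n → Bool) → ℝ≥0∞ :=
      fun a => ∏ k ∈ Finset.range n, w k (ext a) (ext a k) with hG
    have hGc : ∀ c, ∏ k ∈ Finset.range n, w k c (c k) = G (res c) := by
      intro c
      refine Finset.prod_congr rfl fun k hk => ?_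
      have hk' := Finset.mem_range.1 hk
      rw [hagree c k hk']
      exact hpred k _ _ _ fun l hl => (hagree c l (hl.trans hk')).symm
    have hmres : Measurable res := by fun_prop
    have hind : IndepFun res (fun c : ℕ → Bool => c n) Q := by
      have hi := iIndepFun_infinitePi (P := fun _ : ℕ => ν) (X := fun _ x => x)
        (fun _ => measurable_id)
      have h2 := hi.indepFun_finset (Finset.range n) {n} (by simp) (fun _ => by fun_prop)
      exact h2.comp (φ := id) (ψ := fun f : ({n} : Finset ℕ) → Bool => f ⟨n, by simp⟩)
        measurable_id (by fun_prop)
    have hmap := (indepFun_iff_map_prod_eq_prod_map_map hmres.aemeasurable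
      (measurable_pi_apply n).aemeasurable).1 hind
    have hmapn : Q.map (fun c : ℕ → Bool => c n) = ν :=
      (measurePreserving_eval_infinitePi (fun _ : ℕ => ν) n).map_eq
    rw [hmapn] at hmap
    have : IsProbabilityMeasure (Q.map res) := Measure.isProbabilityMeasure_map hmres.aemeasurable
    calc ∫⁻ c, ∏ k ∈ Finset.range (n + 1), w k c (c k) ∂Q
        = ∫⁻ c, (fun p : (Finset.range n → Bool) × Bool => G p.1 * w n (ext p.1) p.2)
            (res c, c n) ∂Q := by
          refine lintegral_congr fun c => ?_
          rw [Finset.prod_range_succ, hGc]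
          congr 1
          exact hpred n _ _ _ fun l hl => (hagree c l hl).symm
      _ = ∫⁻ p, G p.1 * w n (ext p.1) p.2 ∂((Q.map res).prod ν) := by
          rw [← hmap, lintegral_map (measurable_of_finite _) (by fun_prop)]
      _ = ∫⁻ a, ∫⁻ b, G a * w n (ext a) b ∂ν ∂(Q.map res) :=
          lintegral_prod _ (measurable_of_finite _).aemeasurable
      _ ≤ ∫⁻ a, G a ∂(Q.map res) := by
          refine lintegral_mono fun a => ?_
          rw [lintegral_const_mul _ (measurable_of_finite _)]
          exact mul_le_of_le_one_right' (hle n _)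
      _ = ∫⁻ c, G (res c) ∂Q := lintegral_map (measurable_of_finite _) hmres
      _ ≤ 1 := by simpa only [hGc] using ih

/-- Markov's inequality for a product of weights that depend on the rewards and on the past coins,
and have mean at most one under the law of the next coin. -/
lemma Bandit.measure_lt_prod_coin_le {F : ExpFamily} {K : ℕ} (B : Bandit F K) (δ : ℝ)
    (w : ℕ → Outcome K → Bool → ℝ≥0∞)
    (hpred : ∀ n x c c' b, (∀ k < n, c k = c' k) → w n (x, c) b = w n (x, c') b)
    (hle : ∀ n ω, ∫⁻ b, w n ω b ∂(coinLaw δ) ≤ 1) (n : ℕ)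
    (hmeas : ∀ k, Measurable fun ω : Outcome K => w k ω (ω.2 k)) {ε : ℝ≥0∞} (hε : ε ≠ 0)
    (hε' : ε ≠ ∞) :
    B.prob δ {ω | ε < ∏ k ∈ Finset.range n, w k ω (ω.2 k)} ≤ ε⁻¹ := by
  have := B.isProbabilityMeasure_arm
  have hm : Measurable fun ω : Outcome K => ∏ k ∈ Finset.range n, w k ω (ω.2 k) :=
    Finset.measurable_prod _ fun k _ => hmeas k
  refine (measure_mono (t := {ω | ε ≤ ∏ k ∈ Finset.range n, w k ω (ω.2 k)})
    fun ω hω => by rw [Set.mem_ofPred_eq] at hω ⊢; exact hω.le).trans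
    ((meas_ge_le_lintegral_div hm.aemeasurable hε hε').trans ?_)
  rw [← one_div]
  gcongr
  unfold Bandit.prob
  rw [lintegral_prod _ hm.aemeasurable]
  calc _ ≤ ∫⁻ _, 1 ∂(Measure.infinitePi fun p : Fin K × ℕ => F.law (F.natParam (B.μ p.1))) :=
        lintegral_mono fun x => lintegral_prod_coin_le_one (coinLaw δ) (fun k c b => w k (x, c) b)
          (fun n c c' b h => hpred n x c c' b h) (fun n c => hle n (x, c)) n
    _ = 1 := by simp

/-! ### Measurability -/

/-- The projection of the part of a closed set over an open set of the line is measurable: the open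
set is a countable union of compact sets, along which projections of closed sets are closed. -/
lemma measurableSet_exists_mem_of_isClosed {O : Set ℝ} (hO : IsOpen O) {C : Set (ℝ × ℝ)}
    (hC : IsClosed C) : MeasurableSet {x | ∃ t ∈ O, (x, t) ∈ C} := by
  have := hO.locallyCompactSpace
  obtain ⟨S, hS, hSO⟩ : IsSigmaCompact O :=
    isSigmaCompact_iff_sigmaCompactSpace.2 inferInstance
  have h : {x | ∃ t ∈ O, (x, t) ∈ C} = ⋃ n, {x | ∃ t ∈ S n, (x, t) ∈ C} := by
    ext x
    simp only [← hSO, Set.mem_iUnion, Set.mem_ofPred_eq]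
    constructor
    · rintro ⟨t, ⟨n, hn⟩, ht⟩
      exact ⟨n, t, hn, ht⟩
    · rintro ⟨n, t, hn, ht⟩
      exact ⟨t, ⟨n, hn⟩, ht⟩
  rw [h]
  refine MeasurableSet.iUnion fun n => IsClosed.measurableSet ?_
  have := isCompact_iff_compactSpace.1 (hS n)
  have h2 : {x | ∃ t ∈ S n, (x, t) ∈ C}
      = Prod.fst '' ((fun p : ℝ × S n => (p.1, (p.2 : ℝ))) ⁻¹' C) := by
    ext x
    simp
  rw [h2]
  exact isClosedMap_fst_of_compactSpace _ (hC.preimage (by fun_prop))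

namespace ExpFamily

variable (F : ExpFamily)

/-- In terms of natural parameters, the points within a given divergence of a mean of an open set
form the projection of a closed set. -/
lemma measurableSet_exists_klExt_le (hF : F.I.Nontrivial)
    {O : Set ℝ} (hO : IsOpen O) (r : EReal) :
    MeasurableSet {x | ∃ y ∈ F.I, y ∈ O ∧ F.klExt x y ≤ r} := by
  have hmono := F.strictMono_mean hF
  have hm := hF.nonempty.some_mem
  have hb := F.continuous_b hm
  have hnat : ∀ t, F.natParam (F.mean t) = t := fun t =>
    hmono.injective (F.mean_natParam ⟨t, F.mem_Θ hm t, rfl⟩)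
  have hset : {x | ∃ y ∈ F.I, y ∈ O ∧ F.klExt x y ≤ r} = {x | ∃ t ∈ F.mean ⁻¹' O,
      (x, t) ∈ ⋂ θ ∈ F.Θ, {p : ℝ × ℝ |
        (((θ - p.2) * p.1 - (F.b θ - F.b p.2) : ℝ) : EReal) ≤ r}} := by
    ext x
    simp only [Set.mem_ofPred_eq, Set.mem_preimage, Set.mem_iInter, klExt, iSup_le_iff]
    constructor
    · rintro ⟨y, ⟨t, ht, rfl⟩, hyO, h⟩
      rw [hnat] at h
      exact ⟨t, hyO, h⟩
    · rintro ⟨t, htO, h⟩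
      refine ⟨F.mean t, ⟨t, F.mem_Θ hm t, rfl⟩, htO, ?_⟩
      rwa [hnat]
  rw [hset]
  refine measurableSet_exists_mem_of_isClosed (hO.preimage (F.continuous_mean hm)) ?_
  refine isClosed_biInter fun θ _ => isClosed_le ?_ continuous_const
  exact continuous_coe_real_ereal.comp (by fun_prop)

end ExpFamily

section History

variable {F : ExpFamily}

lemma measurable_pullCount {K n : ℕ} (i : Fin K) :
    Measurable fun h : History K n => pullCount h i := by
  simp only [pullCount, Finset.card_filter]
  refine Finset.measurable_sum _ fun s _ => Measurable.ite ?_ measurable_const measurable_const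
  exact (measurable_fst.comp (measurable_pi_apply s)) (measurableSet_singleton i)

lemma measurable_empMean {K n : ℕ} (i : Fin K) :
    Measurable fun h : History K n => empMean h i := by
  refine Measurable.div (Finset.measurable_sum _ fun s _ => Measurable.ite ?_ ?_ measurable_const) ?_
  · exact (measurable_fst.comp (measurable_pi_apply s)) (measurableSet_singleton i)
  · exact measurable_snd.comp (measurable_pi_apply s)
  · exact (measurable_from_top (f := fun k : ℕ => (k : ℝ))).comp (measurable_pullCount i)

lemma measurable_ucb (hF : F.I.Nontrivial) {K n : ℕ} (c : ℝ) (i : Fin K) :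
    Measurable fun h : History K n => ucb F h c i := by
  have h1 : Measurable fun p : ℕ × ℝ => sSup ((fun y : ℝ => (y : EReal)) ''
      {y | y ∈ F.I ∧ F.klExt p.2 y ≤ ((c / p.1 : ℝ) : EReal)}) := by
    refine measurable_from_prod_countable_right fun k => measurable_of_Ioi fun a => ?_
    have hset : (fun x : ℝ => sSup ((fun y : ℝ => (y : EReal)) ''
        {y | y ∈ F.I ∧ F.klExt x y ≤ ((c / k : ℝ) : EReal)})) ⁻¹' Set.Ioi a
        = {x | ∃ y ∈ F.I, y ∈ {y : ℝ | a < (y : EReal)} ∧ F.klExt x y ≤ ((c / k : ℝ) : EReal)} := by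
      ext x
      rw [Set.mem_preimage, Set.mem_Ioi, lt_sSup_iff, Set.exists_mem_image, Set.mem_ofPred_eq]
      exact exists_congr fun y => ⟨fun ⟨⟨h1, h2⟩, h3⟩ => ⟨h1, h3, h2⟩,
        fun ⟨h1, h3, h2⟩ => ⟨⟨h1, h2⟩, h3⟩⟩
    exact hset ▸ F.measurableSet_exists_klExt_le hF
      (isOpen_lt continuous_const continuous_coe_real_ereal) _
  have h2 := h1.comp ((measurable_pullCount (n := n) i).prodMk (measurable_empMean i))
  exact h2

lemma measurable_lcb (hF : F.I.Nontrivial) {K n : ℕ} (c : ℝ) (i : Fin K) :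
    Measurable fun h : History K n => lcb F h c i := by
  have h1 : Measurable fun p : ℕ × ℝ => sInf ((fun y : ℝ => (y : EReal)) ''
      {y | y ∈ F.I ∧ F.klExt p.2 y ≤ ((c / p.1 : ℝ) : EReal)}) := by
    refine measurable_from_prod_countable_right fun k => measurable_of_Iio fun a => ?_
    have hset : (fun x : ℝ => sInf ((fun y : ℝ => (y : EReal)) ''
        {y | y ∈ F.I ∧ F.klExt x y ≤ ((c / k : ℝ) : EReal)})) ⁻¹' Set.Iio a
        = {x | ∃ y ∈ F.I, y ∈ {y : ℝ | (y : EReal) < a} ∧ F.klExt x y ≤ ((c / k : ℝ) : EReal)} := by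
      ext x
      rw [Set.mem_preimage, Set.mem_Iio, sInf_lt_iff, Set.exists_mem_image, Set.mem_ofPred_eq]
      exact exists_congr fun y => ⟨fun ⟨⟨h1, h2⟩, h3⟩ => ⟨h1, h3, h2⟩,
        fun ⟨h1, h3, h2⟩ => ⟨⟨h1, h2⟩, h3⟩⟩
    exact hset ▸ F.measurableSet_exists_klExt_le hF
      (isOpen_lt continuous_coe_real_ereal continuous_const) _
  have h2 := h1.comp ((measurable_pullCount (n := n) i).prodMk (measurable_empMean i))
  exact h2

lemma measurable_eval_of_countable {α ι β : Type*} [MeasurableSpace α] [MeasurableSpace ι]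
    [MeasurableSpace β] [Countable ι] [MeasurableSingletonClass ι] {f : ι → α → β} {g : α → ι}
    (hf : ∀ i, Measurable (f i)) (hg : Measurable g) : Measurable fun a => f (g a) a :=
  (measurable_from_prod_countable_right (f := fun p : ι × α => f p.1 p.2) hf).comp
    (hg.prodMk measurable_id)

/-- A tie rule applied to the maximizers of measurable functions is measurable. -/
lemma measurable_pick_maximizers {K n : ℕ} (T : TieRule K) (S : Finset (Fin K))
    {u : History K n → Fin K → EReal} (hu : ∀ i, Measurable fun h => u h i) :
    Measurable fun h => T.pick n h (maximizers S (u h)) := by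
  let _ : MeasurableSpace (Finset (Fin K)) := ⊤
  have : MeasurableSingletonClass (Finset (Fin K)) := ⟨fun _ => trivial⟩
  refine measurable_eval_of_countable (f := fun S' h => T.pick n h S')
    (fun S' => T.measurable_pick n S') (measurable_to_countable' fun S' => ?_)
  have hset : (fun h => maximizers S (u h)) ⁻¹' {S'}
      = ⋂ i, {h | i ∈ S' ↔ (i ∈ S ∧ ∀ j, j ∈ S → u h j ≤ u h i)} := by
    ext h
    simp only [Set.mem_preimage, Set.mem_singleton_iff, Set.mem_iInter, Set.mem_ofPred_eq,
      Finset.ext_iff, maximizers, Finset.mem_filter]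
    exact forall_congr' fun i => iff_comm
  rw [hset]
  refine MeasurableSet.iInter fun i => measurableSet_setOfPred.2 (Measurable.iff measurable_const
    (Measurable.and measurable_const (Measurable.forall fun j => Measurable.imp measurable_const
      (measurableSet_setOfPred.1 (measurableSet_le (hu j) (hu i))))))

lemma measurable_candF (hF : F.I.Nontrivial) {K n : ℕ} (Tf : TieRule K) :
    Measurable fun h : History K n => candF F Tf h :=
  measurable_pick_maximizers Tf _ fun i => measurable_ucb hF _ i

lemma measurable_candG (hF : F.I.Nontrivial) {K n : ℕ} (δ : ℝ) (Tf Tg : TieRule K) :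
    Measurable fun h : History K n => candG F δ Tf Tg h :=
  measurable_eval_of_countable (f := fun a h => Tg.pick n h (maximizers (Finset.univ.erase a)
    fun i => ucb F h (explG K δ (n + 1)) i))
    (fun _ => measurable_pick_maximizers Tg _ fun i => measurable_ucb hF _ i)
    (measurable_candF hF Tf)

lemma measurable_nextArm (hF : F.I.Nontrivial) {K n : ℕ} (δ : ℝ) (Tf Tg : TieRule K) :
    Measurable fun p : History K n × Bool => nextArm F δ Tf Tg p.1 p.2 := by
  refine measurable_from_prod_countable_left fun b => ?_
  unfold nextArm
  by_cases hn : n < K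
  · simp [hn]
  · cases b
    · simpa [hn] using measurable_candG hF δ Tf Tg
    · simpa [hn] using measurable_candF hF Tf

lemma measurableSet_stopCond (hF : F.I.Nontrivial) {K n : ℕ} (δ : ℝ) (Tf Tg : TieRule K) :
    MeasurableSet {h : History K n | stopCond F δ Tf Tg h} :=
  measurableSet_lt
    (measurable_eval_of_countable (f := fun i h => ucb F h (explG K δ (n + 1)) i)
      (fun i => measurable_ucb hF _ i) (measurable_candG hF δ Tf Tg))
    (measurable_eval_of_countable (f := fun i h => lcb F h (explG K δ (n + 1)) i)
      (fun i => measurable_lcb hF _ i) (measurable_candF hF Tf))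

lemma measurable_hist (hF : F.I.Nontrivial) {K : ℕ} (δ : ℝ) (Tf Tg : TieRule K) (n : ℕ) :
    Measurable fun ω : Outcome K => hist F δ Tf Tg ω n := by
  induction n with
  | zero => exact measurable_pi_lambda _ fun s => s.elim0
  | succ n ih =>
    have ha : Measurable fun ω : Outcome K =>
        nextArm F δ Tf Tg (hist F δ Tf Tg ω n) (ω.2 n) :=
      (measurable_nextArm hF δ Tf Tg).comp
        (ih.prodMk ((measurable_pi_apply n).comp measurable_snd))
    have hc : Measurable fun ω : Outcome K => pullCount (hist F δ Tf Tg ω n)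
        (nextArm F δ Tf Tg (hist F δ Tf Tg ω n) (ω.2 n)) :=
      measurable_eval_of_countable (f := fun i (ω : Outcome K) => pullCount (hist F δ Tf Tg ω n) i)
        (fun i => (measurable_pullCount i).comp ih) ha
    refine measurable_pi_lambda _ fun s => ?_
    refine Fin.lastCases ?_ (fun s => ?_) s
    · simp only [hist, Fin.snoc_last]
      refine ha.prodMk (measurable_eval_of_countable
        (f := fun p (ω : Outcome K) => ω.1 p) (fun p => ?_) (ha.prodMk hc))
      exact (measurable_pi_apply p).comp measurable_fst
    · simp only [hist, Fin.snoc_castSucc]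
      exact (measurable_pi_apply s).comp ih

end History

section StopTime

variable {F : ExpFamily} {K : ℕ} {δ : ℝ} {Tf Tg : TieRule K} {ω : Outcome K}

lemma stopTime_le {n : ℕ} (hn : K ≤ n) (h : stopCond F δ Tf Tg (hist F δ Tf Tg ω n)) :
    stopTime F δ Tf Tg ω ≤ ((n + 1 : ℕ) : ℕ∞) :=
  sInf_le ⟨n, hn, h, rfl⟩

/-- The stopping time is infinite, or it is `n + 1` for the first `n` with the stopping condition. -/
lemma stopTime_cases (F : ExpFamily) (δ : ℝ) (Tf Tg : TieRule K) (ω : Outcome K) :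
    (stopTime F δ Tf Tg ω = ⊤ ∧ ∀ n, K ≤ n → ¬ stopCond F δ Tf Tg (hist F δ Tf Tg ω n)) ∨
    ∃ n, K ≤ n ∧ stopCond F δ Tf Tg (hist F δ Tf Tg ω n) ∧
      stopTime F δ Tf Tg ω = ((n + 1 : ℕ) : ℕ∞) ∧
      ∀ k < n, K ≤ k → ¬ stopCond F δ Tf Tg (hist F δ Tf Tg ω k) := by
  classical
  by_cases h : ∃ n, K ≤ n ∧ stopCond F δ Tf Tg (hist F δ Tf Tg ω n)
  · right
    refine ⟨Nat.find h, (Nat.find_spec h).1, (Nat.find_spec h).2, ?_, fun k hk hKk hs =>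
      Nat.find_min h hk ⟨hKk, hs⟩⟩
    refine le_antisymm (stopTime_le (Nat.find_spec h).1 (Nat.find_spec h).2) (le_sInf ?_)
    rintro t ⟨n, hn, hs, rfl⟩
    exact_mod_cast Nat.succ_le_succ (Nat.find_min' h ⟨hn, hs⟩)
  · left
    push Not at h
    refine ⟨?_, h⟩
    refine sInf_eq_top.2 ?_
    rintro t ⟨n, hn, hs, rfl⟩
    exact absurd hs (h n hn)

lemma measurable_stopTime (hF : F.I.Nontrivial) :
    Measurable fun ω : Outcome K => stopTime F δ Tf Tg ω := by
  have hP : ∀ n, MeasurableSet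
      {ω : Outcome K | K ≤ n ∧ stopCond F δ Tf Tg (hist F δ Tf Tg ω n)} := fun n =>
    measurableSet_setOfPred.2 (Measurable.and measurable_const (measurableSet_setOfPred.1
      ((measurable_hist hF δ Tf Tg n) (measurableSet_stopCond hF δ Tf Tg))))
  refine ENat.measurable_iff.2 fun n => ?_
  have hset : (fun ω : Outcome K => stopTime F δ Tf Tg ω) ⁻¹' {(n : ℕ∞)} =
      ⋃ k : {k : ℕ // k + 1 = n}, {ω | K ≤ k.1 ∧ stopCond F δ Tf Tg (hist F δ Tf Tg ω k.1)} ∩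
        ⋂ l : {l : ℕ // l < k.1},
          {ω | K ≤ l.1 ∧ stopCond F δ Tf Tg (hist F δ Tf Tg ω l.1)}ᶜ := by
    ext ω
    simp only [Set.mem_preimage, Set.mem_singleton_iff, Set.mem_iUnion, Set.mem_inter_iff,
      Set.mem_iInter, Set.mem_compl_iff, Set.mem_ofPred_eq, Subtype.forall, Subtype.exists]
    rcases stopTime_cases F δ Tf Tg ω with ⟨htop, hno⟩ | ⟨k, hKk, hs, heq, hmin⟩
    · rw [htop]
      simp only [ENat.top_ne_natCast, false_iff]
      rintro ⟨k, -, ⟨hk, hs⟩, -⟩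
      exact hno k hk hs
    · rw [heq]
      constructor
      · intro h
        refine ⟨k, by exact_mod_cast h, ⟨hKk, hs⟩, fun l hl hs' => hmin l hl hs'.1 hs'.2⟩
      · rintro ⟨k', rfl, ⟨hk', hs'⟩, hmin'⟩
        have : k = k' := by
          rcases lt_trichotomy k k' with h | h | h
          · exact absurd ⟨hKk, hs⟩ (hmin' k h)
          · exact h
          · exact absurd hs' (hmin k' h hk')
        rw [this]
  rw [hset]
  exact MeasurableSet.iUnion fun k => (hP _).inter (MeasurableSet.iInter fun l => (hP _).compl)

lemma measurable_regret (B : Bandit F K) (hF : F.I.Nontrivial) : Measurable (regret B δ Tf Tg) := by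
  refine measurable_eval_of_countable (f := fun T (ω : Outcome K) =>
    ∑ s : Fin T, (B.μ B.best - (hist F δ Tf Tg ω T s).2))
    (fun T => Finset.measurable_sum _ fun s _ => measurable_const.sub ?_)
    ((measurable_from_top (f := ENat.toNat)).comp (measurable_stopTime hF))
  exact measurable_snd.comp ((measurable_pi_apply s).comp (measurable_hist hF δ Tf Tg T))

end StopTime

/-! ### Trajectories -/

section Trajectory

variable (F : ExpFamily) {K : ℕ} (δ : ℝ) (Tf Tg : TieRule K) (ω : Outcome K)

/-- The number of pulls of arm `i` in the first `n` steps on the outcome `ω`. -/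
noncomputable def pulls (i : Fin K) (n : ℕ) : ℕ := pullCount (hist F δ Tf Tg ω n) i

/-- The arm pulled at time step `n + 1` on the outcome `ω`. -/
noncomputable def armAt (n : ℕ) : Fin K := nextArm F δ Tf Tg (hist F δ Tf Tg ω n) (ω.2 n)

/-- The candidate `A^f` at time step `n + 1` on the outcome `ω`. -/
noncomputable def leader (n : ℕ) : Fin K := candF F Tf (hist F δ Tf Tg ω n)

/-- The candidate `A^g` at time step `n + 1` on the outcome `ω`. -/
noncomputable def challenger (n : ℕ) : Fin K := candG F δ Tf Tg (hist F δ Tf Tg ω n)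

lemma hist_succ (n : ℕ) : hist F δ Tf Tg ω (n + 1) =
    Fin.snoc (α := fun _ => Fin K × ℝ) (hist F δ Tf Tg ω n) (armAt F δ Tf Tg ω n,
      ω.1 (armAt F δ Tf Tg ω n, pulls F δ Tf Tg ω (armAt F δ Tf Tg ω n) n)) := rfl

lemma pulls_zero (i : Fin K) : pulls F δ Tf Tg ω i 0 = 0 := by
  simp [pulls, pullCount]

lemma pulls_succ (i : Fin K) (n : ℕ) : pulls F δ Tf Tg ω i (n + 1) =
    pulls F δ Tf Tg ω i n + if armAt F δ Tf Tg ω n = i then 1 else 0 := by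
  unfold pulls
  rw [hist_succ]
  simp only [pullCount, Finset.card_filter, Fin.sum_univ_castSucc, Fin.snoc_castSucc,
    Fin.snoc_last]

lemma pulls_eq_card (i : Fin K) (n : ℕ) : pulls F δ Tf Tg ω i n =
    ((Finset.range n).filter fun k => armAt F δ Tf Tg ω k = i).card := by
  induction n with
  | zero => simp [pulls_zero]
  | succ n ih =>
    rw [pulls_succ, ih, Finset.range_add_one, Finset.filter_insert]
    split_ifs with h <;> simp

lemma pulls_mono (i : Fin K) : Monotone (pulls F δ Tf Tg ω i) :=
  monotone_nat_of_le_succ fun n => by rw [pulls_succ]; omega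

lemma sum_pulls (n : ℕ) : ∑ i, pulls F δ Tf Tg ω i n = n := by
  induction n with
  | zero => simp [pulls_zero]
  | succ n ih => simp [pulls_succ, Finset.sum_add_distrib, ih]

lemma pulls_le (i : Fin K) (n : ℕ) : pulls F δ Tf Tg ω i n ≤ n := by
  conv_rhs => rw [← sum_pulls F δ Tf Tg ω n]
  exact Finset.single_le_sum (f := fun i => pulls F δ Tf Tg ω i n) (fun _ _ => Nat.zero_le _)
    (Finset.mem_univ i)

lemma one_le_pulls (i : Fin K) {n : ℕ} (hn : K ≤ n) : 1 ≤ pulls F δ Tf Tg ω i n := by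
  have h1 : 1 ≤ pulls F δ Tf Tg ω i (i.1 + 1) := by
    rw [pulls_succ, if_pos]
    · omega
    · simp [armAt, nextArm, i.2]
  exact h1.trans (pulls_mono F δ Tf Tg ω i (by have := i.2; omega))

lemma armAt_of_heads {n : ℕ} (hn : K ≤ n) (h : ω.2 n = true) :
    armAt F δ Tf Tg ω n = leader F δ Tf Tg ω n := by
  simp [armAt, nextArm, leader, h, hn]

lemma armAt_of_tails {n : ℕ} (hn : K ≤ n) (h : ω.2 n = false) :
    armAt F δ Tf Tg ω n = challenger F δ Tf Tg ω n := by
  simp [armAt, nextArm, challenger, h, hn]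

/-- An arm is pulled at most `M + 1` times while its number of pulls is at most `M`. -/
lemma card_filter_pulls_le (i : Fin K) (S : Finset ℕ) (M : ℕ)
    (h : ∀ k ∈ S, armAt F δ Tf Tg ω k = i ∧ pulls F δ Tf Tg ω i k ≤ M) : S.card ≤ M + 1 := by
  have hcard : S.card ≤ (Finset.range (M + 1)).card := by
    refine Finset.card_le_card_of_injOn (pulls F δ Tf Tg ω i) (fun k hk => ?_) ?_
    · have := (h k hk).2
      simp only [Finset.coe_range, Set.mem_Iio]
      omega
    · have hlt : ∀ k ∈ S, ∀ l ∈ S, k < l → pulls F δ Tf Tg ω i k < pulls F δ Tf Tg ω i l := by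
        intro k hk l _ hkl
        have h1 := pulls_succ F δ Tf Tg ω i k
        rw [if_pos (h k hk).1] at h1
        have h2 := pulls_mono F δ Tf Tg ω i (Nat.succ_le_of_lt hkl)
        simp only [Nat.succ_eq_add_one] at h2
        omega
      intro k hk l hl heq
      rcases lt_trichotomy k l with hkl | hkl | hkl
      · exact absurd heq (hlt k hk l hl hkl).ne
      · exact hkl
      · exact absurd heq (hlt l hl k hk hkl).ne'
  simpa using hcard

lemma sum_rewards (i : Fin K) (n : ℕ) :
    ∑ s, (if (hist F δ Tf Tg ω n s).1 = i then (hist F δ Tf Tg ω n s).2 else 0)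
      = ∑ j ∈ Finset.range (pulls F δ Tf Tg ω i n), ω.1 (i, j) := by
  induction n with
  | zero => simp [pulls_zero]
  | succ n ih =>
    rw [hist_succ, Fin.sum_univ_castSucc, pulls_succ]
    simp only [Fin.snoc_castSucc, Fin.snoc_last]
    rw [ih]
    split_ifs with h
    · rw [Finset.sum_range_succ, h]
    · simp

lemma empMean_hist (i : Fin K) (n : ℕ) :
    empMean (hist F δ Tf Tg ω n) i = rewardAvg ω i (pulls F δ Tf Tg ω i n) := by
  rw [empMean, sum_rewards]; rfl

/-- The regret of `n` steps, arm by arm. -/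
lemma sum_regret_eq (B : Bandit F K) (n : ℕ) :
    ∑ s : Fin n, (B.μ B.best - (hist F δ Tf Tg ω n s).2) =
      ∑ i, (pulls F δ Tf Tg ω i n * B.gap i + (pulls F δ Tf Tg ω i n * B.μ i -
        ∑ j ∈ Finset.range (pulls F δ Tf Tg ω i n), ω.1 (i, j))) := by
  have h1 : ∑ s : Fin n, (hist F δ Tf Tg ω n s).2
      = ∑ i, ∑ j ∈ Finset.range (pulls F δ Tf Tg ω i n), ω.1 (i, j) := by
    simp_rw [← sum_rewards]
    rw [Finset.sum_comm]
    simp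
  have h2 : (n : ℝ) = ∑ i, (pulls F δ Tf Tg ω i n : ℝ) := by
    rw [← Nat.cast_sum, sum_pulls]
  rw [Finset.sum_sub_distrib, h1]
  simp only [Finset.sum_const, Finset.card_univ, Fintype.card_fin, nsmul_eq_mul]
  rw [h2, Finset.sum_mul, ← Finset.sum_sub_distrib]
  refine Finset.sum_congr rfl fun i _ => ?_
  unfold Bandit.gap
  ring

/-- The first `n` steps do not depend on later coins. -/
lemma hist_congr (x : Fin K × ℕ → ℝ) {c c' : ℕ → Bool} {n : ℕ} (h : ∀ k < n, c k = c' k) :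
    hist F δ Tf Tg (x, c) n = hist F δ Tf Tg (x, c') n := by
  induction n with
  | zero => rfl
  | succ n ih =>
    have ih' := ih fun k hk => h k (hk.trans n.lt_succ_self)
    simp only [hist]
    rw [ih', h n n.lt_succ_self]

lemma leader_congr (x : Fin K × ℕ → ℝ) {c c' : ℕ → Bool} {n : ℕ} (h : ∀ k < n, c k = c' k) :
    leader F δ Tf Tg (x, c) n = leader F δ Tf Tg (x, c') n := by
  unfold leader
  rw [hist_congr F δ Tf Tg x h]

end Trajectory

section Candidates

variable (F : ExpFamily) {K n : ℕ} (δ : ℝ) (Tf Tg : TieRule K) (h : History K n)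

lemma maximizers_nonempty {S : Finset (Fin K)} (hS : S.Nonempty) (u : Fin K → EReal) :
    (maximizers S u).Nonempty := by
  obtain ⟨i, hi, hmax⟩ := S.exists_max_image u hS
  exact ⟨i, Finset.mem_filter.2 ⟨hi, hmax⟩⟩

lemma ucb_le_ucb_candF (i : Fin K) :
    ucb F h (explF (n + 1)) i ≤ ucb F h (explF (n + 1)) (candF F Tf h) := by
  have hmem := Tf.pick_mem n h _
    (maximizers_nonempty ⟨i, Finset.mem_univ i⟩ fun i => ucb F h (explF (n + 1)) i)
  exact (Finset.mem_filter.1 hmem).2 i (Finset.mem_univ i)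

lemma candG_mem (hK : 2 ≤ K) : candG F δ Tf Tg h ∈ maximizers (Finset.univ.erase (candF F Tf h))
    fun i => ucb F h (explG K δ (n + 1)) i := by
  refine Tg.pick_mem n h _ (maximizers_nonempty ?_ _)
  rw [← Finset.card_pos, Finset.card_erase_of_mem (Finset.mem_univ _), Finset.card_univ,
    Fintype.card_fin]
  omega

lemma candG_ne_candF (hK : 2 ≤ K) : candG F δ Tf Tg h ≠ candF F Tf h :=
  (Finset.mem_erase.1 (Finset.mem_filter.1 (candG_mem F δ Tf Tg h hK)).1).1

lemma ucb_le_ucb_candG (hK : 2 ≤ K) {i : Fin K} (hi : i ≠ candF F Tf h) :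
    ucb F h (explG K δ (n + 1)) i ≤ ucb F h (explG K δ (n + 1)) (candG F δ Tf Tg h) :=
  (Finset.mem_filter.1 (candG_mem F δ Tf Tg h hK)).2 i
    (Finset.mem_erase.2 ⟨hi, Finset.mem_univ i⟩)

lemma abs_sub_le_of_mem_confSet {c : ℝ} {i : Fin K} {m : ℝ} (hm : m ∈ confSet F h c i) :
    |empMean h i - m| ≤ √(4 * F.V * (c / pullCount h i)) :=
  Real.abs_le_sqrt (F.sq_le_of_klExt_le hm.1 hm.2)

lemma ucb_le (c : ℝ) (i : Fin K) :
    ucb F h c i ≤ ((empMean h i + √(4 * F.V * (c / pullCount h i)) : ℝ) : EReal) := by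
  refine sSup_le ?_
  rintro _ ⟨m, hm, rfl⟩
  have := (abs_le.1 (abs_sub_le_of_mem_confSet F h hm)).1
  exact EReal.coe_le_coe_iff.2 (by linarith)

lemma le_lcb (c : ℝ) (i : Fin K) :
    ((empMean h i - √(4 * F.V * (c / pullCount h i)) : ℝ) : EReal) ≤ lcb F h c i := by
  refine le_sInf ?_
  rintro _ ⟨m, hm, rfl⟩
  have := (abs_le.1 (abs_sub_le_of_mem_confSet F h hm)).2
  exact EReal.coe_le_coe_iff.2 (by linarith)

lemma le_ucb_of_mem {c : ℝ} {i : Fin K} {m : ℝ} (hm : m ∈ confSet F h c i) :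
    (m : EReal) ≤ ucb F h c i := le_sSup ⟨m, hm, rfl⟩

lemma lcb_le_of_mem {c : ℝ} {i : Fin K} {m : ℝ} (hm : m ∈ confSet F h c i) :
    lcb F h c i ≤ (m : EReal) := sInf_le ⟨m, hm, rfl⟩

end Candidates

/-! ### Correctness -/

section Correctness

variable {F : ExpFamily} {K : ℕ} (B : Bandit F K)

lemma Bandit.gap_nonneg (B : Bandit F K) (i : Fin K) : 0 ≤ B.gap i := by
  by_cases hi : i = B.best
  · simp [hi, Bandit.gap]
  · exact (sub_pos.2 (B.lt_best i hi)).le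

lemma mem_confSet_hist {δ : ℝ} {Tf Tg : TieRule K} {ω : Outcome K} {i : Fin K} {n : ℕ} {c : ℝ}
    (h : F.klExt (rewardAvg ω i (pulls F δ Tf Tg ω i n)) (B.μ i)
      ≤ ((c / pulls F δ Tf Tg ω i n : ℝ) : EReal)) :
    B.μ i ∈ confSet F (hist F δ Tf Tg ω n) c i := by
  refine ⟨B.mem_I i, ?_⟩
  rw [empMean_hist]
  exact h

lemma explG_le_explG {δ : ℝ} (hδ : 0 < δ) {k n : ℕ} (hK : 1 ≤ K) (hk : 1 ≤ k) (hkn : k ≤ n) :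
    explG K δ k ≤ explG K δ n := by
  have hK' : (1 : ℝ) ≤ K := by exact_mod_cast hK
  have hk' : (1 : ℝ) ≤ k := by exact_mod_cast hk
  have hkn' : (k : ℝ) ≤ n := by exact_mod_cast hkn
  unfold explG
  apply Real.log_le_log (by positivity)
  gcongr

/-- The event that a confidence region at level `g` misses its mean has probability at most `δ`.
The arm has been pulled at most `t - 1` times at time `t`, so that a union bound over the numbers of
pulls, instead of over the times, suffices. -/
lemma measure_exists_lt_klExt_le {δ : ℝ} (hδ : 0 < δ) (hδ1 : δ < 1) :
    B.prob δ {ω | ∃ i, ∃ n : ℕ, 1 ≤ n ∧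
      ((explG K δ (n + 1) / n : ℝ) : EReal) < F.klExt (rewardAvg ω i n) (B.μ i)}
      ≤ ENNReal.ofReal δ := by
  have hK : 1 ≤ K := by have := B.best.2; omega
  have hK' : (1 : ℝ) ≤ K := by exact_mod_cast hK
  have hone : ∀ i, ∀ n : ℕ, 1 ≤ n → B.prob δ {ω |
      ((explG K δ (n + 1) / n : ℝ) : EReal) < F.klExt (rewardAvg ω i n) (B.μ i)}
      ≤ ENNReal.ofReal (δ / K * ((1 : ℝ) / n - 1 / (n + 1 : ℝ))) := by
    intro i n hn
    have hn' : (1 : ℝ) ≤ n := by exact_mod_cast hn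
    have harg : 1 ≤ 2 * K * ((n + 1 : ℕ) : ℝ) ^ 2 / δ := by
      rw [le_div_iff₀ hδ]
      push_cast
      nlinarith [mul_self_nonneg (n : ℝ), mul_nonneg (sub_nonneg.2 hK') (sq_nonneg ((n : ℝ) + 1))]
    refine (B.measure_lt_klExt_le δ i hn (c := explG K δ (n + 1)) (Real.log_nonneg harg)).trans
      (ENNReal.ofReal_le_ofReal ?_)
    rw [explG, Real.exp_neg, Real.exp_log (by linarith)]
    push_cast
    have h1 : 2 * (2 * (K : ℝ) * ((n : ℝ) + 1) ^ 2 / δ)⁻¹ = δ / K * (1 / ((n : ℝ) + 1) ^ 2) := by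
      field_simp
    rw [h1]
    refine mul_le_mul_of_nonneg_left ?_ (by positivity)
    rw [div_sub_div _ _ (by positivity) (by positivity), div_le_div_iff₀ (by positivity)
      (by positivity)]
    nlinarith
  have hsub : {ω : Outcome K | ∃ i, ∃ n : ℕ, 1 ≤ n ∧
      ((explG K δ (n + 1) / n : ℝ) : EReal) < F.klExt (rewardAvg ω i n) (B.μ i)}
      ⊆ ⋃ i, ⋃ n : ℕ, {ω | ((explG K δ (n + 1 + 1) / (n + 1 : ℕ) : ℝ) : EReal)
        < F.klExt (rewardAvg ω i (n + 1)) (B.μ i)} := by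
    rintro ω ⟨i, n, hn, h⟩
    refine Set.mem_iUnion.2 ⟨i, Set.mem_iUnion.2 ⟨n - 1, ?_⟩⟩
    rw [Set.mem_ofPred_eq, Nat.sub_add_cancel hn]
    exact h
  have htel : ∑' n : ℕ, ENNReal.ofReal (δ / K * ((1 : ℝ) / (n + 1 : ℕ) - 1 / ((n + 1 : ℕ) + 1 : ℝ)))
      ≤ ENNReal.ofReal (δ / K) := by
    refine ENNReal.tsum_le_of_sum_range_le fun N => ?_
    rw [← ENNReal.ofReal_sum_of_nonneg]
    · refine ENNReal.ofReal_le_ofReal ?_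
      rw [← Finset.mul_sum]
      have h1 : ∑ n ∈ Finset.range N, ((1 : ℝ) / (n + 1 : ℕ) - 1 / ((n + 1 : ℕ) + 1 : ℝ))
          = 1 - 1 / (N + 1 : ℝ) := by
        have := Finset.sum_range_sub' (fun n : ℕ => (1 : ℝ) / (n + 1 : ℕ)) N
        simpa using this
      rw [h1]
      refine mul_le_of_le_one_right (by positivity) ?_
      have : (0 : ℝ) ≤ 1 / (N + 1 : ℝ) := by positivity
      linarith
    · intro n _
      refine mul_nonneg (by positivity) (sub_nonneg.2 ?_)
      exact one_div_le_one_div_of_le (by positivity) (by simp)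
  calc _ ≤ ∑' i : Fin K, ∑' n : ℕ, B.prob δ {ω |
        ((explG K δ (n + 1 + 1) / (n + 1 : ℕ) : ℝ) : EReal)
          < F.klExt (rewardAvg ω i (n + 1)) (B.μ i)} :=
        (measure_mono hsub).trans ((measure_iUnion_le _).trans
          (ENNReal.tsum_le_tsum fun i => measure_iUnion_le _))
    _ ≤ ∑' _ : Fin K, ENNReal.ofReal (δ / K) :=
        ENNReal.tsum_le_tsum fun i => (ENNReal.tsum_le_tsum fun n =>
          hone i (n + 1) (by omega)).trans htel
    _ = ENNReal.ofReal δ := by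
        rw [tsum_fintype, Finset.sum_const, Finset.card_univ, Fintype.card_fin, nsmul_eq_mul,
          ← ENNReal.ofReal_natCast, ← ENNReal.ofReal_mul (by positivity)]
        congr 1
        field_simp

/-- If all confidence regions at level `g` contain their means, the recommendation is correct. -/
lemma leader_eq_best_of_stopCond (hK : 2 ≤ K) {δ : ℝ} (hδ : 0 < δ) {Tf Tg : TieRule K}
    {ω : Outcome K} (hgood : ∀ i, ∀ n : ℕ, 1 ≤ n →
      F.klExt (rewardAvg ω i n) (B.μ i) ≤ ((explG K δ (n + 1) / n : ℝ) : EReal))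
    {n : ℕ} (hn : K ≤ n) (hs : stopCond F δ Tf Tg (hist F δ Tf Tg ω n)) :
    candF F Tf (hist F δ Tf Tg ω n) = B.best := by
  have hmem : ∀ i, B.μ i ∈ confSet F (hist F δ Tf Tg ω n) (explG K δ (n + 1)) i := by
    intro i
    have h1 := one_le_pulls F δ Tf Tg ω i hn
    refine mem_confSet_hist B ((hgood i _ h1).trans (EReal.coe_le_coe_iff.2 ?_))
    refine div_le_div_of_nonneg_right ?_ (Nat.cast_nonneg _)
    exact explG_le_explG hδ (by omega) (by omega)
      (Nat.succ_le_succ (pulls_le F δ Tf Tg ω i n))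
  by_contra hne
  have h1 := (le_ucb_of_mem F _ (hmem B.best)).trans
    (ucb_le_ucb_candG F δ Tf Tg _ hK (Ne.symm hne))
  have h2 := (h1.trans_lt hs).trans_le (lcb_le_of_mem F _ (hmem _))
  exact absurd (B.lt_best _ hne) (not_lt.2 (EReal.coe_lt_coe_iff.1 h2).le)

/-- An algorithm run that almost surely stops recommends a wrong arm with probability at most
`δ`. -/
lemma measure_recommend_ne_le (hK : 2 ≤ K) {δ : ℝ} (hδ : 0 < δ) (hδ1 : δ < 1) {Tf Tg : TieRule K}
    (hfinite : ∀ᵐ ω ∂(B.prob δ), stopTime F δ Tf Tg ω < ⊤) :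
    B.prob δ {ω | recommend F δ Tf Tg ω ≠ B.best} ≤ ENNReal.ofReal δ := by
  refine (measure_mono_ae ?_).trans (measure_exists_lt_klExt_le B hδ hδ1)
  filter_upwards [hfinite] with ω hω hne
  by_contra hgood
  refine hne ?_
  rcases stopTime_cases F δ Tf Tg ω with ⟨htop, -⟩ | ⟨n, hn, hs, heq, -⟩
  · exact absurd htop hω.ne
  · have h1 : recommend F δ Tf Tg ω = candF F Tf (hist F δ Tf Tg ω n) := by
      unfold recommend
      rw [heq, ENat.toNat_natCast, Nat.add_sub_cancel]
    rw [h1]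
    refine leader_eq_best_of_stopCond B hK hδ (fun i k hk => ?_) hn hs
    by_contra hlt
    exact hgood ⟨i, k, hk, not_le.1 hlt⟩

end Correctness

/-! ### Deviations of adapted sums of coins -/

/-- The probability of tails. -/
noncomputable def tailsProb (δ : ℝ) : ℝ := 1 - coinBias δ

lemma tailsProb_pos (δ : ℝ) : 0 < tailsProb δ := by
  unfold tailsProb coinBias
  split_ifs with h
  · have : 0 < min (1 / Real.log (Real.log (1 / δ))) (1 / 2) := lt_min (by positivity) (by norm_num)
    linarith
  · norm_num

lemma tailsProb_le_half (δ : ℝ) : tailsProb δ ≤ 1 / 2 := by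
  unfold tailsProb coinBias
  split_ifs with h
  · have := min_le_right (1 / Real.log (Real.log (1 / δ))) (1 / 2)
    linarith
  · norm_num

lemma lintegral_coinLaw (δ : ℝ) (g : Bool → ℝ≥0∞) : ∫⁻ b, g b ∂(coinLaw δ) =
    ENNReal.ofReal (1 - tailsProb δ) * g true + ENNReal.ofReal (tailsProb δ) * g false := by
  have h1 : ENNReal.ofReal (1 - tailsProb δ) = ((unitInterval.toNNReal ⟨coinBias δ, coinBias_mem δ⟩ :
      NNReal) : ℝ≥0∞) := by
    rw [tailsProb, sub_sub_cancel, ENNReal.ofReal_eq_coe_nnreal (coinBias_mem δ).1]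
    rfl
  have h2 : ENNReal.ofReal (tailsProb δ) = ((unitInterval.toNNReal
      (unitInterval.symm ⟨coinBias δ, coinBias_mem δ⟩) : NNReal) : ℝ≥0∞) := by
    rw [ENNReal.ofReal_eq_coe_nnreal (tailsProb_pos δ).le]
    rfl
  rw [h1, h2, coinLaw, bernoulliMeasure_def, lintegral_add_measure, lintegral_smul_measure,
    lintegral_smul_measure, lintegral_dirac, lintegral_dirac]
  rfl

section Coins

variable {F : ExpFamily} {K : ℕ} (B : Bandit F K)

open Classical in
/-- Exponential deviation bound for a sum over the coins of an adapted set of times, where heads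
count `a` and tails count `b`. -/
lemma measure_lt_sum_coin_le (δ : ℝ) {a b : ℝ}
    (hab : (1 - tailsProb δ) * Real.exp a + tailsProb δ * Real.exp b ≤ 1)
    (D : ℕ → Outcome K → Prop)
    (hD : ∀ n x c c', (∀ k < n, c k = c' k) → (D n (x, c) ↔ D n (x, c')))
    (hmeas : ∀ n, MeasurableSet {ω | D n ω}) (n : ℕ) (Λ : ℝ) :
    B.prob δ {ω | Λ < ∑ k ∈ (Finset.range n).filter (fun k => D k ω),
      if ω.2 k = true then a else b} ≤ ENNReal.ofReal (Real.exp (-Λ)) := by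
  set w : ℕ → Outcome K → Bool → ℝ≥0∞ := fun k ω c =>
    ENNReal.ofReal (Real.exp (if D k ω then (if c = true then a else b) else 0)) with hw
  have hγ := tailsProb_pos δ
  have hγ' := tailsProb_le_half δ
  have h := B.measure_lt_prod_coin_le δ w
    (fun n x c c' b h => by simp only [hw, hD n x c c' h])
    (fun n ω => by
      rw [lintegral_coinLaw]
      by_cases hDn : D n ω
      · simp only [hw, hDn, if_true, Bool.false_eq_true, if_false]
        rw [← ENNReal.ofReal_mul (by linarith), ← ENNReal.ofReal_mul hγ.le,
          ← ENNReal.ofReal_add (by have := Real.exp_pos a; nlinarith) (by positivity)]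
        exact ENNReal.ofReal_le_one.2 hab
      · simp only [hw, hDn, if_false, Real.exp_zero, ENNReal.ofReal_one, mul_one]
        rw [← ENNReal.ofReal_add (by linarith) hγ.le]
        simp)
    n (fun k => by
      refine ENNReal.measurable_ofReal.comp (Real.measurable_exp.comp (Measurable.ite (hmeas k)
        (Measurable.ite ?_ measurable_const measurable_const) measurable_const))
      exact measurableSet_eq_fun ((measurable_pi_apply k).comp measurable_snd) measurable_const)
    (ε := ENNReal.ofReal (Real.exp Λ)) (by simp [Real.exp_pos]) ENNReal.ofReal_ne_top
  rw [← ENNReal.ofReal_inv_of_pos (Real.exp_pos _), ← Real.exp_neg] at h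
  refine le_trans (measure_mono fun ω hω => ?_) h
  rw [Set.mem_ofPred_eq] at hω ⊢
  simp only [hw]
  rw [← ENNReal.ofReal_prod_of_nonneg (fun _ _ => (Real.exp_pos _).le), ← Real.exp_sum,
    ← Finset.sum_filter]
  exact (ENNReal.ofReal_lt_ofReal_iff (Real.exp_pos _)).2 (Real.exp_lt_exp.2 hω)

lemma quarter_le_log : (1 : ℝ) / 4 ≤ Real.log (4 / 3) := by
  have := Real.one_sub_inv_le_log_of_pos (x := 4 / 3) (by norm_num)
  norm_num at this ⊢
  linarith

open Classical in
/-- A fair share of the coins of an adapted set of times shows heads. -/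
lemma measure_heads_lt_le (δ : ℝ) (D : ℕ → Outcome K → Prop)
    (hD : ∀ n x c c', (∀ k < n, c k = c' k) → (D n (x, c) ↔ D n (x, c')))
    (hmeas : ∀ n, MeasurableSet {ω | D n ω}) (n : ℕ) (Λ : ℝ) :
    B.prob δ {ω | 4 * (Λ + (((Finset.range n).filter fun k => D k ω ∧ ω.2 k = true).card : ℝ))
      < ((Finset.range n).filter fun k => D k ω).card} ≤ ENNReal.ofReal (Real.exp (-Λ)) := by
  have hγ' := tailsProb_le_half δ
  -- the weights `2 / 3` and `4 / 3` have mean at most one, as tails have probability at most `1 / 2`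
  refine le_trans (measure_mono fun ω hω => ?_) (measure_lt_sum_coin_le B δ
    (a := Real.log (2 / 3)) (b := Real.log (4 / 3)) ?_ D hD hmeas n Λ)
  · rw [Set.mem_ofPred_eq] at hω ⊢
    have h1 : Real.log (2 / 3) = Real.log (4 / 3) - Real.log 2 := by
      rw [← Real.log_div (by norm_num) (by norm_num)]; norm_num
    have h2 : ∑ k ∈ (Finset.range n).filter (fun k => D k ω),
        (if ω.2 k = true then Real.log (2 / 3) else Real.log (4 / 3))
        = ((Finset.range n).filter fun k => D k ω).card * Real.log (4 / 3)
          - ((Finset.range n).filter fun k => D k ω ∧ ω.2 k = true).card * Real.log 2 := by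
      rw [← Finset.filter_filter, Finset.card_filter (fun k => ω.2 k = true), Nat.cast_sum,
        Finset.sum_mul, ← nsmul_eq_mul, ← Finset.sum_const, ← Finset.sum_sub_distrib]
      refine Finset.sum_congr rfl fun k _ => ?_
      split_ifs <;> simp [h1]
    rw [h2]
    have h3 := Real.log_two_lt_d9
    have h4 := quarter_le_log
    set H := ((Finset.range n).filter fun k => D k ω ∧ ω.2 k = true).card
    set N := ((Finset.range n).filter fun k => D k ω).card
    have hH : (0 : ℝ) ≤ H := Nat.cast_nonneg _
    have hN : (0 : ℝ) ≤ N := Nat.cast_nonneg _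
    nlinarith
  · rw [Real.exp_log (by norm_num), Real.exp_log (by norm_num)]
    linarith

/-- Deviation bound for a sum over all coins, in terms of the number of tails. -/
lemma measure_lt_tails_le (δ : ℝ) {a b : ℝ}
    (hab : (1 - tailsProb δ) * Real.exp a + tailsProb δ * Real.exp (a + b) ≤ 1) (n : ℕ) (Λ : ℝ) :
    B.prob δ {ω | Λ < n * a + ((Finset.range n).filter fun k => ω.2 k = false).card * b}
      ≤ ENNReal.ofReal (Real.exp (-Λ)) := by
  refine le_trans (measure_mono fun ω hω => ?_) (measure_lt_sum_coin_le B δ hab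
    (fun _ _ => True) (fun _ _ _ _ _ => Iff.rfl) (fun _ => MeasurableSet.const True) n Λ)
  rw [Set.mem_ofPred_eq] at hω ⊢
  refine hω.trans_eq ?_
  rw [Finset.filter_true, Finset.card_filter, Nat.cast_sum, Finset.sum_mul]
  nth_rewrite 1 [← Finset.card_range n]
  rw [← nsmul_eq_mul, ← Finset.sum_const, ← Finset.sum_add_distrib]
  refine Finset.sum_congr rfl fun k _ => ?_
  cases ω.2 k <;> simp

lemma measure_tails_gt_le (δ : ℝ) (n : ℕ) {Λ : ℝ} (hΛ : 0 ≤ Λ) :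
    B.prob δ {ω | 2 * (Λ + tailsProb δ * n)
      < ((Finset.range n).filter fun k => ω.2 k = false).card} ≤ ENNReal.ofReal (Real.exp (-Λ)) := by
  have hγ := tailsProb_pos δ
  refine le_trans (measure_mono fun ω hω => ?_) (measure_lt_tails_le B δ
    (a := -Real.log (1 + tailsProb δ)) (b := Real.log 2) ?_ n Λ)
  · rw [Set.mem_ofPred_eq] at hω ⊢
    have h1 := Real.log_le_sub_one_of_pos (x := 1 + tailsProb δ) (by linarith)
    have h2 := Real.log_two_gt_d9
    have h3 : (n : ℝ) * Real.log (1 + tailsProb δ) ≤ n * tailsProb δ :=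
      mul_le_mul_of_nonneg_left (by linarith) (Nat.cast_nonneg _)
    have h4 : (0 : ℝ) ≤ tailsProb δ * n := by positivity
    nlinarith
  · rw [Real.exp_add, Real.exp_neg, Real.exp_log (by linarith), Real.exp_log (by norm_num)]
    rw [← mul_assoc, mul_assoc, mul_comm _ (2 : ℝ), ← mul_assoc, ← add_mul, ← div_eq_mul_inv,
      div_le_one (by linarith)]
    linarith

lemma measure_tails_lt_le (δ : ℝ) (n : ℕ) (Λ : ℝ) :
    B.prob δ {ω | Λ + (((Finset.range n).filter fun k => ω.2 k = false).card : ℝ)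
      < tailsProb δ * n / 2} ≤ ENNReal.ofReal (Real.exp (-Λ)) := by
  have hγ := tailsProb_pos δ
  have hγ' := tailsProb_le_half δ
  refine le_trans (measure_mono fun ω hω => ?_) (measure_lt_tails_le B δ
    (a := -Real.log (1 - tailsProb δ / 2)) (b := -Real.log 2) ?_ n Λ)
  · rw [Set.mem_ofPred_eq] at hω ⊢
    have h1 := Real.log_le_sub_one_of_pos (x := 1 - tailsProb δ / 2) (by linarith)
    have h2 := Real.log_two_lt_d9
    have h3 : (n : ℝ) * (tailsProb δ / 2) ≤ n * -Real.log (1 - tailsProb δ / 2) :=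
      mul_le_mul_of_nonneg_left (by linarith) (Nat.cast_nonneg _)
    have h4 : (0 : ℝ) ≤ ((Finset.range n).filter fun k => ω.2 k = false).card := Nat.cast_nonneg _
    nlinarith
  · rw [Real.exp_add, Real.exp_neg, Real.exp_neg, Real.exp_log (by linarith),
      Real.exp_log (by norm_num)]
    rw [← mul_assoc, mul_right_comm, ← add_mul, ← div_eq_mul_inv, div_le_one (by linarith)]
    linarith

end Coins

/-! ### Good runs -/

section GoodRun

variable {F : ExpFamily} {K : ℕ} (B : Bandit F K)

/-- A telescoping majorant for the failure probabilities of the concentration bound. -/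
lemma sum_one_div_max_cube_le {s : ℕ} (hs : 1 ≤ s) (N : ℕ) :
    ∑ n ∈ Finset.range N, (1 : ℝ) / (max (n + 2) s : ℕ) ^ 3 ≤ 2 / (s : ℝ) ^ 2 := by
  have hs' : (1 : ℝ) ≤ s := by exact_mod_cast hs
  set φ : ℕ → ℝ := fun n => ((s - n : ℕ) : ℝ) / (s : ℝ) ^ 3 + 1 / (max n s : ℕ) ^ 2 with hφ
  have hstep : ∀ n : ℕ, (1 : ℝ) / (max (n + 2) s : ℕ) ^ 3 ≤ φ n - φ (n + 1) := by
    intro n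
    rcases lt_or_ge n s with h | h
    · have h1 : ((s - n : ℕ) : ℝ) = ((s - (n + 1) : ℕ) : ℝ) + 1 := by
        have : s - n = s - (n + 1) + 1 := by omega
        rw [this]; push_cast; ring
      have h2 : φ n - φ (n + 1) = 1 / (s : ℝ) ^ 3 := by
        simp only [hφ, max_eq_right h.le, max_eq_right (Nat.succ_le_of_lt h), h1]
        ring
      rw [h2]
      have : (s : ℝ) ≤ (max (n + 2) s : ℕ) := by exact_mod_cast le_max_right _ _
      gcongr
    · have hn : (1 : ℝ) ≤ n := by exact_mod_cast hs.trans h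
      have h2 : φ n - φ (n + 1) = 1 / (n : ℝ) ^ 2 - 1 / ((n : ℝ) + 1) ^ 2 := by
        simp only [hφ, max_eq_left h, max_eq_left (h.trans n.le_succ), Nat.sub_eq_zero_of_le h,
          Nat.sub_eq_zero_of_le (h.trans n.le_succ)]
        push_cast
        ring
      rw [h2]
      have h3 : ((n : ℝ) + 1) ≤ (max (n + 2) s : ℕ) := by
        have : n + 1 ≤ max (n + 2) s := by omega
        exact_mod_cast this
      calc (1 : ℝ) / (max (n + 2) s : ℕ) ^ 3 ≤ 1 / ((n : ℝ) + 1) ^ 3 := by gcongr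
        _ ≤ _ := by
          rw [div_sub_div _ _ (by positivity) (by positivity), div_le_div_iff₀ (by positivity)
            (by positivity)]
          have : 0 ≤ (n : ℝ) ^ 3 := by positivity
          nlinarith [sq_nonneg (n : ℝ), mul_nonneg this (sq_nonneg (n : ℝ))]
  calc ∑ n ∈ Finset.range N, (1 : ℝ) / (max (n + 2) s : ℕ) ^ 3
      ≤ ∑ n ∈ Finset.range N, (φ n - φ (n + 1)) := Finset.sum_le_sum fun n _ => hstep n
    _ = φ 0 - φ N := Finset.sum_range_sub' φ N
    _ ≤ φ 0 := by
        have : 0 ≤ φ N := by positivity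
        linarith
    _ = 2 / (s : ℝ) ^ 2 := by
        simp only [hφ, Nat.sub_zero, Nat.zero_max]
        field_simp
        norm_num

/-- With high probability, the confidence regions at level `3 log t` contain their means at all
times `t ≥ s`. -/
lemma measure_exists_lt_klExt_max_le (δ : ℝ) {s : ℕ} (hs : 1 ≤ s) :
    B.prob δ {ω | ∃ i, ∃ n : ℕ, 1 ≤ n ∧ ((3 * Real.log (max (n + 1) s : ℕ) / n : ℝ) : EReal)
      < F.klExt (rewardAvg ω i n) (B.μ i)} ≤ ENNReal.ofReal (4 * K / (s : ℝ) ^ 2) := by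
  have hone : ∀ i, ∀ n : ℕ, B.prob δ {ω |
      ((3 * Real.log (max (n + 2) s : ℕ) / (n + 1 : ℕ) : ℝ) : EReal)
        < F.klExt (rewardAvg ω i (n + 1)) (B.μ i)}
      ≤ ENNReal.ofReal (2 * ((1 : ℝ) / (max (n + 2) s : ℕ) ^ 3)) := by
    intro i n
    have hpos : 1 ≤ max (n + 2) s := by omega
    have hpos' : (1 : ℝ) ≤ (max (n + 2) s : ℕ) := by exact_mod_cast hpos
    refine (B.measure_lt_klExt_le δ i (n := n + 1) (by omega)
      (c := 3 * Real.log (max (n + 2) s : ℕ))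
      (mul_nonneg (by norm_num) (Real.log_nonneg hpos'))).trans (ENNReal.ofReal_le_ofReal ?_)
    refine mul_le_mul_of_nonneg_left (le_of_eq ?_) (by norm_num)
    rw [Real.exp_neg, one_div, mul_comm, Real.exp_mul, Real.exp_log (by linarith)]
    norm_cast
  have hsub : {ω : Outcome K | ∃ i, ∃ n : ℕ, 1 ≤ n ∧
      ((3 * Real.log (max (n + 1) s : ℕ) / n : ℝ) : EReal) < F.klExt (rewardAvg ω i n) (B.μ i)}
      ⊆ ⋃ i, ⋃ n : ℕ, {ω | ((3 * Real.log (max (n + 2) s : ℕ) / (n + 1 : ℕ) : ℝ) : EReal)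
        < F.klExt (rewardAvg ω i (n + 1)) (B.μ i)} := by
    rintro ω ⟨i, n, hn, h⟩
    refine Set.mem_iUnion.2 ⟨i, Set.mem_iUnion.2 ⟨n - 1, ?_⟩⟩
    obtain ⟨k, rfl⟩ : ∃ k, n = k + 1 := ⟨n - 1, by omega⟩
    exact h
  have htel : ∑' n : ℕ, ENNReal.ofReal (2 * ((1 : ℝ) / (max (n + 2) s : ℕ) ^ 3))
      ≤ ENNReal.ofReal (2 * (2 / (s : ℝ) ^ 2)) := by
    refine ENNReal.tsum_le_of_sum_range_le fun N => ?_
    rw [← ENNReal.ofReal_sum_of_nonneg (fun _ _ => by positivity), ← Finset.mul_sum]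
    exact ENNReal.ofReal_le_ofReal
      (mul_le_mul_of_nonneg_left (sum_one_div_max_cube_le hs N) (by norm_num))
  calc _ ≤ ∑' i : Fin K, ∑' n : ℕ, B.prob δ {ω |
        ((3 * Real.log (max (n + 2) s : ℕ) / (n + 1 : ℕ) : ℝ) : EReal)
          < F.klExt (rewardAvg ω i (n + 1)) (B.μ i)} :=
        (measure_mono hsub).trans ((measure_iUnion_le _).trans
          (ENNReal.tsum_le_tsum fun i => measure_iUnion_le _))
    _ ≤ ∑' _ : Fin K, ENNReal.ofReal (2 * (2 / (s : ℝ) ^ 2)) :=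
        ENNReal.tsum_le_tsum fun i => (ENNReal.tsum_le_tsum fun n => hone i n).trans htel
    _ = ENNReal.ofReal (4 * K / (s : ℝ) ^ 2) := by
        rw [tsum_fintype, Finset.sum_const, Finset.card_univ, Fintype.card_fin, nsmul_eq_mul,
          ← ENNReal.ofReal_natCast, ← ENNReal.ofReal_mul (by positivity)]
        congr 1
        ring

/-- The time, about a fraction `tailsProb δ / 16` of the horizon `q ^ 4`, by which the optimal arm
is pulled often enough on a good run. -/
noncomputable def warmup (δ : ℝ) (q : ℕ) : ℕ := ⌊tailsProb δ * (q : ℝ) ^ 4 / 16⌋₊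

/-- The leader at time step `k + 1` is not the optimal arm, after the first `q ^ 3` steps. -/
def WrongLeader (δ : ℝ) (Tf Tg : TieRule K) (q k : ℕ) (ω : Outcome K) : Prop :=
  q ^ 3 ≤ k ∧ leader F δ Tf Tg ω k ≠ B.best

open Classical in
/-- A run that is good for the horizon `q ^ 4`: the rewards concentrate, with confidence regions that
may fail before time `q ^ 3` only, and the coins show heads and tails about as often as expected. -/
structure IsGoodRun (δ : ℝ) (Tf Tg : TieRule K) (q : ℕ) (ω : Outcome K) : Prop where
  /-- the means lie in their confidence regions -/
  klExt_le : ∀ i, ∀ n : ℕ, 1 ≤ n → F.klExt (rewardAvg ω i n) (B.μ i)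
    ≤ ((3 * Real.log (max (n + 1) (q ^ 3) : ℕ) / n : ℝ) : EReal)
  /-- the wrong leaders are pulled in a fair share of the cases -/
  wrong_le : (((Finset.range (q ^ 4)).filter fun k => WrongLeader B δ Tf Tg q k ω).card : ℝ)
    ≤ 4 * (6 * Real.log q + (((Finset.range (q ^ 4)).filter fun k =>
      WrongLeader B δ Tf Tg q k ω ∧ ω.2 k = true).card : ℝ))
  /-- there are enough heads in the warm-up -/
  le_heads : (warmup δ q : ℝ) ≤ 4 * (6 * Real.log q +
    (((Finset.range (warmup δ q)).filter fun k => ω.2 k = true).card : ℝ))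
  /-- there are few tails in the warm-up -/
  tails_le : (((Finset.range (warmup δ q)).filter fun k => ω.2 k = false).card : ℝ)
    ≤ 2 * (6 * Real.log q + tailsProb δ * warmup δ q)
  /-- there are enough tails before the horizon -/
  le_tails : tailsProb δ * (q : ℝ) ^ 4 / 2 ≤ 6 * Real.log q +
    (((Finset.range (q ^ 4)).filter fun k => ω.2 k = false).card : ℝ)

lemma Bandit.nontrivial_I (B : Bandit F K) (hK : 2 ≤ K) : F.I.Nontrivial := by
  have : Nontrivial (Fin K) := Fin.nontrivial_iff_two_le.2 hK
  obtain ⟨i, hi⟩ := exists_ne B.best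
  exact ⟨B.μ i, B.mem_I i, B.μ B.best, B.mem_I _, (B.lt_best i hi).ne⟩

lemma measure_not_isGoodRun_le (hK : 2 ≤ K) (δ : ℝ) (Tf Tg : TieRule K) {q : ℕ} (hq : 1 ≤ q) :
    B.prob δ {ω | ¬ IsGoodRun B δ Tf Tg q ω} ≤ ENNReal.ofReal ((4 * K + 4) / (q : ℝ) ^ 6) := by
  classical
  have hq' : (1 : ℝ) ≤ q := by exact_mod_cast hq
  have hF := B.nontrivial_I hK
  have hlog : 0 ≤ Real.log q := Real.log_nonneg hq'
  have hexp : Real.exp (-(6 * Real.log q)) = 1 / (q : ℝ) ^ 6 := by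
    rw [Real.exp_neg, one_div, mul_comm, Real.exp_mul, Real.exp_log (by linarith)]
    norm_cast
  have h1 := measure_exists_lt_klExt_max_le B δ (s := q ^ 3) (Nat.one_le_pow _ _ hq)
  have h2 := measure_heads_lt_le B δ
    (fun k ω => WrongLeader B δ Tf Tg q k ω)
    (fun n x c c' h => by simp only [WrongLeader, leader_congr F δ Tf Tg x h])
    (fun n => measurableSet_setOfPred.2 (Measurable.and measurable_const
      (measurableSet_setOfPred.1 (measurableSet_eq_fun
        ((measurable_candF hF Tf).comp (measurable_hist hF δ Tf Tg n)) measurable_const).compl)))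
    (q ^ 4) (6 * Real.log q)
  have h3 := measure_heads_lt_le B δ (fun _ _ => True) (fun _ _ _ _ _ => Iff.rfl)
    (fun _ => MeasurableSet.const True) (warmup δ q) (6 * Real.log q)
  have h4 := measure_tails_gt_le B δ (warmup δ q) (Λ := 6 * Real.log q) (by positivity)
  have h5 := measure_tails_lt_le B δ (q ^ 4) (6 * Real.log q)
  rw [hexp] at h2 h3 h4 h5
  have hq3 : (4 : ℝ) * K / ((q ^ 3 : ℕ) : ℝ) ^ 2 = 4 * K / (q : ℝ) ^ 6 := by
    push_cast; rw [← pow_mul]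
  rw [hq3] at h1
  refine le_trans (measure_mono ?_) ((measure_union_le _ _).trans (add_le_add h1
    ((measure_union_le _ _).trans (add_le_add h2 ((measure_union_le _ _).trans (add_le_add h3
    ((measure_union_le _ _).trans (add_le_add h4 h5))))))) |>.trans_eq ?_)
  · intro ω hω
    by_contra hcon
    simp only [Set.mem_union, Set.mem_ofPred_eq, not_or, not_lt, not_exists, not_and, true_and,
      Finset.filter_true, Finset.card_range, Nat.cast_pow] at hcon
    obtain ⟨g1, g2, g3, g4, g5⟩ := hcon
    refine hω ⟨fun i n hn => ?_, g2, g3, g4, g5⟩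
    exact g1 i n hn
  · rw [← ENNReal.ofReal_add (by positivity) (by positivity),
      ← ENNReal.ofReal_add (by positivity) (by positivity),
      ← ENNReal.ofReal_add (by positivity) (by positivity),
      ← ENNReal.ofReal_add (by positivity) (by positivity)]
    congr 1
    ring

end GoodRun

/-! ### What happens on a good run -/

/-- Constants that separate the suboptimal arms of an instance from the optimal one: a lower bound
`D` for the gaps, and bounds `κ i` for the divergences that are robust to errors of size `ε`. -/
structure Separates {F : ExpFamily} {K : ℕ} (B : Bandit F K) (D ε : ℝ) (κ : Fin K → ℝ) : Prop where
  D_pos : 0 < D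
  le_gap : ∀ i, i ≠ B.best → D ≤ B.gap i
  ε_pos : 0 < ε
  κ_pos : ∀ i, i ≠ B.best → 0 < κ i
  le_klExt : ∀ i, i ≠ B.best → ∀ x ≤ B.μ i + ε, ∀ y ∈ F.I, B.μ B.best - ε ≤ y →
    (κ i : EReal) ≤ F.klExt x y

/-- The horizon `q ^ 4` is long enough for a good run to stop before it. -/
structure LongEnough {F : ExpFamily} {K : ℕ} (B : Bandit F K) (D ε : ℝ) (κ : Fin K → ℝ) (δ : ℝ)
    (q : ℕ) : Prop where
  one_le : 1 ≤ q
  init_le : K ≤ q ^ 3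
  /-- there are at most `q ^ 3` wrong leaders -/
  wrong_le : 4 * (6 * Real.log q + K * (48 * F.V * Real.log ((q : ℝ) ^ 4 + 1) / D ^ 2 + 1))
    ≤ (q : ℝ) ^ 3
  /-- after the warm-up, the mean of the optimal arm is known up to `ε` -/
  precise : ∀ n : ℕ, (warmup δ q : ℝ) ≤ 4 * (6 * Real.log q + 2 * (q : ℝ) ^ 3 + n) →
    √(12 * F.V * Real.log ((q : ℝ) ^ 4 + 1) / n) + √(4 * F.V * (explG K δ (q ^ 4) / n)) < ε
  /-- there are more tails than pulls of challengers -/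
  stops : 6 * Real.log q + 2 * (q : ℝ) ^ 3 + 2 * (6 * Real.log q + tailsProb δ * warmup δ q)
    + ∑ i ∈ Finset.univ.erase B.best, (12 * F.V * Real.log ((q : ℝ) ^ 4 + 1) / ε ^ 2
      + explG K δ (q ^ 4) / κ i + 1) < tailsProb δ * (q : ℝ) ^ 4 / 2

namespace IsGoodRun

variable {F : ExpFamily} {K : ℕ} {B : Bandit F K} {δ : ℝ} {Tf Tg : TieRule K} {q : ℕ}
  {ω : Outcome K}

lemma log_max_le (q : ℕ) {n : ℕ} (hq : 1 ≤ q) (hn : n ≤ q ^ 4) :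
    Real.log (max (n + 1) (q ^ 3) : ℕ) ≤ Real.log ((q : ℝ) ^ 4 + 1) := by
  have h1 : max (n + 1) (q ^ 3) ≤ q ^ 4 + 1 :=
    max_le (by omega) ((Nat.pow_le_pow_right hq (by norm_num)).trans (Nat.le_succ _))
  have h2 : 0 < max (n + 1) (q ^ 3) := by omega
  refine Real.log_le_log (by exact_mod_cast h2) ?_
  exact_mod_cast h1

lemma log_horizon_nonneg (q : ℕ) : 0 ≤ Real.log ((q : ℝ) ^ 4 + 1) :=
  Real.log_nonneg (le_add_of_nonneg_left (by positivity))

/-- Up to the horizon, the empirical means are close to the means. -/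
lemma abs_rewardAvg_sub_le (h : IsGoodRun B δ Tf Tg q ω) (hq : 1 ≤ q) (i : Fin K) {n : ℕ}
    (hn : 1 ≤ n) (hnT : n ≤ q ^ 4) :
    |rewardAvg ω i n - B.μ i| ≤ √(12 * F.V * Real.log ((q : ℝ) ^ 4 + 1) / n) := by
  have hV := F.V_pos
  have hn' : (0 : ℝ) < n := by exact_mod_cast hn
  refine Real.abs_le_sqrt ((F.sq_le_of_klExt_le (B.mem_I i) (h.klExt_le i n hn)).trans ?_)
  have h1 := log_max_le q hq hnT
  have h2 : 4 * F.V * (3 * Real.log (max (n + 1) (q ^ 3) : ℕ) / n)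
      = 12 * F.V * Real.log (max (n + 1) (q ^ 3) : ℕ) / n := by ring
  rw [h2]
  gcongr

lemma mem_confSet (h : IsGoodRun B δ Tf Tg q ω) {k : ℕ} (hK : K ≤ q ^ 3) (hk : q ^ 3 ≤ k)
    (i : Fin K) : B.μ i ∈ confSet F (hist F δ Tf Tg ω k) (explF (k + 1)) i := by
  have h1 := one_le_pulls F δ Tf Tg ω i (hK.trans hk)
  refine mem_confSet_hist B ((h.klExt_le i _ h1).trans (EReal.coe_le_coe_iff.2 ?_))
  have h2 := pulls_le F δ Tf Tg ω i k
  have h3 : max (pulls F δ Tf Tg ω i k + 1) (q ^ 3) ≤ k + 1 := max_le (by omega) (by omega)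
  have h4 : 0 < max (pulls F δ Tf Tg ω i k + 1) (q ^ 3) := by omega
  unfold explF
  have h5 : Real.log (max (pulls F δ Tf Tg ω i k + 1) (q ^ 3) : ℕ) ≤ Real.log (k + 1 : ℕ) :=
    Real.log_le_log (by exact_mod_cast h4) (by exact_mod_cast h3)
  gcongr

/-- A suboptimal leader has few pulls: its confidence region at level `f` reaches up to the optimal
mean. -/
lemma pulls_le_of_wrongLeader (h : IsGoodRun B δ Tf Tg q ω) (hq : 1 ≤ q) (hK : K ≤ q ^ 3) {D : ℝ}
    (hD : 0 < D) (hgap : ∀ i, i ≠ B.best → D ≤ B.gap i) {k : ℕ} (hkT : k < q ^ 4)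
    (hw : WrongLeader B δ Tf Tg q k ω) :
    (pulls F δ Tf Tg ω (leader F δ Tf Tg ω k) k : ℝ)
      ≤ 48 * F.V * Real.log ((q : ℝ) ^ 4 + 1) / D ^ 2 := by
  obtain ⟨hk, hne⟩ := hw
  have hV := F.V_pos
  set i := leader F δ Tf Tg ω k with hi
  set ℓ := Real.log ((q : ℝ) ^ 4 + 1)
  have h1 := one_le_pulls F δ Tf Tg ω i (hK.trans hk)
  have hNk := pulls_le F δ Tf Tg ω i k
  have h2 := (le_ucb_of_mem F _ (h.mem_confSet hK hk B.best)).trans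
    ((ucb_le_ucb_candF F Tf (hist F δ Tf Tg ω k) B.best).trans
      (ucb_le F (hist F δ Tf Tg ω k) (explF (k + 1)) i))
  rw [EReal.coe_le_coe_iff, empMean_hist] at h2
  change B.μ B.best ≤ rewardAvg ω i (pulls F δ Tf Tg ω i k)
    + √(4 * F.V * (explF (k + 1) / pulls F δ Tf Tg ω i k)) at h2
  have h3 := (abs_le.1 (h.abs_rewardAvg_sub_le hq i h1 (hNk.trans hkT.le))).2
  set N := pulls F δ Tf Tg ω i k
  have hN' : (0 : ℝ) < N := by exact_mod_cast h1
  have h4 : √(4 * F.V * (explF (k + 1) / N)) ≤ √(12 * F.V * ℓ / N) := by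
    apply Real.sqrt_le_sqrt
    have h5 : Real.log (k + 1 : ℕ) ≤ ℓ := by
      refine Real.log_le_log (by positivity) ?_
      have : k + 1 ≤ q ^ 4 + 1 := by omega
      exact_mod_cast this
    have h6 : 4 * F.V * (explF (k + 1) / N) = 12 * F.V * Real.log (k + 1 : ℕ) / N := by
      unfold explF; ring
    rw [h6]
    gcongr
  have h7 : D / 2 ≤ √(12 * F.V * ℓ / N) := by
    have h8 := hgap i hne
    unfold Bandit.gap at h8
    linarith
  have h9 := (Real.le_sqrt (by positivity) (div_nonneg (mul_nonneg (by positivity)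
    (log_horizon_nonneg q)) hN'.le)).1 h7
  rw [le_div_iff₀ hN'] at h9
  rw [le_div_iff₀ (by positivity)]
  linarith

open Classical in
/-- There are few wrong leaders, as each suboptimal arm is pulled rarely as a leader, and a fair
share of the leaders are pulled. -/
lemma card_wrongLeader_le (h : IsGoodRun B δ Tf Tg q ω) {D ε : ℝ} {κ : Fin K → ℝ}
    (hs : Separates B D ε κ) (hl : LongEnough B D ε κ δ q) :
    ((Finset.range (q ^ 4)).filter fun k => WrongLeader B δ Tf Tg q k ω).card ≤ q ^ 3 := by
  set M := 48 * F.V * Real.log ((q : ℝ) ^ 4 + 1) / D ^ 2 with hM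
  have hM0 : 0 ≤ M := div_nonneg (mul_nonneg (by have := F.V_pos; positivity)
    (log_horizon_nonneg q)) (by positivity)
  set S := (Finset.range (q ^ 4)).filter fun k => WrongLeader B δ Tf Tg q k ω ∧ ω.2 k = true
  have hS : S.card ≤ K * (⌊M⌋₊ + 1) := by
    rw [Finset.card_eq_sum_card_fiberwise (f := leader F δ Tf Tg ω) (t := Finset.univ)
      (fun _ _ => Finset.mem_coe.2 (Finset.mem_univ _))]
    refine (Finset.sum_le_card_nsmul _ _ (⌊M⌋₊ + 1) fun i _ => ?_).trans_eq (by simp)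
    refine card_filter_pulls_le F δ Tf Tg ω i _ _ fun k hk => ?_
    obtain ⟨hkS, rfl⟩ := Finset.mem_filter.1 hk
    obtain ⟨hkT, hw, hc⟩ := Finset.mem_filter.1 hkS
    refine ⟨armAt_of_heads F δ Tf Tg ω (hl.init_le.trans hw.1) hc, Nat.le_floor ?_⟩
    exact h.pulls_le_of_wrongLeader hl.one_le hl.init_le hs.D_pos hs.le_gap (Finset.mem_range.1 hkT) hw
  have hS' : (S.card : ℝ) ≤ K * (M + 1) := by
    refine le_trans (by exact_mod_cast hS : (S.card : ℝ) ≤ ((K * (⌊M⌋₊ + 1) : ℕ) : ℝ)) ?_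
    push_cast
    have := Nat.floor_le hM0
    gcongr
  have h1 := h.wrong_le
  have h2 : (((Finset.range (q ^ 4)).filter fun k => WrongLeader B δ Tf Tg q k ω).card : ℝ)
      ≤ ((q ^ 3 : ℕ) : ℝ) := by
    push_cast
    refine h1.trans (le_trans ?_ hl.wrong_le)
    gcongr
  exact_mod_cast h2

lemma warmup_le (hq : 1 ≤ q) : warmup δ q ≤ q ^ 4 := by
  have h1 := tailsProb_le_half δ
  have h3 : (0 : ℝ) ≤ (q : ℝ) ^ 4 := by positivity
  refine Nat.floor_le_of_le ?_
  push_cast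
  nlinarith

open Classical in
/-- The optimal arm is pulled often in the warm-up. -/
lemma warmup_le_pulls (h : IsGoodRun B δ Tf Tg q ω) (hq : 1 ≤ q) (hK : K ≤ q ^ 3)
    (hW : ((Finset.range (q ^ 4)).filter fun k => WrongLeader B δ Tf Tg q k ω).card ≤ q ^ 3) :
    (warmup δ q : ℝ)
      ≤ 4 * (6 * Real.log q + 2 * q ^ 3 + pulls F δ Tf Tg ω B.best (warmup δ q)) := by
  have hsub : ((Finset.range (warmup δ q)).filter fun k => ω.2 k = true) ⊆
      Finset.range (q ^ 3) ∪ ((Finset.range (q ^ 4)).filter fun k => WrongLeader B δ Tf Tg q k ω) ∪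
        ((Finset.range (warmup δ q)).filter fun k => armAt F δ Tf Tg ω k = B.best) := by
    intro k hk
    simp only [Finset.mem_filter, Finset.mem_range, Finset.mem_union] at hk ⊢
    by_cases h1 : k < q ^ 3
    · exact Or.inl (Or.inl h1)
    · by_cases h2 : leader F δ Tf Tg ω k = B.best
      · right
        exact ⟨hk.1, (armAt_of_heads F δ Tf Tg ω (hK.trans (not_lt.1 h1)) hk.2).trans h2⟩
      · exact Or.inl (Or.inr ⟨hk.1.trans_le (warmup_le hq), not_lt.1 h1, h2⟩)
  have hcard := (Finset.card_le_card hsub).trans ((Finset.card_union_le _ _).trans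
    (Nat.add_le_add_right (Finset.card_union_le _ _) _))
  rw [Finset.card_range, ← pulls_eq_card] at hcard
  have h2 : ((Finset.range (warmup δ q)).filter fun k => ω.2 k = true).card
      ≤ 2 * q ^ 3 + pulls F δ Tf Tg ω B.best (warmup δ q) := by omega
  have h3 : (((Finset.range (warmup δ q)).filter fun k => ω.2 k = true).card : ℝ)
      ≤ 2 * q ^ 3 + pulls F δ Tf Tg ω B.best (warmup δ q) := by exact_mod_cast h2
  refine h.le_heads.trans ?_
  linarith

/-- After the warm-up, a challenger of the optimal arm has few pulls as long as the algorithm does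
not stop: its confidence region at level `g` reaches up almost to the optimal mean. -/
lemma pulls_challenger_le (h : IsGoodRun B δ Tf Tg q ω) (hK : 2 ≤ K) (hδ : 0 < δ) {D ε : ℝ}
    {κ : Fin K → ℝ} (hs : Separates B D ε κ) (hl : LongEnough B D ε κ δ q) {k : ℕ}
    (hk : q ^ 3 ≤ k) (hwk : warmup δ q ≤ k) (hkT : k < q ^ 4)
    (hlead : leader F δ Tf Tg ω k = B.best)
    (hns : ¬ stopCond F δ Tf Tg (hist F δ Tf Tg ω k)) :
    challenger F δ Tf Tg ω k ≠ B.best ∧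
    (pulls F δ Tf Tg ω (challenger F δ Tf Tg ω k) k : ℝ)
      ≤ 12 * F.V * Real.log ((q : ℝ) ^ 4 + 1) / ε ^ 2
        + explG K δ (q ^ 4) / κ (challenger F δ Tf Tg ω k) := by
  have hprec := hl.precise (pulls F δ Tf Tg ω B.best k) ((h.warmup_le_pulls hl.one_le hl.init_le
    (h.card_wrongLeader_le hs hl)).trans (by
      have : (pulls F δ Tf Tg ω B.best (warmup δ q) : ℝ) ≤ pulls F δ Tf Tg ω B.best k := by
        exact_mod_cast pulls_mono F δ Tf Tg ω B.best hwk
      linarith))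
  have hq := hl.one_le
  have hε := hs.ε_pos
  have hV := F.V_pos
  set i := challenger F δ Tf Tg ω k with hi
  set ℓ := Real.log ((q : ℝ) ^ 4 + 1)
  have hℓ : 0 ≤ ℓ := log_horizon_nonneg q
  set hh := hist F δ Tf Tg ω k with hhh
  have hne : i ≠ B.best := hlead ▸ candG_ne_candF F δ Tf Tg hh hK
  refine ⟨hne, ?_⟩
  set N := pulls F δ Tf Tg ω i k with hN
  set M := pulls F δ Tf Tg ω B.best k with hM
  have hN1 : 1 ≤ N := one_le_pulls F δ Tf Tg ω i (hl.init_le.trans hk)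
  have hM1 : 1 ≤ M := one_le_pulls F δ Tf Tg ω B.best (hl.init_le.trans hk)
  have hN' : (0 : ℝ) < N := by exact_mod_cast hN1
  have hg : explG K δ (k + 1) ≤ explG K δ (q ^ 4) :=
    explG_le_explG hδ (by omega) (by omega) (by omega)
  unfold stopCond at hns
  rw [not_lt] at hns
  change lcb F hh _ (leader F δ Tf Tg ω k) ≤ ucb F hh _ i at hns
  rw [hlead] at hns
  have h1 := (le_lcb F hh (explG K δ (k + 1)) B.best).trans hns
  rw [empMean_hist] at h1
  change ((rewardAvg ω B.best M - √(4 * F.V * (explG K δ (k + 1) / M)) : ℝ) : EReal) ≤ _ at h1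
  have h2 := (abs_le.1 (h.abs_rewardAvg_sub_le hq B.best hM1
    ((pulls_le F δ Tf Tg ω B.best k).trans hkT.le))).1
  have h3 : √(4 * F.V * (explG K δ (k + 1) / M)) ≤ √(4 * F.V * (explG K δ (q ^ 4) / M)) := by
    apply Real.sqrt_le_sqrt
    gcongr
  have h4 : ((B.μ B.best - ε : ℝ) : EReal) < ucb F hh (explG K δ (k + 1)) i := by
    refine lt_of_lt_of_le (EReal.coe_lt_coe_iff.2 ?_) h1
    linarith
  obtain ⟨_, ⟨m, hm, rfl⟩, hlt⟩ := lt_sSup_iff.1 h4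
  have hm2 : B.μ B.best - ε ≤ m := (EReal.coe_lt_coe_iff.1 hlt).le
  have hm3 := hm.2
  rw [empMean_hist] at hm3
  change F.klExt (rewardAvg ω i N) m ≤ ((explG K δ (k + 1) / N : ℝ) : EReal) at hm3
  have hgN : 0 ≤ explG K δ (k + 1) / N := by
    have := (sq_nonneg _).trans (F.sq_le_of_klExt_le hm.1 hm3)
    exact nonneg_of_mul_nonneg_right this (by positivity)
  have hG0 : 0 ≤ explG K δ (q ^ 4) := by
    refine le_trans ?_ hg
    by_contra hcon
    exact absurd hgN (not_le.2 (div_neg_of_neg_of_pos (not_le.1 hcon) hN'))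
  rcases le_or_gt (N : ℝ) (12 * F.V * ℓ / ε ^ 2) with hcase | hcase
  · exact hcase.trans (le_add_of_nonneg_right (div_nonneg hG0 (hs.κ_pos i hne).le))
  · have h5 := (abs_le.1 (h.abs_rewardAvg_sub_le hq i hN1
      ((pulls_le F δ Tf Tg ω i k).trans hkT.le))).2
    have h6 : √(12 * F.V * ℓ / N) ≤ ε := by
      refine Real.sqrt_le_iff.2 ⟨hε.le, ?_⟩
      rw [div_lt_iff₀ (by positivity)] at hcase
      rw [div_le_iff₀ hN']
      linarith
    have h7 := (hs.le_klExt i hne (rewardAvg ω i N) (by linarith) m hm.1 hm2).trans hm3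
    rw [EReal.coe_le_coe_iff, le_div_iff₀ hN'] at h7
    have h8 : (N : ℝ) ≤ explG K δ (q ^ 4) / κ i := by
      rw [le_div_iff₀ (hs.κ_pos i hne), mul_comm]
      exact h7.trans hg
    have h9 : 0 ≤ 12 * F.V * ℓ / ε ^ 2 := by positivity
    linarith

end IsGoodRun

namespace IsGoodRun

variable {F : ExpFamily} {K : ℕ} {B : Bandit F K} {δ : ℝ} {Tf Tg : TieRule K} {q : ℕ}
  {ω : Outcome K} {D ε : ℝ} {κ : Fin K → ℝ}

open Classical in
/-- The pulls of a challenger `i` of the optimal arm after the warm-up, while the algorithm has not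
stopped. -/
lemma card_challenges_le (h : IsGoodRun B δ Tf Tg q ω) (hK : 2 ≤ K) (hδ : 0 < δ)
    (hs : Separates B D ε κ) (hl : LongEnough B D ε κ δ q) (i : Fin K) {n : ℕ} (hn : n ≤ q ^ 4)
    (hns : ∀ k < n, K ≤ k → ¬ stopCond F δ Tf Tg (hist F δ Tf Tg ω k)) :
    ((Finset.range n).filter fun k => q ^ 3 ≤ k ∧ warmup δ q ≤ k ∧
      leader F δ Tf Tg ω k = B.best ∧ ω.2 k = false ∧ armAt F δ Tf Tg ω k = i).card
      ≤ ⌊12 * F.V * Real.log ((q : ℝ) ^ 4 + 1) / ε ^ 2 + explG K δ (q ^ 4) / κ i⌋₊ + 1 := by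
  refine card_filter_pulls_le F δ Tf Tg ω i _ _ fun k hk => ?_
  obtain ⟨hkn, hk3, hkw, hlead, hc, ha⟩ := Finset.mem_filter.1 hk
  have hkn' := Finset.mem_range.1 hkn
  refine ⟨ha, Nat.le_floor ?_⟩
  rw [armAt_of_tails F δ Tf Tg ω (hl.init_le.trans hk3) hc] at ha
  have := (h.pulls_challenger_le hK hδ hs hl hk3 hkw (hkn'.trans_le hn) hlead
    (hns k hkn' (hl.init_le.trans hk3))).2
  rwa [ha] at this

lemma explG_nonneg (hK : 2 ≤ K) (hδ : 0 < δ) (hδ1 : δ < 1) (hq : 1 ≤ q) :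
    0 ≤ explG K δ (q ^ 4) := by
  refine Real.log_nonneg ?_
  have h1 : (1 : ℝ) ≤ K := by exact_mod_cast (by omega : 1 ≤ K)
  have h2 : (1 : ℝ) ≤ ((q ^ 4 : ℕ) : ℝ) ^ 2 :=
    one_le_pow₀ (by exact_mod_cast Nat.one_le_pow _ _ hq)
  rw [le_div_iff₀ hδ]
  nlinarith

lemma floor_challenges_le (hK : 2 ≤ K) (hδ : 0 < δ) (hδ1 : δ < 1)
    (hs : Separates B D ε κ) (hl : LongEnough B D ε κ δ q) {i : Fin K} (hi : i ≠ B.best) :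
    ((⌊12 * F.V * Real.log ((q : ℝ) ^ 4 + 1) / ε ^ 2 + explG K δ (q ^ 4) / κ i⌋₊ : ℕ) : ℝ)
      ≤ 12 * F.V * Real.log ((q : ℝ) ^ 4 + 1) / ε ^ 2 + explG K δ (q ^ 4) / κ i := by
  refine Nat.floor_le (add_nonneg (div_nonneg (mul_nonneg ?_ (log_horizon_nonneg q)) (sq_nonneg _))
    (div_nonneg (explG_nonneg hK hδ hδ1 hl.one_le) (hs.κ_pos i hi).le))
  have := F.V_pos
  positivity

open Classical in
/-- As long as the algorithm has not stopped, a suboptimal arm has few pulls. -/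
lemma pulls_le_of_not_stopCond (h : IsGoodRun B δ Tf Tg q ω) (hK : 2 ≤ K) (hδ : 0 < δ) (hδ1 : δ < 1)
    (hs : Separates B D ε κ) (hl : LongEnough B D ε κ δ q) {i : Fin K} (hi : i ≠ B.best) {n : ℕ}
    (hn : n ≤ q ^ 4) (hns : ∀ k < n, K ≤ k → ¬ stopCond F δ Tf Tg (hist F δ Tf Tg ω k)) :
    (pulls F δ Tf Tg ω i n : ℝ) ≤ 2 * (q : ℝ) ^ 3
      + 2 * (6 * Real.log q + tailsProb δ * warmup δ q)
      + (12 * F.V * Real.log ((q : ℝ) ^ 4 + 1) / ε ^ 2 + explG K δ (q ^ 4) / κ i + 1) := by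
  have hsub : ((Finset.range n).filter fun k => armAt F δ Tf Tg ω k = i) ⊆
      Finset.range (q ^ 3) ∪ ((Finset.range (q ^ 4)).filter fun k => WrongLeader B δ Tf Tg q k ω) ∪
        (((Finset.range (warmup δ q)).filter fun k => ω.2 k = false) ∪
        ((Finset.range n).filter fun k => q ^ 3 ≤ k ∧ warmup δ q ≤ k ∧
          leader F δ Tf Tg ω k = B.best ∧ ω.2 k = false ∧ armAt F δ Tf Tg ω k = i)) := by
    intro k hk
    simp only [Finset.mem_filter, Finset.mem_range, Finset.mem_union] at hk ⊢
    by_cases h1 : k < q ^ 3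
    · exact Or.inl (Or.inl h1)
    · rw [not_lt] at h1
      by_cases h2 : leader F δ Tf Tg ω k = B.best
      · right
        cases hc : ω.2 k with
        | true =>
          rw [armAt_of_heads F δ Tf Tg ω (hl.init_le.trans h1) hc, h2] at hk
          exact absurd hk.2.symm hi
        | false =>
          by_cases h3 : k < warmup δ q
          · exact Or.inl ⟨h3, rfl⟩
          · exact Or.inr ⟨hk.1, h1, not_lt.1 h3, h2, rfl, hk.2⟩
      · exact Or.inl (Or.inr ⟨hk.1.trans_le hn, h1, h2⟩)
  have hcard := (Finset.card_le_card hsub).trans ((Finset.card_union_le _ _).trans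
    (add_le_add (Finset.card_union_le _ _) (Finset.card_union_le _ _)))
  rw [Finset.card_range, ← pulls_eq_card] at hcard
  have h1 := h.card_wrongLeader_le hs hl
  have h2 := h.card_challenges_le hK hδ hs hl i hn hns
  have h3 := h.tails_le
  have h4 := floor_challenges_le hK hδ hδ1 hs hl hi
  have h5 := hcard.trans (add_le_add (add_le_add_right h1 _) (add_le_add_right h2 _))
  have h6 : (pulls F δ Tf Tg ω i n : ℝ) ≤ ((q : ℝ) ^ 3 + (q : ℝ) ^ 3)
      + ((((Finset.range (warmup δ q)).filter fun k => ω.2 k = false).card : ℝ)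
      + ((⌊12 * F.V * Real.log ((q : ℝ) ^ 4 + 1) / ε ^ 2 + explG K δ (q ^ 4) / κ i⌋₊ : ℕ) + 1)) := by
    exact_mod_cast h5
  linarith

open Classical in
/-- A good run stops before the horizon, as there are more tails than pulls of challengers. -/
lemma exists_stopCond (h : IsGoodRun B δ Tf Tg q ω) (hK : 2 ≤ K) (hδ : 0 < δ) (hδ1 : δ < 1)
    (hs : Separates B D ε κ) (hl : LongEnough B D ε κ δ q) :
    ∃ k < q ^ 4, K ≤ k ∧ stopCond F δ Tf Tg (hist F δ Tf Tg ω k) := by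
  by_contra hcon
  push Not at hcon
  have hsub : ((Finset.range (q ^ 4)).filter fun k => ω.2 k = false) ⊆
      Finset.range (q ^ 3) ∪ ((Finset.range (q ^ 4)).filter fun k => WrongLeader B δ Tf Tg q k ω) ∪
        (((Finset.range (warmup δ q)).filter fun k => ω.2 k = false) ∪
        (Finset.univ.erase B.best).biUnion fun i =>
        ((Finset.range (q ^ 4)).filter fun k => q ^ 3 ≤ k ∧ warmup δ q ≤ k ∧
          leader F δ Tf Tg ω k = B.best ∧ ω.2 k = false ∧ armAt F δ Tf Tg ω k = i)) := by
    intro k hk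
    simp only [Finset.mem_filter, Finset.mem_range, Finset.mem_union, Finset.mem_biUnion,
      Finset.mem_erase, Finset.mem_univ, and_true] at hk ⊢
    by_cases h1 : k < q ^ 3
    · exact Or.inl (Or.inl h1)
    · rw [not_lt] at h1
      by_cases h2 : leader F δ Tf Tg ω k = B.best
      · right
        by_cases h3 : k < warmup δ q
        · exact Or.inl ⟨h3, hk.2⟩
        · refine Or.inr ⟨armAt F δ Tf Tg ω k, ?_, hk.1, h1, not_lt.1 h3, h2, hk.2, rfl⟩
          rw [armAt_of_tails F δ Tf Tg ω (hl.init_le.trans h1) hk.2]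
          exact (h.pulls_challenger_le hK hδ hs hl h1 (not_lt.1 h3) hk.1 h2
            (hcon k hk.1 (hl.init_le.trans h1))).1
      · exact Or.inl (Or.inr ⟨hk.1, h1, h2⟩)
  have hcard := (Finset.card_le_card hsub).trans ((Finset.card_union_le _ _).trans
    (add_le_add (Finset.card_union_le _ _) ((Finset.card_union_le _ _).trans
      (add_le_add_right Finset.card_biUnion_le _))))
  rw [Finset.card_range] at hcard
  have h1 := h.card_wrongLeader_le hs hl
  have h2 : ∀ i ∈ Finset.univ.erase B.best, ((((Finset.range (q ^ 4)).filter fun k =>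
      q ^ 3 ≤ k ∧ warmup δ q ≤ k ∧ leader F δ Tf Tg ω k = B.best ∧ ω.2 k = false ∧
        armAt F δ Tf Tg ω k = i).card : ℕ) : ℝ)
      ≤ 12 * F.V * Real.log ((q : ℝ) ^ 4 + 1) / ε ^ 2 + explG K δ (q ^ 4) / κ i + 1 := by
    intro i hi
    have h3 := h.card_challenges_le hK hδ hs hl i le_rfl hcon
    have h4 := floor_challenges_le hK hδ hδ1 hs hl (Finset.ne_of_mem_erase hi)
    have h5 : ((((Finset.range (q ^ 4)).filter fun k =>
      q ^ 3 ≤ k ∧ warmup δ q ≤ k ∧ leader F δ Tf Tg ω k = B.best ∧ ω.2 k = false ∧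
        armAt F δ Tf Tg ω k = i).card : ℕ) : ℝ) ≤ ((⌊12 * F.V * Real.log ((q : ℝ) ^ 4 + 1) / ε ^ 2
          + explG K δ (q ^ 4) / κ i⌋₊ : ℕ) : ℝ) + 1 := by exact_mod_cast h3
    linarith
  have h3 := Finset.sum_le_sum h2
  rw [← Nat.cast_sum] at h3
  have h4 := h.tails_le
  have h5 := h.le_tails
  have h6 := hl.stops
  have h7 := hcard.trans (add_le_add_left (add_le_add_right h1 _) _)
  have h8 : (((Finset.range (q ^ 4)).filter fun k => ω.2 k = false).card : ℝ)
      ≤ ((q : ℝ) ^ 3 + (q : ℝ) ^ 3)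
        + ((((Finset.range (warmup δ q)).filter fun k => ω.2 k = false).card : ℝ)
        + ((∑ i ∈ Finset.univ.erase B.best, ((Finset.range (q ^ 4)).filter fun k =>
      q ^ 3 ≤ k ∧ warmup δ q ≤ k ∧ leader F δ Tf Tg ω k = B.best ∧ ω.2 k = false ∧
        armAt F δ Tf Tg ω k = i).card : ℕ) : ℝ)) := by exact_mod_cast h7
  linarith

/-- The noise in the rewards contributes little to the regret up to the horizon. -/
lemma abs_noise_le (h : IsGoodRun B δ Tf Tg q ω) (hq : 1 ≤ q) (i : Fin K) {N : ℕ}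
    (hN : N ≤ q ^ 4) : |(N : ℝ) * B.μ i - ∑ j ∈ Finset.range N, ω.1 (i, j)|
      ≤ √(12 * F.V * Real.log ((q : ℝ) ^ 4 + 1) * (q : ℝ) ^ 4) := by
  rcases Nat.eq_zero_or_pos N with rfl | hpos
  · simp only [Nat.cast_zero, zero_mul, Finset.range_zero, Finset.sum_empty, sub_self, abs_zero]
    exact Real.sqrt_nonneg _
  have hV := F.V_pos
  have hℓ := log_horizon_nonneg q
  have hN' : (0 : ℝ) < N := by exact_mod_cast hpos
  have h1 := h.abs_rewardAvg_sub_le hq i hpos hN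
  have h2 : (N : ℝ) * B.μ i - ∑ j ∈ Finset.range N, ω.1 (i, j)
      = -(N * (rewardAvg ω i N - B.μ i)) := by
    unfold rewardAvg
    field_simp
    ring
  rw [h2, abs_neg, abs_mul, abs_of_pos hN']
  refine (mul_le_mul_of_nonneg_left h1 hN'.le).trans ?_
  refine Real.le_sqrt_of_sq_le ?_
  rw [mul_pow, Real.sq_sqrt (by positivity)]
  have h3 : (N : ℝ) ≤ (q : ℝ) ^ 4 := by exact_mod_cast hN
  have h4 : (N : ℝ) ^ 2 * (12 * F.V * Real.log ((q : ℝ) ^ 4 + 1) / N)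
      = 12 * F.V * Real.log ((q : ℝ) ^ 4 + 1) * N := by field_simp
  rw [h4]
  gcongr

/-- A good run stops before the horizon, with a regret that comes from the pulls of the suboptimal
arms as challengers, up to terms of lower order. -/
lemma stopTime_and_regret_le (h : IsGoodRun B δ Tf Tg q ω) (hK : 2 ≤ K) (hδ : 0 < δ) (hδ1 : δ < 1)
    (hs : Separates B D ε κ) (hl : LongEnough B D ε κ δ q) :
    stopTime F δ Tf Tg ω ≤ ((q ^ 4 : ℕ) : ℕ∞) ∧
    regret B δ Tf Tg ω ≤ ∑ i ∈ Finset.univ.erase B.best, (2 * (q : ℝ) ^ 3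
      + 2 * (6 * Real.log q + tailsProb δ * warmup δ q)
      + (12 * F.V * Real.log ((q : ℝ) ^ 4 + 1) / ε ^ 2 + explG K δ (q ^ 4) / κ i + 2)) * B.gap i
      + K * √(12 * F.V * Real.log ((q : ℝ) ^ 4 + 1) * (q : ℝ) ^ 4) ∧
    |regret B δ Tf Tg ω| ≤ (q : ℝ) ^ 4 * ∑ i, B.gap i
      + K * √(12 * F.V * Real.log ((q : ℝ) ^ 4 + 1) * (q : ℝ) ^ 4) := by
  obtain ⟨k, hkT, hKk, hk⟩ := h.exists_stopCond hK hδ hδ1 hs hl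
  rcases stopTime_cases F δ Tf Tg ω with ⟨-, hno⟩ | ⟨n, hKn, hn, heq, hmin⟩
  · exact absurd hk (hno k hKk)
  have hnk : n ≤ k := by
    by_contra hcon
    exact hmin k (not_le.1 hcon) hKk hk
  have hnT : n + 1 ≤ q ^ 4 := by omega
  have hreg : regret B δ Tf Tg ω = ∑ i, (pulls F δ Tf Tg ω i (n + 1) : ℝ) * B.gap i
      + ∑ i, ((pulls F δ Tf Tg ω i (n + 1) : ℝ) * B.μ i
        - ∑ j ∈ Finset.range (pulls F δ Tf Tg ω i (n + 1)), ω.1 (i, j)) := by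
    have h0 : (stopTime F δ Tf Tg ω).toNat = n + 1 := by rw [heq, ENat.toNat_natCast]
    simp only [regret]
    rw [h0, sum_regret_eq, Finset.sum_add_distrib]
  set Z := √(12 * F.V * Real.log ((q : ℝ) ^ 4 + 1) * (q : ℝ) ^ 4)
  have hnoise : |∑ i, ((pulls F δ Tf Tg ω i (n + 1) : ℝ) * B.μ i
        - ∑ j ∈ Finset.range (pulls F δ Tf Tg ω i (n + 1)), ω.1 (i, j))| ≤ K * Z := by
    refine (Finset.abs_sum_le_sum_abs _ _).trans ((Finset.sum_le_card_nsmul _ _ Z fun i _ =>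
      h.abs_noise_le hl.one_le i ((pulls_le F δ Tf Tg ω i _).trans hnT)).trans_eq ?_)
    simp
  have hnoise' := abs_le.1 hnoise
  have hbest : B.gap B.best = 0 := by simp [Bandit.gap]
  refine ⟨?_, ?_, ?_⟩
  · rw [heq]
    exact_mod_cast hnT
  · rw [hreg]
    refine add_le_add ?_ hnoise'.2
    rw [← Finset.add_sum_erase _ _ (Finset.mem_univ B.best), hbest, mul_zero, zero_add]
    refine Finset.sum_le_sum fun i hi => mul_le_mul_of_nonneg_right ?_ (B.gap_nonneg i)
    have h1 := h.pulls_le_of_not_stopCond hK hδ hδ1 hs hl (Finset.ne_of_mem_erase hi) (n := n)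
      (by omega) hmin
    have h2 : (pulls F δ Tf Tg ω i (n + 1) : ℝ) ≤ pulls F δ Tf Tg ω i n + 1 := by
      have : pulls F δ Tf Tg ω i (n + 1) ≤ pulls F δ Tf Tg ω i n + 1 := by
        rw [pulls_succ]; split_ifs <;> omega
      exact_mod_cast this
    linarith
  · rw [hreg]
    refine (abs_add_le _ _).trans (add_le_add ?_ hnoise)
    rw [abs_of_nonneg (Finset.sum_nonneg fun i _ => mul_nonneg (Nat.cast_nonneg _) (B.gap_nonneg i)),
      Finset.mul_sum]
    refine Finset.sum_le_sum fun i _ => mul_le_mul_of_nonneg_right ?_ (B.gap_nonneg i)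
    exact_mod_cast (pulls_le F δ Tf Tg ω i _).trans hnT

end IsGoodRun

/-! ### Long horizons -/

lemma eventually_add_mul_log_le_sq (a b : ℝ) :
    ∀ᶠ q : ℕ in atTop, a + b * Real.log q ≤ (q : ℝ) ^ 2 := by
  filter_upwards [eventually_ge_atTop (⌈|a| + |b|⌉₊ + 1)] with q hq
  have h1 : |a| + |b| + 1 ≤ q :=
    (add_le_add_left (Nat.le_ceil _) 1).trans (by exact_mod_cast hq)
  have ha := abs_nonneg a
  have hb := abs_nonneg b
  have h2 : (1 : ℝ) ≤ q := by linarith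
  have h3 : 0 ≤ Real.log q := Real.log_nonneg h2
  have h4 : Real.log q ≤ q := (Real.log_le_sub_one_of_pos (by linarith)).trans (by linarith)
  have h5 : b * Real.log q ≤ |b| * q :=
    (mul_le_mul_of_nonneg_right (le_abs_self b) h3).trans (mul_le_mul_of_nonneg_left h4 hb)
  nlinarith [le_abs_self a]

lemma log_horizon_le {q : ℕ} (hq : 1 ≤ q) :
    Real.log ((q : ℝ) ^ 4 + 1) ≤ 1 + 4 * Real.log q := by
  have h1 : (1 : ℝ) ≤ q := by exact_mod_cast hq
  have h2 : (1 : ℝ) ≤ (q : ℝ) ^ 4 := one_le_pow₀ h1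
  have h3 : Real.log ((q : ℝ) ^ 4 + 1) ≤ Real.log (2 * (q : ℝ) ^ 4) :=
    Real.log_le_log (by positivity) (by linarith)
  rw [Real.log_mul (by norm_num) (by positivity), Real.log_pow] at h3
  have := Real.log_two_lt_d9
  push_cast at h3
  linarith

lemma explG_horizon {K q : ℕ} {δ : ℝ} (hK : 1 ≤ K) (hδ : 0 < δ) (hq : 1 ≤ q) :
    explG K δ (q ^ 4) = Real.log (1 / δ) + (Real.log (2 * K) + 8 * Real.log q) := by
  have h1 : (0 : ℝ) < q := by exact_mod_cast hq
  have h2 : (0 : ℝ) < K := by exact_mod_cast hK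
  unfold explG
  rw [Real.log_div (by positivity) hδ.ne', Real.log_mul (by positivity) (by positivity),
    one_div, Real.log_inv]
  push_cast
  rw [← pow_mul, Real.log_pow]
  push_cast
  ring

/-- The horizon `q ^ 4` is long enough as soon as `q`, `tailsProb δ * q` and
`tailsProb δ * q ^ 4 / log (1 / δ)` are large. -/
lemma exists_longEnough {F : ExpFamily} {K : ℕ} (B : Bandit F K) {D ε : ℝ} {κ : Fin K → ℝ}
    (hs : Separates B D ε κ) :
    ∃ C > 0, ∃ q₁ : ℕ, ∀ δ, 0 < δ → δ < 1 → ∀ q ≥ q₁, C ≤ tailsProb δ * q →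
      C * Real.log (1 / δ) ≤ tailsProb δ * (q : ℝ) ^ 4 →
      LongEnough B D ε κ δ q ∧ Real.log q ≤ (q : ℝ) ^ 2 ∧
      Real.log ((q : ℝ) ^ 4 + 1) ≤ (q : ℝ) ^ 2 ∧
      explG K δ (q ^ 4) ≤ Real.log (1 / δ) + (q : ℝ) ^ 2 := by
  have hK : 1 ≤ K := by have := B.best.2; omega
  have hV := F.V_pos
  have hε := hs.ε_pos
  have hD := hs.D_pos
  set S : ℝ := 20 + K * (12 * F.V / ε ^ 2 + 1) + 2 * ∑ i ∈ Finset.univ.erase B.best, 1 / κ i with hS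
  have hS0 : 0 ≤ ∑ i ∈ Finset.univ.erase B.best, 1 / κ i :=
    Finset.sum_nonneg fun i hi => (one_div_pos.2 (hs.κ_pos i (Finset.ne_of_mem_erase hi))).le
  have hSpos : 0 < S := by positivity
  -- every error term is at most a multiple of `q ^ 3` or of `log (1 / δ)`, hence small compared with
  -- `Γ = tailsProb δ * q ^ 4 ≥ C * max (q ^ 3) (log (1 / δ))` if `C` is large
  set C : ℝ := 1152 + 8192 * F.V / ε ^ 2 + 4 * S with hC
  have hVε : 0 < F.V / ε ^ 2 := by positivity
  have hC1 : 1152 ≤ C := by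
    have : 0 < 8192 * F.V / ε ^ 2 := by positivity
    linarith
  have hC2 : 8192 * F.V ≤ C * ε ^ 2 := by
    rw [← div_le_iff₀ (by positivity)]
    linarith
  have hC3 : 4 * S ≤ C := by
    have : 0 < 8192 * F.V / ε ^ 2 := by positivity
    linarith
  have hC0 : 0 < C := by linarith
  have hev : ∀ᶠ q : ℕ in atTop, 1 ≤ q ∧ K ≤ q ∧ 0 + 1 * Real.log q ≤ (q : ℝ) ^ 2 ∧
      1 + 4 * Real.log q ≤ (q : ℝ) ^ 2 ∧ Real.log (2 * K) + 8 * Real.log q ≤ (q : ℝ) ^ 2 ∧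
      4 * (K * (48 * F.V / D ^ 2 + 1)) + (24 + 4 * (K * (48 * F.V / D ^ 2 * 4))) * Real.log q
        ≤ (q : ℝ) ^ 2 :=
    (eventually_ge_atTop 1).and ((eventually_ge_atTop K).and
      ((eventually_add_mul_log_le_sq _ _).and ((eventually_add_mul_log_le_sq _ _).and
      ((eventually_add_mul_log_le_sq _ _).and (eventually_add_mul_log_le_sq _ _)))))
  obtain ⟨q₁, hq₁⟩ := eventually_atTop.1 hev
  refine ⟨C, hC0, q₁, fun δ hδ hδ1 q hq hγq hγL => ?_⟩
  obtain ⟨hq1, hKq, hlog, hℓ, hG, hwr⟩ := hq₁ q hq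
  rw [zero_add, one_mul] at hlog
  have hγ := tailsProb_pos δ
  have hγ' := tailsProb_le_half δ
  have hℓ2 := log_horizon_le hq1
  have hℓ1 := IsGoodRun.log_horizon_nonneg q
  set ℓ := Real.log ((q : ℝ) ^ 4 + 1) with hℓdef
  have hGeq := explG_horizon hK hδ hq1
  set G := explG K δ (q ^ 4) with hGdef
  set L := Real.log (1 / δ) with hL
  have hL0 : 0 < L := Real.log_pos (by rw [lt_div_iff₀ hδ]; linarith)
  have hqr : (1 : ℝ) ≤ q := by exact_mod_cast hq1
  set x : ℝ := (q : ℝ) ^ 3 with hx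
  have hx1 : 1 ≤ x := one_le_pow₀ hqr
  have hqx : (q : ℝ) ^ 2 ≤ x := pow_le_pow_right₀ hqr (by norm_num)
  set Γ : ℝ := tailsProb δ * (q : ℝ) ^ 4 with hΓ
  have hΓx : C * x ≤ Γ := by
    have h1 : Γ = tailsProb δ * q * x := by rw [hΓ, hx]; ring
    rw [h1]
    gcongr
  have hΓpos : 0 < Γ := by positivity
  have hΓx' : 1152 * x ≤ Γ := (mul_le_mul_of_nonneg_right hC1 (by linarith)).trans hΓx
  have h1 : 8192 * F.V * x ≤ ε ^ 2 * Γ :=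
    calc 8192 * F.V * x ≤ C * ε ^ 2 * x := mul_le_mul_of_nonneg_right hC2 (by linarith)
      _ = ε ^ 2 * (C * x) := by ring
      _ ≤ ε ^ 2 * Γ := mul_le_mul_of_nonneg_left hΓx (sq_nonneg ε)
  have h1' : 8192 * F.V * L ≤ ε ^ 2 * Γ :=
    calc 8192 * F.V * L ≤ C * ε ^ 2 * L := mul_le_mul_of_nonneg_right hC2 hL0.le
      _ = ε ^ 2 * (C * L) := by ring
      _ ≤ ε ^ 2 * Γ := mul_le_mul_of_nonneg_left hγL (sq_nonneg ε)
  have hw1 : Γ / 16 - 1 < warmup δ q := Nat.sub_one_lt_floor _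
  have hw2 : (warmup δ q : ℝ) ≤ Γ / 16 := Nat.floor_le (by positivity)
  refine ⟨⟨hq1, ?_, ?_, ?_, ?_⟩, hlog, by linarith, by linarith⟩
  · exact hKq.trans (Nat.le_self_pow (by norm_num) q)
  · refine le_trans ?_ (hwr.trans hqx)
    have h1 : 48 * F.V * ℓ / D ^ 2 ≤ 48 * F.V * (1 + 4 * Real.log q) / D ^ 2 := by gcongr
    have h2 : 4 * (6 * Real.log q + K * (48 * F.V * ℓ / D ^ 2 + 1))
        ≤ 4 * (6 * Real.log q + K * (48 * F.V * (1 + 4 * Real.log q) / D ^ 2 + 1)) := by gcongr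
    refine h2.trans (le_of_eq ?_)
    ring
  · intro n hn
    have hn1 : Γ / 128 ≤ n := by linarith
    have hn0 : (0 : ℝ) < n := lt_of_lt_of_le (by positivity) hn1
    have e1 : √(12 * F.V * ℓ / n) < ε / 2 := by
      rw [Real.sqrt_lt' (by positivity), div_lt_iff₀ hn0]
      have h2 : F.V * ℓ ≤ F.V * x := by gcongr; linarith
      have h3 : ε ^ 2 * (Γ / 128) ≤ ε ^ 2 * n := by gcongr
      have h4 : 0 < F.V * x := by positivity
      have h5 : (ε / 2) ^ 2 * n = ε ^ 2 * n / 4 := by ring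
      rw [h5]
      linarith
    have e2 : √(4 * F.V * (G / n)) < ε / 2 := by
      rw [Real.sqrt_lt' (by positivity), ← mul_div_assoc, div_lt_iff₀ hn0]
      have h2 : F.V * G ≤ F.V * L + F.V * x := by
        rw [← mul_add]; gcongr; linarith
      have h3 : ε ^ 2 * (Γ / 128) ≤ ε ^ 2 * n := by gcongr
      have h4 : 0 < F.V * x := by positivity
      have h5 : (ε / 2) ^ 2 * n = ε ^ 2 * n / 4 := by ring
      have h6 : 0 < ε ^ 2 * Γ := by positivity
      rw [h5]
      linarith
    linarith
  · have hsum : ∑ i ∈ Finset.univ.erase B.best, (12 * F.V * ℓ / ε ^ 2 + G / κ i + 1)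
        ≤ K * (12 * F.V / ε ^ 2 + 1) * x
          + (L + x) * ∑ i ∈ Finset.univ.erase B.best, 1 / κ i := by
      rw [Finset.mul_sum]
      have h1 : ∀ i ∈ Finset.univ.erase B.best, 12 * F.V * ℓ / ε ^ 2 + G / κ i + 1
          ≤ (12 * F.V / ε ^ 2 + 1) * x + (L + x) * (1 / κ i) := by
        intro i hi
        have hκ := hs.κ_pos i (Finset.ne_of_mem_erase hi)
        have h2 : 12 * F.V * ℓ / ε ^ 2 ≤ 12 * F.V / ε ^ 2 * x := by
          rw [mul_div_right_comm]
          gcongr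
          linarith
        have h3 : G / κ i ≤ (L + x) * (1 / κ i) := by
          rw [← div_eq_mul_one_div]
          gcongr
          linarith
        linarith
      refine (Finset.sum_le_sum h1).trans ?_
      rw [Finset.sum_add_distrib, Finset.sum_const, nsmul_eq_mul]
      have h2 : ((Finset.univ.erase B.best).card : ℝ) ≤ K := by
        have := Finset.card_le_univ (Finset.univ.erase B.best)
        rw [Fintype.card_fin] at this
        exact_mod_cast this
      rw [← mul_assoc]
      gcongr
    set W := ∑ i ∈ Finset.univ.erase B.best, 1 / κ i
    have hxL : (20 + K * (12 * F.V / ε ^ 2 + 1)) * x + (L + x) * W ≤ Γ / 4 := by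
      have h1 : C * ((20 + K * (12 * F.V / ε ^ 2 + 1)) * x + (L + x) * W) ≤ S * Γ := by
        have h2 : 0 ≤ 20 + K * (12 * F.V / ε ^ 2 + 1) := by positivity
        calc C * ((20 + K * (12 * F.V / ε ^ 2 + 1)) * x + (L + x) * W)
            = (20 + K * (12 * F.V / ε ^ 2 + 1)) * (C * x) + W * (C * L) + W * (C * x) := by ring
          _ ≤ (20 + K * (12 * F.V / ε ^ 2 + 1)) * Γ + W * Γ + W * Γ := by gcongr
          _ = S * Γ := by rw [hS]; ring
      have h2 : S * Γ ≤ C * (Γ / 4) :=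
        calc S * Γ = 4 * S * (Γ / 4) := by ring
          _ ≤ C * (Γ / 4) := mul_le_mul_of_nonneg_right hC3 (by linarith)
      exact le_of_mul_le_mul_left (h1.trans h2) hC0
    have h3 : tailsProb δ * warmup δ q ≤ 1 / 2 * (Γ / 16) := by gcongr
    have h4 : Real.log q ≤ x := hlog.trans hqx
    linarith

/-! ### Expectations -/

/-- If `f` is at most `C * q ^ 4` off an event `bad q` of probability `O(q⁻⁶)`, for all large `q`,
then `f` is at most its bound off `bad q₀` in the mean, up to an error of order `1 / q₀`: on the
event that `q + 1` is the first index which is not bad, `f ≤ C * (q + 1) ^ 4`. -/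
lemma lintegral_le_of_bad {Ω : Type*} [MeasurableSpace Ω] (P : Measure Ω) [IsProbabilityMeasure P]
    (bad : ℕ → Set Ω) {c : ℝ} (hc : 0 ≤ c)
    (hbad : ∀ q : ℕ, 1 ≤ q → P (bad q) ≤ ENNReal.ofReal (c / (q : ℝ) ^ 6))
    {q₀ : ℕ} (hq₀ : 1 ≤ q₀) (f : Ω → ℝ≥0∞) {A C : ℝ} (hC0 : 0 ≤ C)
    (hA : ∀ ω ∉ bad q₀, f ω ≤ ENNReal.ofReal A)
    (hC : ∀ q ≥ q₀, ∀ ω ∉ bad q, f ω ≤ ENNReal.ofReal (C * (q : ℝ) ^ 4)) :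
    ∫⁻ ω, f ω ∂P ≤ ENNReal.ofReal A + ENNReal.ofReal (32 * C * c / q₀) := by
  classical
  set h : ℕ → Ω → ℝ≥0∞ := fun j => (toMeasurable P (bad (q₀ + j))).indicator
    fun _ => ENNReal.ofReal (C * ((q₀ + j : ℝ) + 1) ^ 4) with hh
  have hae : ∀ᵐ ω ∂P, ∃ q, q₀ ≤ q ∧ ω ∉ bad q := by
    rw [ae_iff]
    have hle : ∀ q : ℕ, q₀ ≤ q → P {ω | ¬ ∃ q, q₀ ≤ q ∧ ω ∉ bad q}
        ≤ ENNReal.ofReal (c / (q : ℝ) ^ 6) := by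
      intro q hq
      refine (measure_mono fun ω hω => ?_).trans (hbad q (hq₀.trans hq))
      rw [Set.mem_ofPred_eq] at hω
      push Not at hω
      exact hω q hq
    have hlim : Tendsto (fun q : ℕ => ENNReal.ofReal (c / (q : ℝ) ^ 6)) atTop (𝓝 0) := by
      rw [← ENNReal.ofReal_zero]
      refine ENNReal.tendsto_ofReal (tendsto_const_nhds.div_atTop ?_)
      exact (tendsto_pow_atTop (by norm_num)).comp tendsto_natCast_atTop_atTop
    exact le_antisymm (ge_of_tendsto hlim (eventually_atTop.2 ⟨q₀, hle⟩)) bot_le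
  have hf : ∀ᵐ ω ∂P, f ω ≤ ENNReal.ofReal A + ∑' j, h j ω := by
    filter_upwards [hae] with ω hω
    obtain ⟨hQ, hQbad⟩ := Nat.find_spec hω
    have hmin := fun m => Nat.find_min (m := m) hω
    set Q := Nat.find hω
    rcases hQ.eq_or_lt with heq | hlt
    · exact (hA ω (heq ▸ hQbad)).trans le_self_add
    · obtain ⟨j, hj⟩ : ∃ j, Q = q₀ + j + 1 := ⟨Q - q₀ - 1, by omega⟩
      have hmem : ω ∈ bad (q₀ + j) := by
        by_contra hcon
        exact hmin (q₀ + j) (by omega) ⟨by omega, hcon⟩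
      refine (le_trans ?_ (ENNReal.le_tsum j)).trans le_add_self
      simp only [hh]
      rw [Set.indicator_of_mem (subset_toMeasurable _ _ hmem)]
      refine (hC Q hQ ω hQbad).trans (le_of_eq ?_)
      rw [hj]
      push_cast
      rfl
  refine (lintegral_mono_ae hf).trans ?_
  have hmeas : ∀ j, Measurable (h j) := fun j =>
    measurable_const.indicator (measurableSet_toMeasurable _ _)
  rw [lintegral_add_left measurable_const, lintegral_const, measure_univ, mul_one,
    lintegral_tsum fun j => (hmeas j).aemeasurable]
  refine add_le_add le_rfl (ENNReal.tsum_le_of_sum_range_le fun N => ?_)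
  have hq0 : (1 : ℝ) ≤ q₀ := by exact_mod_cast hq₀
  have hterm : ∀ j : ℕ, ∫⁻ ω, h j ω ∂P ≤ ENNReal.ofReal
      (32 * C * c * (1 / ((q₀ + j : ℕ) : ℝ) - 1 / ((q₀ + (j + 1) : ℕ) : ℝ))) := by
    intro j
    simp only [hh]
    rw [lintegral_indicator (measurableSet_toMeasurable _ _), setLIntegral_const,
      measure_toMeasurable]
    refine (mul_le_mul' le_rfl (hbad (q₀ + j) (by omega))).trans ?_
    rw [← ENNReal.ofReal_mul (by positivity)]
    refine ENNReal.ofReal_le_ofReal ?_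
    have hy : (1 : ℝ) ≤ (q₀ : ℝ) + j := le_add_of_le_of_nonneg hq0 (Nat.cast_nonneg _)
    push_cast
    rw [← add_assoc]
    set y : ℝ := (q₀ : ℝ) + j
    have h1 : (y + 1) ^ 4 ≤ 16 * y ^ 4 := by
      have : (y + 1) ^ 4 ≤ (2 * y) ^ 4 := by gcongr; linarith
      linarith [mul_pow 2 y 4]
    have h2 : y ^ 4 / y ^ 6 ≤ 2 * (1 / y - 1 / (y + 1)) := by
      have e1 : y ^ 4 / y ^ 6 = 1 / y ^ 2 := by field_simp
      have e2 : 2 * (1 / y - 1 / (y + 1)) = 2 / (y * (y + 1)) := by field_simp; ring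
      rw [e1, e2, div_le_div_iff₀ (by positivity) (by positivity)]
      nlinarith
    calc C * (y + 1) ^ 4 * (c / y ^ 6) ≤ C * (16 * y ^ 4) * (c / y ^ 6) := by gcongr
      _ = 16 * C * c * (y ^ 4 / y ^ 6) := by ring
      _ ≤ 16 * C * c * (2 * (1 / y - 1 / (y + 1))) := by gcongr
      _ = _ := by ring
  refine (Finset.sum_le_sum fun j _ => hterm j).trans ?_
  rw [← ENNReal.ofReal_sum_of_nonneg]
  · refine ENNReal.ofReal_le_ofReal ?_
    rw [← Finset.mul_sum, Finset.sum_range_sub' (fun j : ℕ => (1 : ℝ) / ((q₀ + j : ℕ) : ℝ)) N,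
      mul_div_assoc, add_zero]
    refine le_trans (mul_le_mul_of_nonneg_left (sub_le_self _ (by positivity)) (by positivity))
      (le_of_eq ?_)
    ring
  · intro j _
    refine mul_nonneg (by positivity) (sub_nonneg.2 ?_)
    refine one_div_le_one_div_of_le (by exact_mod_cast (by omega : 0 < q₀ + j)) ?_
    exact_mod_cast (by omega : q₀ + j ≤ q₀ + (j + 1))

section Expectation

variable {F : ExpFamily} {K : ℕ}

/-- Bounds for the expected stopping time and the expected regret in terms of a long enough
horizon. -/
lemma exists_expectation_bounds (B : Bandit F K) (hK : 2 ≤ K) (Tf Tg : TieRule K) {D ε : ℝ}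
    {κ : Fin K → ℝ} (hs : Separates B D ε κ) :
    ∃ C > 0, ∃ c ≥ 0, ∃ q₁ : ℕ, ∀ δ, 0 < δ → δ < 1 → ∀ q ≥ q₁, C ≤ tailsProb δ * q →
      C * Real.log (1 / δ) ≤ tailsProb δ * (q : ℝ) ^ 4 →
      ∫⁻ ω, (stopTime F δ Tf Tg ω : ℝ≥0∞) ∂(B.prob δ) ≤ ENNReal.ofReal ((q : ℝ) ^ 4 + c) ∧
      Integrable (regret B δ Tf Tg) (B.prob δ) ∧
      ∫ ω, regret B δ Tf Tg ω ∂(B.prob δ) ≤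
        (∑ i ∈ Finset.univ.erase B.best, B.gap i / κ i) * Real.log (1 / δ)
          + c * ((q : ℝ) ^ 3 + tailsProb δ ^ 2 * (q : ℝ) ^ 4) + c := by
  obtain ⟨C, hC, q₁, hlong⟩ := exists_longEnough B hs
  have hV := F.V_pos
  have hε := hs.ε_pos
  set c₁ : ℝ := ∑ i ∈ Finset.univ.erase B.best, B.gap i * (16 + 12 * F.V / ε ^ 2 + 1 / κ i)
    + K * √(12 * F.V) with hc₁
  set c₂ : ℝ := ∑ i, B.gap i + K * √(12 * F.V) with hc₂
  set c₃ : ℝ := 4 * K + 4 with hc₃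
  have hc₁0 : 0 ≤ c₁ := by
    refine add_nonneg (Finset.sum_nonneg fun i hi => mul_nonneg (B.gap_nonneg i) ?_) (by positivity)
    have := hs.κ_pos i (Finset.ne_of_mem_erase hi)
    positivity
  have hc₂0 : 0 ≤ c₂ :=
    add_nonneg (Finset.sum_nonneg fun i _ => B.gap_nonneg i) (by positivity)
  have hc₃0 : 0 ≤ c₃ := by positivity
  refine ⟨C, hC, c₁ + 32 * c₃ + 32 * c₂ * c₃, by positivity, max q₁ 1,
    fun δ hδ hδ1 q hq hγq hγL => ?_⟩
  have hq1 : 1 ≤ q := (le_max_right _ _).trans hq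
  have hγ := tailsProb_pos δ
  have hlong' : ∀ p ≥ q, LongEnough B D ε κ δ p ∧ Real.log p ≤ (p : ℝ) ^ 2 ∧
      Real.log ((p : ℝ) ^ 4 + 1) ≤ (p : ℝ) ^ 2 ∧
      explG K δ (p ^ 4) ≤ Real.log (1 / δ) + (p : ℝ) ^ 2 := by
    intro p hp
    have hp' : (q : ℝ) ≤ p := by exact_mod_cast hp
    refine hlong δ hδ hδ1 p (((le_max_left _ _).trans hq).trans hp) (hγq.trans ?_) (hγL.trans ?_)
    all_goals gcongr
  have hnoise : ∀ p ≥ q, √(12 * F.V * Real.log ((p : ℝ) ^ 4 + 1) * (p : ℝ) ^ 4)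
      ≤ √(12 * F.V) * (p : ℝ) ^ 3 := by
    intro p hp
    have h1 : (p : ℝ) ^ 3 = √(((p : ℝ) ^ 3) ^ 2) := (Real.sqrt_sq (by positivity)).symm
    rw [h1, ← Real.sqrt_mul (by positivity)]
    refine Real.sqrt_le_sqrt ?_
    calc 12 * F.V * Real.log ((p : ℝ) ^ 4 + 1) * (p : ℝ) ^ 4
        ≤ 12 * F.V * (p : ℝ) ^ 2 * (p : ℝ) ^ 4 := by
          have := (hlong' p hp).2.2.1
          gcongr
      _ = 12 * F.V * ((p : ℝ) ^ 3) ^ 2 := by ring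
  have hgood : ∀ p ≥ q, ∀ ω ∉ {ω | ¬ IsGoodRun B δ Tf Tg p ω},
      stopTime F δ Tf Tg ω ≤ ((p ^ 4 : ℕ) : ℕ∞) ∧
      regret B δ Tf Tg ω ≤ ∑ i ∈ Finset.univ.erase B.best, (2 * (p : ℝ) ^ 3
        + 2 * (6 * Real.log p + tailsProb δ * warmup δ p)
        + (12 * F.V * Real.log ((p : ℝ) ^ 4 + 1) / ε ^ 2 + explG K δ (p ^ 4) / κ i + 2)) * B.gap i
        + K * √(12 * F.V * Real.log ((p : ℝ) ^ 4 + 1) * (p : ℝ) ^ 4) ∧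
      |regret B δ Tf Tg ω| ≤ (p : ℝ) ^ 4 * ∑ i, B.gap i
        + K * √(12 * F.V * Real.log ((p : ℝ) ^ 4 + 1) * (p : ℝ) ^ 4) := by
    intro p hp ω hω
    have hω' : IsGoodRun B δ Tf Tg p ω := by
      rw [Set.mem_ofPred_eq, not_not] at hω
      exact hω
    exact hω'.stopTime_and_regret_le hK hδ hδ1 hs (hlong' p hp).1
  have hbad : ∀ p : ℕ, 1 ≤ p → B.prob δ {ω | ¬ IsGoodRun B δ Tf Tg p ω}
      ≤ ENNReal.ofReal (c₃ / (p : ℝ) ^ 6) := fun p hp =>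
    measure_not_isGoodRun_le B hK δ Tf Tg hp
  have hq' : (1 : ℝ) ≤ q := by exact_mod_cast hq1
  have habs : ∀ p ≥ q, ∀ ω ∉ {ω | ¬ IsGoodRun B δ Tf Tg p ω},
      ENNReal.ofReal |regret B δ Tf Tg ω| ≤ ENNReal.ofReal (c₂ * (p : ℝ) ^ 4) := by
    intro p hp ω hω
    refine ENNReal.ofReal_le_ofReal ((hgood p hp ω hω).2.2.trans ?_)
    have h1 := hnoise p hp
    have hp' : (1 : ℝ) ≤ p := hq'.trans (by exact_mod_cast hp)
    have h2 : (p : ℝ) ^ 3 ≤ (p : ℝ) ^ 4 := pow_le_pow_right₀ hp' (by norm_num)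
    calc _ ≤ (p : ℝ) ^ 4 * ∑ i, B.gap i + K * (√(12 * F.V) * (p : ℝ) ^ 4) := by
          gcongr
          exact h1.trans (by gcongr)
      _ = c₂ * (p : ℝ) ^ 4 := by rw [hc₂]; ring
  have hdiv : ∀ a : ℝ, 0 ≤ a → a / q ≤ a := fun a ha => div_le_self ha hq'
  have hInt : Integrable (regret B δ Tf Tg) (B.prob δ) := by
    refine ⟨(measurable_regret B (B.nontrivial_I hK)).aestronglyMeasurable, ?_⟩
    have h := lintegral_le_of_bad (B.prob δ) _ hc₃0 hbad hq1
      (fun ω => ENNReal.ofReal |regret B δ Tf Tg ω|) hc₂0 (habs q le_rfl) habs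
    refine lt_of_le_of_lt (le_trans (le_of_eq ?_) h)
      (ENNReal.add_lt_top.2 ⟨ENNReal.ofReal_lt_top, ENNReal.ofReal_lt_top⟩)
    refine lintegral_congr fun ω => ?_
    rw [← Real.norm_eq_abs, ofReal_norm]
  refine ⟨?_, hInt, ?_⟩
  · have hτ : ∀ p ≥ q, ∀ ω ∉ {ω | ¬ IsGoodRun B δ Tf Tg p ω},
        (stopTime F δ Tf Tg ω : ℝ≥0∞) ≤ ENNReal.ofReal (1 * (p : ℝ) ^ 4) := by
      intro p hp ω hω
      have h1 : (stopTime F δ Tf Tg ω : ℝ≥0∞) ≤ (((p ^ 4 : ℕ) : ℕ∞) : ℝ≥0∞) :=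
        ENat.toENNReal_le.2 (hgood p hp ω hω).1
      refine h1.trans (le_of_eq ?_)
      rw [one_mul, ENat.toENNReal_coe, ← ENNReal.ofReal_natCast]
      push_cast
      rfl
    refine (lintegral_le_of_bad (B.prob δ) _ hc₃0 hbad hq1 _ zero_le_one
      (fun ω hω => hτ q le_rfl ω hω) hτ).trans ?_
    rw [← ENNReal.ofReal_add (by positivity) (by positivity)]
    refine ENNReal.ofReal_le_ofReal ?_
    have := hdiv (32 * 1 * c₃) (by positivity)
    have h2 : 0 ≤ 32 * c₂ * c₃ := by positivity
    linarith
  · set A : ℝ := (∑ i ∈ Finset.univ.erase B.best, B.gap i / κ i) * Real.log (1 / δ)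
      + c₁ * ((q : ℝ) ^ 3 + tailsProb δ ^ 2 * (q : ℝ) ^ 4) with hA
    have hL0 : 0 < Real.log (1 / δ) := Real.log_pos (by rw [lt_div_iff₀ hδ]; linarith)
    have hA0 : 0 ≤ A := by
      refine add_nonneg (mul_nonneg (Finset.sum_nonneg fun i hi => div_nonneg (B.gap_nonneg i)
        (hs.κ_pos i (Finset.ne_of_mem_erase hi)).le) hL0.le) (by positivity)
    have hup : ∀ ω ∉ {ω | ¬ IsGoodRun B δ Tf Tg q ω},
        ENNReal.ofReal (regret B δ Tf Tg ω) ≤ ENNReal.ofReal A := by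
      intro ω hω
      refine ENNReal.ofReal_le_ofReal ((hgood q le_rfl ω hω).2.1.trans ?_)
      obtain ⟨-, h1, h2, h3⟩ := hlong' q le_rfl
      have h4 := hnoise q le_rfl
      have hx : (q : ℝ) ^ 2 ≤ (q : ℝ) ^ 3 := pow_le_pow_right₀ hq' (by norm_num)
      have hx1 : (1 : ℝ) ≤ (q : ℝ) ^ 3 := one_le_pow₀ hq'
      have hw : tailsProb δ * warmup δ q ≤ tailsProb δ ^ 2 * (q : ℝ) ^ 4 := by
        have h5 : (warmup δ q : ℝ) ≤ tailsProb δ * (q : ℝ) ^ 4 / 16 := Nat.floor_le (by positivity)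
        have h6 : 0 ≤ tailsProb δ * (q : ℝ) ^ 4 := by positivity
        calc tailsProb δ * warmup δ q ≤ tailsProb δ * (tailsProb δ * (q : ℝ) ^ 4) := by
              gcongr; linarith
          _ = tailsProb δ ^ 2 * (q : ℝ) ^ 4 := by ring
      set x := (q : ℝ) ^ 3
      set z := tailsProb δ ^ 2 * (q : ℝ) ^ 4 with hz
      have hz0 : 0 ≤ z := by positivity
      set L := Real.log (1 / δ)
      have hi : ∀ i ∈ Finset.univ.erase B.best, (2 * x
          + 2 * (6 * Real.log q + tailsProb δ * warmup δ q)
          + (12 * F.V * Real.log ((q : ℝ) ^ 4 + 1) / ε ^ 2 + explG K δ (q ^ 4) / κ i + 2))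
            * B.gap i
          ≤ B.gap i / κ i * L + B.gap i * (16 + 12 * F.V / ε ^ 2 + 1 / κ i) * (x + z) := by
        intro i hi
        have hκ := hs.κ_pos i (Finset.ne_of_mem_erase hi)
        have e1 : 12 * F.V * Real.log ((q : ℝ) ^ 4 + 1) / ε ^ 2 ≤ 12 * F.V / ε ^ 2 * (x + z) := by
          rw [mul_div_right_comm]
          gcongr
          linarith
        have e2 : explG K δ (q ^ 4) / κ i ≤ 1 / κ i * L + 1 / κ i * (x + z) := by
          rw [← mul_add, mul_comm, ← div_eq_mul_one_div]
          gcongr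
          linarith
        have e3 : 2 * x + 2 * (6 * Real.log q + tailsProb δ * warmup δ q)
            + (12 * F.V * Real.log ((q : ℝ) ^ 4 + 1) / ε ^ 2 + explG K δ (q ^ 4) / κ i + 2)
            ≤ 1 / κ i * L + (16 + 12 * F.V / ε ^ 2 + 1 / κ i) * (x + z) := by
          linarith
        refine (mul_le_mul_of_nonneg_right e3 (B.gap_nonneg i)).trans (le_of_eq ?_)
        ring
      calc _ ≤ ∑ i ∈ Finset.univ.erase B.best, (B.gap i / κ i * L
            + B.gap i * (16 + 12 * F.V / ε ^ 2 + 1 / κ i) * (x + z))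
            + K * (√(12 * F.V) * (x + z)) := by
            refine add_le_add (Finset.sum_le_sum hi) ?_
            gcongr
            refine h4.trans ?_
            gcongr
            linarith
        _ = A := by
            rw [hA, hc₁, Finset.sum_add_distrib, ← Finset.sum_mul, ← Finset.sum_mul]
            ring
    have hint : ∫⁻ ω, ENNReal.ofReal (regret B δ Tf Tg ω) ∂(B.prob δ)
        ≤ ENNReal.ofReal (A + 32 * c₂ * c₃ / q) := by
      rw [ENNReal.ofReal_add hA0 (by positivity)]
      exact lintegral_le_of_bad (B.prob δ) _ hc₃0 hbad hq1
        (fun ω => ENNReal.ofReal (regret B δ Tf Tg ω)) hc₂0 hup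
        (fun p hp ω hω => (ENNReal.ofReal_le_ofReal (le_abs_self _)).trans (habs p hp ω hω))
    have hle : ∫ ω, regret B δ Tf Tg ω ∂(B.prob δ) ≤ A + 32 * c₂ * c₃ / q := by
      -- the regret may be negative, and its negative part is dropped
      rw [integral_eq_lintegral_pos_part_sub_lintegral_neg_part hInt]
      refine (sub_le_self _ ENNReal.toReal_nonneg).trans ?_
      exact ENNReal.toReal_le_of_le_ofReal (by positivity) hint
    have h1 := hdiv (32 * c₂ * c₃) (by positivity)
    have h2 : 0 ≤ (32 * c₃ + 32 * c₂ * c₃) * ((q : ℝ) ^ 3 + tailsProb δ ^ 2 * (q : ℝ) ^ 4) := by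
      positivity
    have h3 : 0 ≤ c₁ + 32 * c₃ := by positivity
    rw [hA] at hle
    linarith

end Expectation

/-! ### Asymptotics in the confidence level -/

section Asymptotics

variable {F : ExpFamily} {K : ℕ}

/-- The constants that control how fast an arm is recognized as suboptimal can be taken arbitrarily
close to the divergences. -/
lemma exists_separates (B : Bandit F K) {θ : ℝ} (hθ : 0 < θ) (hθ1 : θ < 1) :
    ∃ D ε, Separates B D ε fun i => (1 - θ) * F.kl (B.μ i) (B.μ B.best) := by
  have hkl : ∀ i, i ≠ B.best → 0 < F.kl (B.μ i) (B.μ B.best) := fun i hi =>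
    F.kl_pos (B.mem_I i) (B.mem_I B.best) (B.lt_best i hi).ne
  have hev : ∀ᶠ ε in 𝓝[>] (0 : ℝ), ∀ i, i ≠ B.best → ε ≤ B.gap i ∧
      ∀ x ≤ B.μ i + ε, ∀ y ∈ F.I, B.μ B.best - ε ≤ y →
        (((1 - θ) * F.kl (B.μ i) (B.μ B.best) : ℝ) : EReal) ≤ F.klExt x y := by
    refine eventually_all.2 fun i => ?_
    by_cases hi : i = B.best
    · exact Eventually.of_forall fun _ h => absurd hi h
    obtain ⟨e, he, h⟩ := F.exists_le_klExt (B.mem_I i) (B.mem_I B.best) (B.lt_best i hi)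
      (k := (1 - θ) * F.kl (B.μ i) (B.μ B.best)) (by nlinarith [hkl i hi])
    have hgap : 0 < B.gap i := sub_pos.2 (B.lt_best i hi)
    filter_upwards [Ioo_mem_nhdsGT he, Ioo_mem_nhdsGT hgap] with ε h1 h2 _
    exact ⟨h2.2.le, fun x hx y hy hxy => h x (hx.trans (by linarith [h1.2])) y hy
      (by linarith [h1.2])⟩
  obtain ⟨ε, hε, h⟩ := (eventually_mem_nhdsWithin.and hev).exists
  exact ⟨ε, ε, hε, fun i hi => (h i hi).1, hε,
    fun i hi => mul_pos (by linarith) (hkl i hi), fun i hi => (h i hi).2⟩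

/-- For a fixed `δ` the probability of tails is a positive constant, so that all large horizons are
long enough. -/
lemma ae_stopTime_lt_top (B : Bandit F K) (hK : 2 ≤ K) (Tf Tg : TieRule K) {δ : ℝ} (hδ : 0 < δ)
    (hδ1 : δ < 1) : ∀ᵐ ω ∂(B.prob δ), stopTime F δ Tf Tg ω < ⊤ := by
  obtain ⟨D, ε, hs⟩ := exists_separates B (θ := 1 / 2) (by norm_num) (by norm_num)
  obtain ⟨C, -, c, -, q₁, h⟩ := exists_expectation_bounds B hK Tf Tg hs
  have hγ := tailsProb_pos δ
  have h1 : Tendsto (fun q : ℕ => tailsProb δ * q) atTop atTop :=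
    tendsto_natCast_atTop_atTop.const_mul_atTop hγ
  have h2 : Tendsto (fun q : ℕ => tailsProb δ * (q : ℝ) ^ 4) atTop atTop :=
    ((tendsto_pow_atTop (by norm_num)).comp tendsto_natCast_atTop_atTop).const_mul_atTop hγ
  obtain ⟨q, hq, hq1, hq2⟩ := ((eventually_ge_atTop q₁).and ((h1.eventually_ge_atTop C).and
    (h2.eventually_ge_atTop (C * Real.log (1 / δ))))).exists
  have hfin := (h δ hδ hδ1 q hq hq1 hq2).1.trans_lt ENNReal.ofReal_lt_top
  have hmeas : Measurable fun ω : Outcome K => (stopTime F δ Tf Tg ω : ℝ≥0∞) :=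
    (measurable_from_top (f := ((↑) : ℕ∞ → ℝ≥0∞))).comp
      (measurable_stopTime (B.nontrivial_I hK))
  filter_upwards [ae_lt_top hmeas hfin.ne] with ω hω
  exact ENat.toENNReal_lt_top.1 hω

lemma tendsto_log_one_div : Tendsto (fun δ : ℝ => Real.log (1 / δ)) (𝓝[>] 0) atTop := by
  simp only [one_div]
  exact Real.tendsto_log_atTop.comp tendsto_inv_nhdsGT_zero

/-- There are horizons `q ^ 4` of order `x * (log x) ^ (3 / 2)`. For `x = log (1 / δ)` this order lies
strictly between the order `x * log x` that is needed to stop and the order `x * (log x) ^ 2` that is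
allowed for the expected stopping time. -/
lemma eventually_exists_horizon : ∀ᶠ x : ℝ in atTop, ∃ q : ℕ, Real.log x ^ 3 ≤ q ∧
    x * Real.log x * √(Real.log x) ≤ (q : ℝ) ^ 4 ∧
    (q : ℝ) ^ 4 ≤ 16 * (x * Real.log x * √(Real.log x)) := by
  -- `q` is the fourth root `s`, rounded up
  have hlog := (Real.isLittleO_pow_log_id_atTop (n := 12)).bound one_pos
  filter_upwards [hlog, Real.tendsto_log_atTop.eventually_ge_atTop 1, eventually_ge_atTop 1]
    with x hx hρ hx1
  set ρ := Real.log x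
  simp only [id, one_mul, Real.norm_eq_abs] at hx
  rw [abs_of_nonneg (by positivity), abs_of_nonneg (by positivity)] at hx
  have hw : 1 ≤ √ρ := Real.one_le_sqrt.2 hρ
  have hle : x ≤ x * ρ * √ρ := by
    rw [mul_assoc]
    exact le_mul_of_one_le_right (by linarith) (one_le_mul_of_one_le_of_one_le hρ hw)
  set z := x * ρ * √ρ
  set s := √√z
  have hs4 : s ^ 4 = z := by
    rw [show s ^ 4 = (s ^ 2) ^ 2 by ring, Real.sq_sqrt (Real.sqrt_nonneg _),
      Real.sq_sqrt (by linarith)]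
  have hs0 : 0 ≤ s := Real.sqrt_nonneg _
  have hs1 : 1 ≤ s := by
    rw [← pow_le_pow_iff_left₀ zero_le_one hs0 (n := 4) (by norm_num), hs4]
    linarith
  have hsq : s ≤ ⌈s⌉₊ := Nat.le_ceil s
  have hqs : (⌈s⌉₊ : ℝ) ≤ 2 * s := by linarith [Nat.ceil_lt_add_one hs0]
  refine ⟨⌈s⌉₊, le_trans ?_ hsq, ?_, ?_⟩
  · rw [← pow_le_pow_iff_left₀ (by positivity) hs0 (n := 4) (by norm_num), hs4, ← pow_mul]
    exact hx.trans hle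
  · rw [← hs4]
    gcongr
  · calc (⌈s⌉₊ : ℝ) ^ 4 ≤ (2 * s) ^ 4 := by gcongr
      _ = 16 * z := by rw [mul_pow, hs4]; norm_num

/-- The bounds for the horizons of order `x * (log x) ^ (3 / 2)` with `x = log (1 / δ)`, for which the
terms of lower order are `O(x / √(log x))`. -/
lemma exists_eventually_bounds (B : Bandit F K) (hK : 2 ≤ K) (Tf Tg : TieRule K) {D ε : ℝ}
    {κ : Fin K → ℝ} (hs : Separates B D ε κ) :
    ∃ c : ℝ, ∀ᶠ δ in 𝓝[>] (0 : ℝ),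
      ∫⁻ ω, (stopTime F δ Tf Tg ω : ℝ≥0∞) ∂(B.prob δ) ≤
        ENNReal.ofReal (c * (Real.log (1 / δ) * √(Real.log (Real.log (1 / δ))) ^ 3)) ∧
      Integrable (regret B δ Tf Tg) (B.prob δ) ∧
      ∫ ω, regret B δ Tf Tg ω ∂(B.prob δ) ≤
        (∑ i ∈ Finset.univ.erase B.best, B.gap i / κ i) * Real.log (1 / δ)
          + c * (Real.log (1 / δ) / √(Real.log (Real.log (1 / δ)))) := by
  obtain ⟨C, -, c, hc, q₁, h⟩ := exists_expectation_bounds B hK Tf Tg hs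
  refine ⟨33 * c + 16, ?_⟩
  have hρ := Real.tendsto_log_atTop.comp tendsto_log_one_div
  have hw := Real.tendsto_sqrt_atTop.comp hρ
  filter_upwards [tendsto_log_one_div.eventually eventually_exists_horizon,
    tendsto_log_one_div.eventually_ge_atTop 1, hρ.eventually_ge_atTop 2,
    hρ.eventually_ge_atTop C, hw.eventually_ge_atTop C, hρ.eventually_ge_atTop (q₁ : ℝ),
    Ioo_mem_nhdsGT (zero_lt_one (α := ℝ))] with δ ⟨q, hq3, hq4, hq4'⟩ hx hρ2 hρC hwC hρq hδ
  simp only [Function.comp_apply] at hρ2 hρC hwC hρq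
  have hγ : tailsProb δ = 1 / Real.log (Real.log (1 / δ)) := by
    have h2 : 1 / Real.log (Real.log (1 / δ)) ≤ 1 / 2 :=
      one_div_le_one_div_of_le (by norm_num) hρ2
    rw [tailsProb, coinBias, if_pos (by linarith), min_eq_left h2, sub_sub_cancel]
  have hρx : Real.log (Real.log (1 / δ)) ≤ Real.log (1 / δ) := Real.log_le_self (by linarith)
  set x := Real.log (1 / δ)
  set ρ := Real.log x
  set w := √ρ
  have hwρ : w ^ 2 = ρ := Real.sq_sqrt (by linarith)
  have hw1 : 1 ≤ w := Real.one_le_sqrt.2 (by linarith)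
  have hρ0 : 0 < ρ := by linarith
  have hwle : w ≤ ρ := by nlinarith
  have hq0 : (0 : ℝ) < q := lt_of_lt_of_le (by positivity) hq3
  have hρ3 : ρ ≤ ρ ^ 3 := le_self_pow₀ (by linarith) (by norm_num)
  have hqq : q₁ ≤ q := by exact_mod_cast hρq.trans (hρ3.trans hq3)
  obtain ⟨hτ, hI, hR⟩ := h δ hδ.1 hδ.2 q hqq
    (by
      rw [hγ, one_div_mul_eq_div, le_div_iff₀ hρ0]
      calc C * ρ ≤ ρ ^ 2 * ρ := by gcongr; nlinarith
        _ = ρ ^ 3 := by ring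
        _ ≤ q := hq3)
    (by
      rw [hγ, one_div_mul_eq_div, le_div_iff₀ hρ0]
      refine le_trans (le_of_eq_of_le ?_ (mul_le_mul_of_nonneg_left hwC (by positivity : 0 ≤ x * ρ)))
        hq4
      ring)
  refine ⟨hτ.trans (ENNReal.ofReal_le_ofReal ?_), hI, hR.trans ?_⟩
  · have h1 : x * w ^ 3 = x * ρ * w := by rw [← hwρ]; ring
    have h2 : 1 ≤ x * w ^ 3 := one_le_mul_of_one_le_of_one_le hx (one_le_pow₀ hw1)
    rw [← h1] at hq4'
    nlinarith
  · have e1 : (q : ℝ) ^ 3 ≤ 16 * (x / w) := by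
      have h1 : (q : ℝ) ^ 4 ≤ 16 * x * ρ ^ 2 := by
        refine hq4'.trans ?_
        calc 16 * (x * ρ * w) ≤ 16 * (x * ρ * ρ) := by gcongr
          _ = 16 * x * ρ ^ 2 := by ring
      have h2 : (q : ℝ) ^ 3 * w ≤ 16 * x := by
        have h3 : (q : ℝ) ^ 3 * w * ρ ^ 2 ≤ 16 * x * ρ ^ 2 := by
          calc (q : ℝ) ^ 3 * w * ρ ^ 2 ≤ (q : ℝ) ^ 3 * ρ * ρ ^ 2 := by gcongr
            _ = (q : ℝ) ^ 3 * ρ ^ 3 := by ring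
            _ ≤ (q : ℝ) ^ 3 * q := by gcongr
            _ = (q : ℝ) ^ 4 := by ring
            _ ≤ _ := h1
        exact le_of_mul_le_mul_right h3 (by positivity)
      rw [← mul_div_assoc, le_div_iff₀ (by linarith)]
      exact h2
    have e2 : tailsProb δ ^ 2 * (q : ℝ) ^ 4 ≤ 16 * (x / w) := by
      rw [hγ]
      calc (1 / ρ) ^ 2 * (q : ℝ) ^ 4 ≤ (1 / ρ) ^ 2 * (16 * (x * ρ * w)) := by gcongr
        _ = 16 * (x / w) := by
          rw [← hwρ]
          field_simp
    have e3 : 1 ≤ x / w := by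
      rw [le_div_iff₀ (by linarith)]
      linarith
    have : c * ((q : ℝ) ^ 3 + tailsProb δ ^ 2 * (q : ℝ) ^ 4) ≤ c * (32 * (x / w)) := by
      gcongr
      linarith
    nlinarith

end Asymptotics

theorem theorem3 (F : ExpFamily) (K : ℕ) (hK : 2 ≤ K) (Tf Tg : TieRule K) :
    -- the algorithm is `δ`-PAC for every confidence level
    (∀ δ : ℝ, 0 < δ → δ < 1 → IsPAC F K δ (stopTime F δ Tf Tg) (recommend F δ Tf Tg)) ∧
    ∀ B : Bandit F K,
      -- the expected regret is well defined for small `δ` and asymptotically optimal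
      (∀ᶠ δ in 𝓝[>] (0 : ℝ), Integrable (regret B δ Tf Tg) (B.prob δ)) ∧
      limsup (fun δ : ℝ =>
          (((∫ ω, regret B δ Tf Tg ω ∂(B.prob δ)) / Real.log (1 / δ) : ℝ) : EReal)) (𝓝[>] (0 : ℝ))
        ≤ (B.hardness : EReal) ∧
      -- the expected stopping time, as an extended nonnegative real
      Tendsto (fun δ : ℝ =>
          (∫⁻ ω, (stopTime F δ Tf Tg ω : ENNReal) ∂(B.prob δ)) /
            ENNReal.ofReal (Real.log (1 / δ) * Real.log (Real.log (1 / δ)) ^ 2))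
        (𝓝[>] (0 : ℝ)) (𝓝 0) := by
  refine ⟨fun δ hδ hδ1 B => ?_, fun B => ?_⟩
  · have hfinite := ae_stopTime_lt_top B hK Tf Tg hδ hδ1
    exact ⟨hfinite, measure_recommend_ne_le B hK hδ hδ1 hfinite⟩
  have hρ := Real.tendsto_log_atTop.comp tendsto_log_one_div
  have hw : Tendsto (fun δ : ℝ => √(Real.log (Real.log (1 / δ)))) (𝓝[>] 0) atTop :=
    Real.tendsto_sqrt_atTop.comp hρ
  obtain ⟨D, ε, hs⟩ := exists_separates B (θ := 1 / 2) (by norm_num) (by norm_num)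
  obtain ⟨c, hc⟩ := exists_eventually_bounds B hK Tf Tg hs
  refine ⟨hc.mono fun δ h => h.2.1, ?_, ?_⟩
  · have hθ : ∀ᶠ θ in 𝓝[>] (0 : ℝ), limsup (fun δ : ℝ =>
          (((∫ ω, regret B δ Tf Tg ω ∂(B.prob δ)) / Real.log (1 / δ) : ℝ) : EReal)) (𝓝[>] (0 : ℝ))
        ≤ ((B.hardness / (1 - θ) : ℝ) : EReal) := by
      filter_upwards [Ioo_mem_nhdsGT (zero_lt_one (α := ℝ))] with θ hθ
      obtain ⟨D, ε, hs⟩ := exists_separates B hθ.1 hθ.2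
      obtain ⟨c, hc⟩ := exists_eventually_bounds B hK Tf Tg hs
      have hsum : ∑ i ∈ Finset.univ.erase B.best,
          B.gap i / ((1 - θ) * F.kl (B.μ i) (B.μ B.best)) = B.hardness / (1 - θ) := by
        rw [Bandit.hardness, Finset.sum_div]
        refine Finset.sum_congr rfl fun i _ => ?_
        rw [div_div, mul_comm]
      have hlim : Tendsto (fun δ : ℝ => ((B.hardness / (1 - θ)
          + c / √(Real.log (Real.log (1 / δ))) : ℝ) : EReal)) (𝓝[>] (0 : ℝ))
          (𝓝 ((B.hardness / (1 - θ) : ℝ) : EReal)) := by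
        refine EReal.tendsto_coe.2 ?_
        simpa using tendsto_const_nhds.add (hw.const_div_atTop c)
      rw [← hlim.limsup_eq]
      refine limsup_le_limsup ?_
      filter_upwards [hc, tendsto_log_one_div.eventually_gt_atTop 0] with δ h hx
      rw [EReal.coe_le_coe_iff, div_le_iff₀ hx]
      refine h.2.2.trans (le_of_eq ?_)
      rw [hsum]
      ring
    refine ge_of_tendsto (EReal.tendsto_coe.2 ?_) hθ
    have : Tendsto (fun θ : ℝ => B.hardness / (1 - θ)) (𝓝 0) (𝓝 (B.hardness / (1 - 0))) :=
      tendsto_const_nhds.div (tendsto_const_nhds.sub tendsto_id) (by norm_num)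
    rw [sub_zero, div_one] at this
    exact this.mono_left nhdsWithin_le_nhds
  · have hlim : Tendsto (fun δ : ℝ => ENNReal.ofReal (c / √(Real.log (Real.log (1 / δ)))))
        (𝓝[>] (0 : ℝ)) (𝓝 0) := by
      rw [← ENNReal.ofReal_zero]
      exact ENNReal.tendsto_ofReal (hw.const_div_atTop c)
    refine tendsto_of_tendsto_of_tendsto_of_le_of_le' tendsto_const_nhds hlim
      (Eventually.of_forall fun _ => bot_le) ?_
    filter_upwards [hc, tendsto_log_one_div.eventually_gt_atTop 0, hρ.eventually_gt_atTop 0]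
      with δ h hx hρ0
    simp only [Function.comp_apply] at hρ0
    refine (ENNReal.div_le_div_right h.1 _).trans (le_of_eq ?_)
    rw [← ENNReal.ofReal_div_of_pos (by positivity)]
    congr 1
    have hw0 : 0 < √(Real.log (Real.log (1 / δ))) := Real.sqrt_pos.2 hρ0
    have hwρ := Real.sq_sqrt hρ0.le
    set w := √(Real.log (Real.log (1 / δ)))
    rw [← hwρ]
    field_simp
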